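/- Let $C$ be a set of $m\ge 3$ candidates and let $V=(v_1,\dots,v_n)$, $n\ge 1$, be a profile of linear orders over $C$ (the sincere votes). Under \emph{2-approval} every voter gives one point to each of the two candidates ranked highest in her vote; the winner $\mathcal R_2(V)$ is the candidate with the highest score, ties being broken by a given linear order $>$ on $C$. Write $\mathrm{top}_2(v)$ for the set of the two top candidates of $v$, and $(V_{-i},v')$ for $V$ with $v_i$ replaced by $v'$. Two votes are \emph{equivalent} if replacing one by the other never changes the 2-approval winner. A vote $v'$ is a \emph{manipulative vote} of voter $i$ if $i$ strictly prefers (according to $v_i$) $\mathcal R_2(V_{-i},v')$ to $\mathcal R_2(V)$; $N$ is the set of voters who have a manipulative vote. A vote $v'$ is a \emph{level-1 strategy} of $i$ if $i$ strictly prefers $\mathcal R_2(V_{-i},v')$ to every other candidate of the form $\mathcal R_2(V_{-i},v'')$, $v''\in\mathcal L(C)$, where $\mathcal L(C)$ is the set of all linear orders over $C$. For $X=\{x_1,\dots,x_\ell\}\subseteq \mathrm{top}_2(v_i)$ and $Y=\{y_1,\dots,y_\ell\}\subseteq C\setminus \mathrm{top}_2(v_i)$, let $v_i[X;Y]$ be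 the vote obtained from $v_i$ by swapping $x_j$ with $y_j$ for every $j$. A manipulative vote $v_i[X;Y]$ of $i$ is \emph{minimal} if every other manipulative vote of $i$ is equivalent to some vote $v_i[X';Y']$ of this form with $|X'|\ge|X|$. A \emph{GS-game} $G=(V,\mathcal R_2,(A_i)_{i\in N})$ has player set $N\cup\{1\}$. Player 1 may submit any vote in $\mathcal L(C)$, and the strategy set $A_i$ of a player $i\in N\setminus\{1\}$ consists of $v_i$ and a (possibly empty) set of level-1 strategies of $i$; voters who are not players vote sincerely, and each player compares strategy profiles by comparing, according to his sincere vote, the winners that they elect. A strategy $u$ of player 1 \emph{weakly dominates} a strategy $v$ of player 1 if, for all strategies of the other players, $u$ elects a winner that player 1 likes at least as much as the winner elected by $v$, and, for some strategies of the other players, one that he strictly prefers. A strategy of player 1 is a \emph{level-2 strategy} if no other strategy of player 1 weakly dominates it, and an \emph{improving strategy} if it weakly dominates $v_1$. Consider GS-games under 2-approval in which, for every $i\in N\setminus\{1\}$, the set $A_i$ consists of $v_i$ and a subset of $i$'s minimal manipulative votes. The input lists explicitly the tie-breaking order, the votes $v_1,\dots,v_n$ and, for each $i\in N\setminus\{1\}$,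 the votes in $A_i$. Then each of the following can be decided by a Turing machine in time polynomial in the length of the input: 1. given such a game $G$ and a vote $v_1'\in\mathcal L(C)$, whether $v_1'$ is a level-2 strategy of player 1 in $G$; 2. given such a game $G$ and a vote $v_1'\in\mathcal L(C)$, whether $v_1'$ is an improving strategy of player 1 in $G$; 3. given such a game $G$, whether player 1 has a level-2 strategy in $G$; 4. given such a game $G$, whether player 1 has an improving strategy in $G$. -/

import Mathlib

namespace GSVoting

/-! ### Votes, profiles and voting rules -/

/-- A linear order over the candidates `Fin m`, written as a ranking: `v r` is the candidate in
position `r`, where position `0` is the top one, and `v.symm c` is the position of `c`. -/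
abbrev Vote (m : ℕ) : Type := Equiv.Perm (Fin m)

/-- `v.Prefers a b`: the vote `v` ranks `a` strictly above `b`. -/
def Vote.Prefers {m : ℕ} (v : Vote m) (a b : Fin m) : Prop := v.symm a < v.symm b

/-- The set of the top `k` candidates of `v`. -/
def Vote.top {m : ℕ} (k : ℕ) (v : Vote m) : Finset (Fin m) :=
  Finset.univ.filter fun c => (v.symm c : ℕ) < k

/-- A preference profile of `n` voters over `m` candidates. -/
abbrev Profile (n m : ℕ) : Type := Fin n → Vote m

/-- A resolute voting rule. -/
abbrev VotingRule (n m : ℕ) : Type := Profile n m → Fin m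

/-- The `k`-approval score of `c` at `V`. -/
def score {n m : ℕ} (k : ℕ) (V : Profile n m) (c : Fin m) : ℕ :=
  (Finset.univ.filter fun i => c ∈ (V i).top k).card

/-- `x` beats `y` at `V` with respect to `k`-approval and the tie-breaking order `tie`. -/
def Beats {n m : ℕ} (k : ℕ) (tie : Vote m) (V : Profile n m) (x y : Fin m) : Prop :=
  score k V y < score k V x ∨ (score k V x = score k V y ∧ tie.Prefers x y)

theorem exists_beats_all {n m : ℕ} (k : ℕ) (hk : k < m) (tie : Vote m) (V : Profile n m) :
    ∃ c, ∀ d, d ≠ c → Beats k tie V c d := by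
  obtain ⟨c, -, hc⟩ := Finset.exists_max_image (Finset.univ : Finset (Fin m))
    (fun c => (toLex (score k V c, OrderDual.toDual (tie.symm c)) : ℕ ×ₗ (Fin m)ᵒᵈ))
    ⟨⟨k, hk⟩, Finset.mem_univ _⟩
  refine ⟨c, fun d hd => ?_⟩
  have h := hc d (Finset.mem_univ _)
  rw [Prod.Lex.toLex_le_toLex] at h
  rcases h with h | ⟨h, h'⟩
  · exact Or.inl h
  · refine Or.inr ⟨h.symm, lt_of_le_of_ne h' ?_⟩
    exact fun e => hd (tie.symm.injective e).symm

/-- The `k`-approval rule, for `k < m`, with ties broken by `tie`: the winner is the (unique)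
candidate who beats all the others. -/
noncomputable def kApproval {n m : ℕ} (k : ℕ) (hk : k < m) (tie : Vote m) : VotingRule n m :=
  fun V => (exists_beats_all k hk tie V).choose

/-! ### Manipulation -/

/-- `v'` is a manipulative vote of voter `i` at `V`. -/
def Manipulative {n m : ℕ} (R : VotingRule n m) (V : Profile n m) (i : Fin n) (v' : Vote m) :
    Prop :=
  (V i).Prefers (R (Function.update V i v')) (R V)

/-- The set `N(V, R)` of Gibbard–Satterthwaite manipulators at `V`. -/
def manipulators {n m : ℕ} (R : VotingRule n m) (V : Profile n m) : Set (Fin n) :=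
  {i | ∃ v', Manipulative R V i v'}

/-- The set `F_i` of candidates that are feasible for `i` at `V`. -/
def feasible {n m : ℕ} (R : VotingRule n m) (V : Profile n m) (i : Fin n) : Set (Fin m) :=
  {c | ∃ v', R (Function.update V i v') = c}

/-- `v'` is a level-1 strategy of voter `i` at `V`: it elects the feasible candidate that `i`
likes best. -/
def IsLevelOne {n m : ℕ} (R : VotingRule n m) (V : Profile n m) (i : Fin n) (v' : Vote m) :
    Prop :=
  ∀ c ∈ feasible R V i, c ≠ R (Function.update V i v') →
    (V i).Prefers (R (Function.update V i v')) c

/-- Two votes are equivalent with respect to `R` if they always have the same effect. -/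
def Equivalent {n m : ℕ} (R : VotingRule n m) (v v' : Vote m) : Prop :=
  ∀ (i : Fin n) (V : Profile n m), R (Function.update V i v) = R (Function.update V i v')

/-- `u = v[X; Y]` for some sets `X = {x_1, …, x_ℓ} ⊆ top_k(v)` and
`Y = {y_1, …, y_ℓ} ⊆ C ∖ top_k(v)` of `ℓ` candidates each: `u` is obtained from `v` by swapping
`x_j` with `y_j` for every `j`. -/
def IsSwap {m : ℕ} (k : ℕ) (v : Vote m) (ℓ : ℕ) (u : Vote m) : Prop :=
  ∃ x y : Fin ℓ → Fin m, Function.Injective x ∧ Function.Injective y ∧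
    (∀ j, x j ∈ v.top k) ∧ (∀ j, y j ∉ v.top k) ∧
    (∀ j, u.symm (x j) = v.symm (y j) ∧ u.symm (y j) = v.symm (x j)) ∧
    ∀ c, (∀ j, c ≠ x j ∧ c ≠ y j) → u.symm c = v.symm c

/-- `v'` is a minimal manipulative vote of voter `i` at `V` under `k`-approval: it is a
manipulative vote `v_i[X; Y]`, and every other manipulative vote of `i` is equivalent to some
`v_i[X'; Y']` with `|X'| ≥ |X|`. -/
def IsMinimalManipulation {n m : ℕ} (k : ℕ) (hk : k < m) (tie : Vote m) (V : Profile n m)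
    (i : Fin n) (v' : Vote m) : Prop :=
  Manipulative (kApproval k hk tie) V i v' ∧
    ∃ ℓ, IsSwap k (V i) ℓ v' ∧
      ∀ v'', v'' ≠ v' → Manipulative (kApproval k hk tie) V i v'' →
        ∃ (u : Vote m) (ℓ' : ℕ), IsSwap k (V i) ℓ' u ∧
          Equivalent (n := n) (kApproval k hk tie) u v'' ∧ ℓ ≤ ℓ'

/-! ### Normal-form games and Gibbard–Satterthwaite games -/

/-- A normal-form game with player set `ι`; `pref i s t` means that player `i` weakly prefers the
strategy profile `s` to `t`. -/
structure NormalFormGame (ι : Type) where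
  Strat : ι → Type
  pref : ι → (∀ i, Strat i) → (∀ i, Strat i) → Prop

/-- The strategy `s` of player `i` weakly dominates the strategy `s'`. -/
def NormalFormGame.WeaklyDominates {ι : Type} [DecidableEq ι] (G : NormalFormGame ι) (i : ι)
    (s s' : G.Strat i) : Prop :=
  (∀ t : ∀ j, G.Strat j, G.pref i (Function.update t i s) (Function.update t i s')) ∧
    ∃ t : ∀ j, G.Strat j, G.pref i (Function.update t i s) (Function.update t i s') ∧
      ¬ G.pref i (Function.update t i s') (Function.update t i s)

/-- A GS-game for the rule `R`, the sincere profile `V` and the level-2 voter `one`. The set `A i`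
is meaningful only for manipulators `i ≠ one`; the strategy set of `one` consists of all votes. -/
structure GSGame {n m : ℕ} (R : VotingRule n m) (V : Profile n m) (one : Fin n) where
  A : Fin n → Set (Vote m)
  truthful_mem : ∀ i ∈ manipulators R V, i ≠ one → V i ∈ A i
  level_one : ∀ i ∈ manipulators R V, i ≠ one → ∀ v ∈ A i, v = V i ∨ IsLevelOne R V i v

namespace GSGame

variable {n m : ℕ} {R : VotingRule n m} {V : Profile n m} {one : Fin n}

/-- The player set `N ∪ {one}`. -/
abbrev Player (_ : GSGame R V one) : Type := {i : Fin n // i ∈ manipulators R V ∨ i = one}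

/-- The strategy set of a player: every vote for `one`, and `A i` for the others. -/
abbrev Strategy (G : GSGame R V one) (i : G.Player) : Type :=
  {v : Vote m // i.1 = one ∨ v ∈ G.A i.1}

open Classical in
/-- The preference profile `V[s]` in which the players vote according to `s` and everybody else
votes sincerely. -/
noncomputable def outcomeProfile (G : GSGame R V one) (s : ∀ i, G.Strategy i) : Profile n m :=
  fun i => if h : i ∈ manipulators R V ∨ i = one then (s ⟨i, h⟩).1 else V i

/-- The normal-form game: strategy profiles are compared through the winners that they elect,
according to the sincere preferences. -/
noncomputable def toGame (G : GSGame R V one) : NormalFormGame G.Player where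
  Strat := G.Strategy
  pref i s t := (V i.1).Prefers (R (G.outcomeProfile s)) (R (G.outcomeProfile t)) ∨
    R (G.outcomeProfile s) = R (G.outcomeProfile t)

/-- The vote `u` of player `one` weakly dominates his vote `v`. -/
def Dominates (G : GSGame R V one) (u v : Vote m) : Prop :=
  G.toGame.WeaklyDominates ⟨one, Or.inr rfl⟩ ⟨u, Or.inl rfl⟩ ⟨v, Or.inl rfl⟩

/-- `v` is a level-2 strategy: no other strategy of player `one` weakly dominates it. -/
def IsLevelTwo (G : GSGame R V one) (v : Vote m) : Prop :=
  ∀ u, u ≠ v → ¬ G.Dominates u v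

/-- `v` is an improving strategy: it weakly dominates the sincere vote of player `one`. -/
def IsImproving (G : GSGame R V one) (v : Vote m) : Prop :=
  G.Dominates v (V one)

end GSGame

/-! ### Problem instances and their encoding -/

/-- An explicitly listed GS-game under 2-approval that satisfies the minimality assumption.
The level-2 player is the first voter. For every manipulator `i` other than him, `A i` lists the
strategies of `i`, in any order; nothing is listed for the remaining voters. -/
structure Instance where
  m : ℕ
  n : ℕ
  hm : 2 < m
  hn : 0 < n
  tie : Vote m
  V : Profile n m
  A : Fin n → List (Vote m)
  truthful_mem : ∀ i ∈ manipulators (kApproval 2 hm tie) V, i ≠ ⟨0, hn⟩ → V i ∈ A i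
  level_one : ∀ i ∈ manipulators (kApproval 2 hm tie) V, i ≠ ⟨0, hn⟩ →
    ∀ v ∈ A i, v = V i ∨ IsLevelOne (kApproval 2 hm tie) V i v
  minimal : ∀ i ∈ manipulators (kApproval 2 hm tie) V, i ≠ ⟨0, hn⟩ →
    ∀ v ∈ A i, v = V i ∨ IsMinimalManipulation 2 hm tie V i v
  not_listed : ∀ i, ¬ (i ∈ manipulators (kApproval 2 hm tie) V ∧ i ≠ ⟨0, hn⟩) → A i = []

/-- The GS-game described by an instance. -/
def Instance.game (I : Instance) : GSGame (kApproval 2 I.hm I.tie) I.V ⟨0, I.hn⟩ where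
  A i := {v | v ∈ I.A i}
  truthful_mem := I.truthful_mem
  level_one := I.level_one

open Computability (Γ')

/-- A candidate, written in binary. -/
def encodeCandidate {m : ℕ} (c : Fin m) : List Γ' :=
  (Computability.encodeNat c).map Γ'.bit ++ [Γ'.comma]

/-- A sequence of words, enclosed in brackets. -/
def encodeBlock (l : List (List Γ')) : List Γ' := Γ'.bra :: (l.flatten ++ [Γ'.ket])

/-- A vote, written as the list of the candidates from the top to the bottom. -/
def encodeVote {m : ℕ} (v : Vote m) : List Γ' :=
  encodeBlock (List.ofFn fun r => encodeCandidate (v r))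

/-- An instance, written as the tie-breaking order, the list of the sincere votes, and the list of
the lists of strategies. -/
def encodeInstance (I : Instance) : List Γ' :=
  encodeVote I.tie ++ encodeBlock (List.ofFn fun i => encodeVote (I.V i)) ++
    encodeBlock (List.ofFn fun i => encodeBlock ((I.A i).map encodeVote))

/-- An instance together with a vote of the level-2 player. -/
abbrev Query : Type := Σ I : Instance, Vote I.m

/-- The encoding of an instance together with a vote. -/
def encodeQuery (q : Query) : List Γ' := encodeInstance q.1 ++ encodeVote q.2

/-- The property `P` of the objects of type `α`, presented to the machine through the encoding
`enc`, is decided by a Turing machine in time polynomial in the length of the input. -/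
def DecidableInPolyTime {α : Type} (enc : α → List Γ') (P : α → Prop) : Prop :=
  ∃ f : α → Bool, (∀ a, f a = true ↔ P a) ∧
    Nonempty (Turing.TM2ComputableInPolyTime enc Computability.encodeBool f)

end GSVoting

/-! ### A while language on stacks and its translation to `TM2` machines -/

/-! Under 2-approval a vote matters only through the pair of candidates that it approves.
Preferences are linear, so `u` dominates `v` iff some selection of votes of the others makes player
1 strictly prefer the winner under `u`, and none makes him strictly prefer the winner under `v`
(`Instance.dominates_iff`). Everything thus rests on one question, asked for polynomially many
quadruples of candidates: can the others vote so that approving `a`, `b` elects some `p`, approving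
`a'`, `b'` elects some `q`, and player 1 prefers `q` to `p`? The third problem is trivial, since
dominance is a strict partial order on a finite set and has an undominated vote
(`Instance.exists_isLevelTwo`).

What makes the question tractable is `Instance.overlap`: any two strategies of a voter approve a
common candidate. A minimal manipulation keeps one sincerely approved candidate, because a
manipulation that replaces both could be replaced by one that keeps one of them. Two minimal
manipulations of a voter are level-1 strategies, hence elect the same candidate, whom both approve.
So a change of strategy moves at most one approval, from one candidate to another.

Guess `p`, `q` and the numbers `k`, `l` of approvals that they get from the others. It remains to
find a selection in which no candidate exceeds an upper bound and `p`, `q` get at least `k`, `l`.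
For the lower bounds, let the voters up to a threshold favour `p` and the others `q`; all these
selections maximise the joint score of `p` and `q`, and moving the threshold by one raises the score
of `p` by at most one, so some threshold satisfies both (`Ballots.exists_threshold`). The upper
bounds are then enforced by shortest augmenting paths. Moving an approval along the first edge of a
shortest path from an overfull candidate to one with room lowers the total excess, or keeps it and
shortens the path (`Ballots.Good.measure_lt`). If no path exists although a candidate is overfull,
the candidates from which no room is reachable form a cut that shows the bounds to be unsatisfiable
(`Ballots.not_good`). Approvals are only taken from overfull candidates, so the lower bounds survive
(`Ballots.Improving.le_score`). The outcome is `Arena.Models.profitable_iff`.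

The machine is obtained through a logic on words: first-order quantifiers over positions, comparison
of sums of numbers of solutions, and iteration of a definable operator on sets of positions as many
times as the word is long. Every formula is evaluated in polynomial time by a structured program on
stacks (`Formula.exists_runsIn`), and such programs become `TM2` machines
(`Prog.decidableInPolyTime`). A finite transducer first marks each input symbol with its role.
Candidates, ballots, thresholds and scores are then positions of the word, and the algorithm is a
formula (`Tag.definable_profitable`). The word is long enough for the required number of rounds
(`Instance.le_length_word`). -/

namespace StackProg

open Function Turing

/-- Structured programs acting on a register of type `σ` and on stacks. -/
inductive Prog {K : Type} (Γ : K → Type) (σ : Type) : Type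
  | push (k : K) (f : σ → Γ k)
  | pop (k : K) (f : σ → Option (Γ k) → σ)
  | peek (k : K) (f : σ → Option (Γ k) → σ)
  | load (f : σ → σ)
  | seq (p q : Prog Γ σ)
  | ite (b : σ → Bool) (p q : Prog Γ σ)
  | loop (b : σ → Bool) (p : Prog Γ σ)

variable {K : Type} {Γ : K → Type} {σ : Type} [DecidableEq K]

/-- `Exec p v S n v' S'`: started with register `v` and stacks `S`, the program `p` stops within
`n` steps with register `v'` and stacks `S'`. -/
inductive Exec : Prog Γ σ → σ → (∀ k, List (Γ k)) → ℕ → σ → (∀ k, List (Γ k)) → Prop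
  | push (k f v S) : Exec (.push k f) v S 1 v (update S k (f v :: S k))
  | pop (k f v S) : Exec (.pop k f) v S 1 (f v (S k).head?) (update S k (S k).tail)
  | peek (k f v S) : Exec (.peek k f) v S 1 (f v (S k).head?) S
  | load (f v S) : Exec (.load f) v S 1 (f v) S
  | seq {p q v S n v' S' m v'' S''} : Exec p v S n v' S' → Exec q v' S' m v'' S'' →
      Exec (.seq p q) v S (n + m) v'' S''
  | ite_true {b : σ → Bool} {p q v S n v' S'} : b v = true → Exec p v S n v' S' →
      Exec (.ite b p q) v S (n + 1) v' S'
  | ite_false {b : σ → Bool} {p q v S n v' S'} : b v = false → Exec q v S n v' S' →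
      Exec (.ite b p q) v S (n + 1) v' S'
  | loop_false {b : σ → Bool} {p v S} : b v = false → Exec (.loop b p) v S 1 v S
  | loop_true {b : σ → Bool} {p v S n v' S' m v'' S''} : b v = true → Exec p v S n v' S' →
      Exec (.loop b p) v' S' m v'' S'' → Exec (.loop b p) v S (n + m + 1) v'' S''
  | weaken {p v S n v' S' m} : Exec p v S n v' S' → n ≤ m → Exec p v S m v' S'

namespace Prog

/-- The stacks that occur in a program. -/
def usedStacks : Prog Γ σ → Finset K
  | push k _ => {k}
  | pop k _ => {k}
  | peek k _ => {k}
  | load _ => ∅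
  | seq p q => p.usedStacks ∪ q.usedStacks
  | ite _ p q => p.usedStacks ∪ q.usedStacks
  | loop _ p => p.usedStacks

/-- The control points of a program. -/
def Label : Prog Γ σ → Type
  | push _ _ => Unit
  | pop _ _ => Unit
  | peek _ _ => Unit
  | load _ => Unit
  | seq p q => p.Label ⊕ q.Label
  | ite _ p q => Unit ⊕ (p.Label ⊕ q.Label)
  | loop _ p => Unit ⊕ p.Label

/-- The control point where a program starts. -/
def start : (p : Prog Γ σ) → p.Label
  | push _ _ => ()
  | pop _ _ => ()
  | peek _ _ => ()
  | load _ => ()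
  | seq p _ => .inl p.start
  | ite _ _ _ => .inl ()
  | loop _ _ => .inl ()

instance fintypeLabel : (p : Prog Γ σ) → Fintype p.Label
  | push _ _ => inferInstanceAs (Fintype Unit)
  | pop _ _ => inferInstanceAs (Fintype Unit)
  | peek _ _ => inferInstanceAs (Fintype Unit)
  | load _ => inferInstanceAs (Fintype Unit)
  | seq p q =>
    letI := fintypeLabel p
    letI := fintypeLabel q
    inferInstanceAs (Fintype (p.Label ⊕ q.Label))
  | ite _ p q =>
    letI := fintypeLabel p
    letI := fintypeLabel q
    inferInstanceAs (Fintype (Unit ⊕ (p.Label ⊕ q.Label)))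
  | loop _ p =>
    letI := fintypeLabel p
    inferInstanceAs (Fintype (Unit ⊕ p.Label))

variable {Λ : Type}

/-- The statements of a machine that executes a program, whose control points are embedded into
the labels of the machine, and then goes to the label `ex`. Only the stacks in `s` are present. -/
def code (s : Finset K) : (p : Prog Γ σ) → (p.Label → Λ) → Λ → p.Label →
    TM2.Stmt (fun k : {k // k ∈ s} => Γ k.1) Λ σ
  | push k f, _, ex, _ =>
    if h : k ∈ s then .push ⟨k, h⟩ f (.goto fun _ => ex) else .goto fun _ => ex
  | pop k f, _, ex, _ =>
    if h : k ∈ s then .pop ⟨k, h⟩ f (.goto fun _ => ex) else .goto fun _ => ex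
  | peek k f, _, ex, _ =>
    if h : k ∈ s then .peek ⟨k, h⟩ f (.goto fun _ => ex) else .goto fun _ => ex
  | load f, _, ex, _ => .load f (.goto fun _ => ex)
  | seq p q, e, ex, l =>
    match l with
    | .inl l => code s p (fun l => e (.inl l)) (e (.inr q.start)) l
    | .inr l => code s q (fun l => e (.inr l)) ex l
  | ite b p q, e, ex, l =>
    match l with
    | .inl _ => .branch b (.goto fun _ => e (.inr (.inl p.start)))
        (.goto fun _ => e (.inr (.inr q.start)))
    | .inr (.inl l) => code s p (fun l => e (.inr (.inl l))) ex l
    | .inr (.inr l) => code s q (fun l => e (.inr (.inr l))) ex l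
  | loop b p, e, ex, l =>
    match l with
    | .inl _ => .branch b (.goto fun _ => e (.inr p.start)) (.goto fun _ => ex)
    | .inr l => code s p (fun l => e (.inr l)) (e (.inl ())) l

end Prog

/-- The configuration `b` is reached from `a` in at most `n` steps. -/
def ReachesIn {α : Type} (f : α → Option α) (n : ℕ) (a b : α) : Prop :=
  ∃ k ≤ n, (flip bind f)^[k] (some a) = some b

theorem ReachesIn.trans {α : Type} {f : α → Option α} {n m : ℕ} {a b c : α}
    (h : ReachesIn f n a b) (h' : ReachesIn f m b c) : ReachesIn f (n + m) a c := by
  obtain ⟨k, hk, e⟩ := h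
  obtain ⟨k', hk', e'⟩ := h'
  exact ⟨k' + k, by omega, by rw [iterate_add_apply, e, e']⟩

theorem ReachesIn.single {α : Type} {f : α → Option α} {a b : α} (h : f a = some b) :
    ReachesIn f 1 a b := ⟨1, le_rfl, h⟩

theorem ReachesIn.mono {α : Type} {f : α → Option α} {n m : ℕ} {a b : α}
    (h : ReachesIn f n a b) (hm : n ≤ m) : ReachesIn f m a b := by
  obtain ⟨k, hk, e⟩ := h
  exact ⟨k, hk.trans hm, e⟩

theorem update_restrict {s : Finset K} (S : ∀ k, List (Γ k)) (k : K) (h : k ∈ s) (l : List (Γ k)) :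
    update (fun j : {k // k ∈ s} => S j.1) ⟨k, h⟩ l =
      fun j : {k // k ∈ s} => update S k l j.1 := by
  funext ⟨j, hj⟩
  by_cases e : j = k
  · subst e; simp
  · rw [update_of_ne (by simpa using e), update_of_ne (by simpa using e)]

/-- Induction on the execution. Only the labels in the image of `e` need to carry the code of `p`,
so the hypothesis passes to subprograms with `e` composed with an injection and a new exit; the exit
of a loop body is the head of the loop. -/
theorem Exec.reaches {Λ : Type} {s : Finset K}
    {M : Λ → TM2.Stmt (fun k : {k // k ∈ s} => Γ k.1) Λ σ} {p : Prog Γ σ} {v S n v' S'}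
    (h : Exec p v S n v' S') (hs : p.usedStacks ⊆ s) (e : p.Label → Λ) (ex : Λ)
    (hM : ∀ l, M (e l) = p.code s e ex l) :
    ReachesIn (TM2.step M) n ⟨some (e p.start), v, fun k => S k.1⟩
      ⟨some ex, v', fun k => S' k.1⟩ := by
  induction h generalizing ex with
  | push k f v S =>
    have hk : k ∈ s := hs (by simp [Prog.usedStacks])
    refine ReachesIn.single ?_
    rw [TM2.step, hM]
    simp [Prog.code, hk, update_restrict]
  | pop k f v S =>
    have hk : k ∈ s := hs (by simp [Prog.usedStacks])
    refine ReachesIn.single ?_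
    rw [TM2.step, hM]
    simp [Prog.code, hk, update_restrict]
  | peek k f v S =>
    have hk : k ∈ s := hs (by simp [Prog.usedStacks])
    refine ReachesIn.single ?_
    rw [TM2.step, hM]
    simp [Prog.code, hk]
  | load f v S =>
    refine ReachesIn.single ?_
    rw [TM2.step, hM]
    simp [Prog.code]
  | seq _ _ ih ih' =>
    simp only [Prog.usedStacks] at hs
    exact (ih (Finset.union_subset_left hs) (fun l => e (.inl l)) _ fun l => hM (.inl l)).trans
      (ih' (Finset.union_subset_right hs) (fun l => e (.inr l)) ex fun l => hM (.inr l))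
  | @ite_true b p q v S _ _ _ hb _ ih =>
    simp only [Prog.usedStacks] at hs
    rw [add_comm]
    refine (ReachesIn.single ?_).trans (ih (Finset.union_subset_left hs)
      (fun l => e (.inr (.inl l))) ex fun l => hM (.inr (.inl l)))
    rw [TM2.step, hM]
    simp [Prog.code, Prog.start, hb]
  | ite_false hb _ ih =>
    simp only [Prog.usedStacks] at hs
    rw [add_comm]
    refine (ReachesIn.single ?_).trans (ih (Finset.union_subset_right hs)
      (fun l => e (.inr (.inr l))) ex fun l => hM (.inr (.inr l)))
    rw [TM2.step, hM]
    simp [Prog.code, Prog.start, hb]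
  | loop_false hb =>
    refine ReachesIn.single ?_
    rw [TM2.step, hM]
    simp [Prog.code, Prog.start, hb]
  | @loop_true b p v S n _ _ m _ _ hb _ _ ih ih' =>
    have : n + m + 1 = 1 + (n + m) := by omega
    rw [this]
    refine (ReachesIn.single ?_).trans ((ih (by simpa only [Prog.usedStacks] using hs)
      (fun l => e (.inr l)) (e (.inl ())) fun l => hM (.inr l)).trans (ih' hs e ex hM))
    rw [TM2.step, hM]
    simp [Prog.code, Prog.start, hb]
  | weaken _ hm ih => exact (ih hs e ex hM).mono hm

/-- A program that, started with the input on the stack `inp`, stops after polynomial time with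
empty stacks and the answer in the register, gives a polynomial-time machine. -/
theorem Prog.decidableInPolyTime {α A : Type} {enc : α → List A} (p : Prog Γ σ) [Fintype σ]
    (inp out : K) (ne : inp ≠ out) (init : σ) (eI : Γ inp ≃ A) [Fintype A] (eO : Γ out ≃ Bool)
    (bit : σ → Bool) (f : α → Bool) (P : Polynomial ℕ)
    (h : ∀ a, ∃ v, bit v = f a ∧ Exec p init (update (fun _ => []) inp ((enc a).map eI.symm))
      (P.eval (enc a).length) v (fun _ => [])) :
    Nonempty (TM2ComputableInPolyTime enc Computability.encodeBool f) := by
  classical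
  -- `K` may be infinite, whereas a machine has finitely many stacks; only those that matter are
  -- kept.
  let s : Finset K := insert inp (insert out p.usedStacks)
  have hi : inp ∈ s := by simp [s]
  have ho : out ∈ s := by simp [s]
  have hs : p.usedStacks ⊆ s := fun k hk => by simp [s, hk]
  -- The additional label `none` writes the answer and resets the register, because a halting
  -- configuration must carry the initial register.
  let M : Option p.Label → TM2.Stmt (fun k : {k // k ∈ s} => Γ k.1) (Option p.Label) σ
    | none => .push ⟨out, ho⟩ (fun v => eO.symm (bit v)) (.load (fun _ => init) .halt)
    | some l => p.code s some none l
  let tm : FinTM2 :=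
    { K := {k // k ∈ s}
      k₀ := ⟨inp, hi⟩
      k₁ := ⟨out, ho⟩
      Γ := fun k => Γ k.1
      Λ := Option p.Label
      main := some p.start
      ΛFin := inferInstance
      σ := σ
      initialState := init
      Γk₀Fin := Fintype.ofEquiv A eI.symm
      m := M }
  refine ⟨⟨⟨tm, eI, eO⟩, P + 1, fun a => ?_⟩⟩
  have key : ∃ k ≤ P.eval (enc a).length + 1, (flip bind (TM2.step M))^[k]
      (some (initList tm ((enc a).map eI.symm))) =
        some (haltList tm ((Computability.encodeBool (f a)).map eO.symm)) := by
    obtain ⟨v, hv, hx⟩ := h a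
    refine ReachesIn.trans (b := ⟨some none, v, fun k => []⟩) ?_ (ReachesIn.single ?_)
    · have hx := hx.reaches hs (M := M) some none fun l => rfl
      suffices e : initList tm ((enc a).map eI.symm) = ⟨some (some p.start), init, fun k =>
          update (fun _ => []) inp ((enc a).map eI.symm) k.1⟩ by
        rw [e]; exact hx
      refine congrArg (TM2.Cfg.mk _ _) (funext fun ⟨k, hk⟩ => ?_)
      by_cases e : k = inp
      · subst e
        simp [tm]
      · rw [update_of_ne e]
        exact dif_neg (by simpa [tm] using e)
    · simp only [TM2.step, M, TM2.stepAux]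
      refine congrArg some ?_
      refine congrArg (TM2.Cfg.mk _ _) (funext fun ⟨k, hk⟩ => ?_)
      by_cases e : k = out
      · subst e
        simp [tm, hv, Computability.encodeBool]
      · rw [update_of_ne (by simpa using e)]
        have e' : ¬ (⟨k, hk⟩ : {k // k ∈ s}) = tm.k₁ := by simpa [tm] using e
        rw [dif_neg e']
  exact ⟨⟨key.choose, key.choose_spec.2⟩, by simpa using key.choose_spec.1⟩

end StackProg

/-! ### A logic on words -/

namespace StackProg

open Function

/-- The extension of an assignment by a value for the new variable. -/
abbrev cons {α γ : Type} (x : γ) (e : α → γ) : Option α → γ := fun o => o.elim x e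

/-- Formulas about a word with letters in `Sig`; their free variables are pointers `α` to
positions of the word, and sets `β` of positions. -/
inductive Formula (Sig : Type) : Type → Type → Type 1
  /-- The letter at position `a` has property `p`. -/
  | letter {α β : Type} (p : Sig → Bool) (a : α) : Formula Sig α β
  | lt {α β : Type} (a b : α) : Formula Sig α β
  | mem {α β : Type} (s : β) (a : α) : Formula Sig α β
  | neg {α β : Type} (φ : Formula Sig α β) : Formula Sig α β
  | and {α β : Type} (φ ψ : Formula Sig α β) : Formula Sig α β
  | ex {α β : Type} (φ : Formula Sig (Option α) β) : Formula Sig α β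
  /-- The number of solutions of `φ₁` plus that of `φ₂` is at most that of `ψ₁` plus that of
  `ψ₂`. -/
  | le {α β : Type} (φ₁ φ₂ ψ₁ ψ₂ : Formula Sig (Option α) β) : Formula Sig α β
  /-- `ψ` holds of the set that is obtained from `∅` by iterating the operator defined by `φ` as
  often as the word has positions; `φ` may refer to the number of the round. -/
  | iter {α β : Type} (φ : Formula Sig (Option (Option α)) (Option β))
      (ψ : Formula Sig α (Option β)) : Formula Sig α β

namespace Formula

variable {Sig : Type}

/-- The iterates, from `∅`, of an operator that depends on the number of the round. -/
def iterate (F : ℕ → Set ℕ → Set ℕ) : ℕ → Set ℕ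
  | 0 => ∅
  | y + 1 => F y (iterate F y)

/-- The number of `x < n` with the property `P`. -/
noncomputable def count (n : ℕ) (P : ℕ → Prop) : ℕ := by
  classical exact Nat.count P n

/-- The semantics of formulas. -/
def eval (w : List Sig) : {α β : Type} → Formula Sig α β → (α → ℕ) → (β → Set ℕ) → Prop
  | _, _, letter p a, e, _ => ∃ s, w[e a]? = some s ∧ p s = true
  | _, _, lt a b, e, _ => e a < e b
  | _, _, mem s a, e, X => e a ∈ X s
  | _, _, neg φ, e, X => ¬ φ.eval w e X
  | _, _, and φ ψ, e, X => φ.eval w e X ∧ ψ.eval w e X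
  | _, _, ex φ, e, X => ∃ x < w.length, φ.eval w (cons x e) X
  | _, _, le φ₁ φ₂ ψ₁ ψ₂, e, X =>
    count w.length (fun x => φ₁.eval w (cons x e) X) +
      count w.length (fun x => φ₂.eval w (cons x e) X) ≤
    count w.length (fun x => ψ₁.eval w (cons x e) X) +
      count w.length (fun x => ψ₂.eval w (cons x e) X)
  | _, _, iter φ ψ, e, X =>
    ψ.eval w e (cons (iterate (fun y Y =>
      {x | x < w.length ∧ φ.eval w (cons x (cons y e)) (cons Y X)}) w.length) X)

/-- The number of additional pointers that are needed to evaluate a formula. -/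
def depth : {α β : Type} → Formula Sig α β → ℕ
  | _, _, letter _ _ => 0
  | _, _, lt _ _ => 0
  | _, _, mem _ _ => 0
  | _, _, neg φ => φ.depth
  | _, _, and φ ψ => max φ.depth ψ.depth
  | _, _, ex φ => φ.depth + 1
  | _, _, le φ₁ φ₂ ψ₁ ψ₂ => max (max φ₁.depth φ₂.depth) (max ψ₁.depth ψ₂.depth) + 1
  | _, _, iter φ ψ => max (φ.depth + 2) ψ.depth

end Formula

/-! ### Evaluation of formulas by programs -/

/-- The stacks used for the evaluation: the input, the output, the two halves of the word seen from
each pointer, and stacks of bits. -/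
inductive Stk
  | inp
  | out
  | left (i : ℕ)
  | right (i : ℕ)
  | work (j : ℕ)
  deriving DecidableEq

/-- The alphabets of the stacks. -/
abbrev Stk.Alphabet (A Sig : Type) : Stk → Type
  | inp => A
  | out => Bool
  | left _ => Sig
  | right _ => Sig
  | work _ => Bool

/-- The register. -/
structure Reg (Q Sig : Type) where
  bit : Bool
  flag : Bool
  sym : Option Sig
  q : Q

instance (Q Sig : Type) [Fintype Q] [Fintype Sig] : Fintype (Reg Q Sig) :=
  Fintype.ofEquiv (Bool × Bool × Option Sig × Q)
    { toFun := fun x => ⟨x.1, x.2.1, x.2.2.1, x.2.2.2⟩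
      invFun := fun x => ⟨x.bit, x.flag, x.sym, x.q⟩
      left_inv := fun _ => rfl
      right_inv := fun _ => rfl }

/-- The state between two parts of the evaluation: a result bit, the positions of the pointers and
the stacks of bits. -/
structure State where
  bit : Bool
  pos : ℕ → ℕ
  work : ℕ → List Bool

variable {A Sig Q : Type}

/-- The stacks that represent a state, when `D` pointers are in use. -/
def State.stk (w : List Sig) (D : ℕ) (c : State) : (k : Stk) → List (k.Alphabet A Sig)
  | .inp => []
  | .out => []
  | .left i => if i < D then (w.take (c.pos i)).reverse else []
  | .right i => if i < D then w.drop (c.pos i) else []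
  | .work j => c.work j

/-- The program `p` leads from the state `c` to the state `c'` within `n` steps. -/
def Run (w : List Sig) (D : ℕ) (q : Q) (p : Prog (Stk.Alphabet A Sig) (Reg Q Sig)) (n : ℕ)
    (c c' : State) : Prop :=
  Exec p ⟨c.bit, false, none, q⟩ (c.stk w D) n ⟨c'.bit, false, none, q⟩ (c'.stk w D)

namespace Prog

/-- Move a pointer to the right. -/
def moveRight [Inhabited Sig] (i : ℕ) : Prog (Stk.Alphabet A Sig) (Reg Q Sig) :=
  .seq (.pop (.right i) fun v o => { v with sym := o })
    (.seq (.push (.left i) fun v => v.sym.getD default) (.load fun v => { v with sym := none }))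

/-- Move a pointer to the left. -/
def moveLeft [Inhabited Sig] (i : ℕ) : Prog (Stk.Alphabet A Sig) (Reg Q Sig) :=
  .seq (.pop (.left i) fun v o => { v with sym := o })
    (.seq (.push (.right i) fun v => v.sym.getD default) (.load fun v => { v with sym := none }))

/-- Push a function of the result bit. -/
def pushBit (j : ℕ) (f : Bool → Bool) : Prog (Stk.Alphabet A Sig) (Reg Q Sig) :=
  .push (.work j) fun v => f v.bit

/-- Pop a bit and combine it with the result bit. -/
def popBit (j : ℕ) (f : Bool → Option Bool → Bool) : Prog (Stk.Alphabet A Sig) (Reg Q Sig) :=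
  .pop (.work j) fun v o => { v with bit := f v.bit o }

/-- Combine the top of a stack of bits with the result bit. -/
def peekBit (j : ℕ) (f : Bool → Option Bool → Bool) : Prog (Stk.Alphabet A Sig) (Reg Q Sig) :=
  .peek (.work j) fun v o => { v with bit := f v.bit o }

/-- Change the result bit. -/
def setBit (f : Bool → Bool) : Prog (Stk.Alphabet A Sig) (Reg Q Sig) :=
  .load fun v => { v with bit := f v.bit }

/-- Move a bit from a stack to another one. -/
def transfer (j j' : ℕ) : Prog (Stk.Alphabet A Sig) (Reg Q Sig) :=
  .seq (.pop (.work j) fun v o => { v with flag := o.getD false })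
    (.seq (.push (.work j') fun v => v.flag) (.load fun v => { v with flag := false }))

/-- Repeat `p` as long as the test `t`, which sets the flag, succeeds. -/
def repeatWhile (t p : Prog (Stk.Alphabet A Sig) (Reg Q Sig)) :
    Prog (Stk.Alphabet A Sig) (Reg Q Sig) :=
  .seq t (.seq (.loop (fun v => v.flag) (.seq (.load fun v => { v with flag := false })
    (.seq p t))) (.load fun v => { v with flag := false }))

/-- Test a property of the top of a stack. -/
def test (k : Stk) (f : Option (k.Alphabet A Sig) → Bool) :
    Prog (Stk.Alphabet A Sig) (Reg Q Sig) :=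
  .peek k fun v o => { v with flag := f o }

/-- Run `p` for every position of the pointer `i`. -/
def forAll [Inhabited Sig] (i : ℕ) (p : Prog (Stk.Alphabet A Sig) (Reg Q Sig)) :
    Prog (Stk.Alphabet A Sig) (Reg Q Sig) :=
  .seq (repeatWhile (test (.right i) Option.isSome) (.seq p (moveRight i)))
    (repeatWhile (test (.left i) Option.isSome) (moveLeft i))

/-- Remove all the elements of a stack of bits. -/
def clear (j : ℕ) : Prog (Stk.Alphabet A Sig) (Reg Q Sig) :=
  repeatWhile (test (.work j) Option.isSome) (popBit j fun b _ => b)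

/-- Move all the elements of a stack of bits to another one. -/
def transferAll (j j' : ℕ) : Prog (Stk.Alphabet A Sig) (Reg Q Sig) :=
  repeatWhile (test (.work j) Option.isSome) (transfer j j')

end Prog

variable {w : List Sig} {D : ℕ} {q : Q} {p p' : Prog (Stk.Alphabet A Sig) (Reg Q Sig)}
  {n m : ℕ} {c c' c'' : State}

theorem Run.exec (h : Run w D q p n c c') :
    Exec p ⟨c.bit, false, none, q⟩ (c.stk w D) n ⟨c'.bit, false, none, q⟩ (c'.stk w D) := h

theorem Run.weaken (h : Run w D q p n c c') (hm : n ≤ m) : Run w D q p m c c' :=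
  Exec.weaken h hm

theorem Run.seq (h : Run w D q p n c c') (h' : Run w D q p' m c' c'') :
    Run w D q (.seq p p') (n + m) c c'' := Exec.seq h h'

/-- The state `c` with the stack `j` of bits replaced by `l`. -/
def State.setWork (c : State) (j : ℕ) (l : List Bool) : State :=
  { c with work := update c.work j l }

/-- The state `c` with the pointer `i` moved to `x`. -/
def State.setPos (c : State) (i x : ℕ) : State :=
  { c with pos := update c.pos i x }

/-- The state `c` with a new result bit. -/
def State.setBit (c : State) (b : Bool) : State :=
  { c with bit := b }

theorem State.stk_setWork (c : State) (j : ℕ) (l : List Bool) :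
    (c.setWork j l).stk w D = update (c.stk (A := A) w D) (.work j) l := by
  funext k
  cases k with
  | work i =>
    by_cases h : i = j
    · subst h; simp [State.stk, State.setWork]
    · rw [update_of_ne (by simpa using h)]
      simp [State.stk, State.setWork, h]
  | _ => rw [update_of_ne (by simp)]; rfl

theorem State.stk_setBit (c : State) (b : Bool) :
    (c.setBit b).stk w D = c.stk (A := A) w D := by
  funext k
  cases k <;> rfl

theorem State.stk_setPos (c : State) (i x : ℕ) (hi : i < D) :
    (c.setPos i x).stk w D = update (update (c.stk (A := A) w D) (.left i) (w.take x).reverse)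
      (.right i) (w.drop x) := by
  funext k
  cases k with
  | left j =>
    rw [update_of_ne (by simp)]
    by_cases h : j = i
    · subst h; simp [State.stk, State.setPos, hi]
    · rw [update_of_ne (by simpa using h)]
      simp [State.stk, State.setPos, h]
  | right j =>
    by_cases h : j = i
    · subst h; simp [State.stk, State.setPos, hi]
    · rw [update_of_ne (by simpa using h), update_of_ne (by simp)]
      simp [State.stk, State.setPos, h]
  | _ => rw [update_of_ne (by simp), update_of_ne (by simp)]; rfl

theorem Exec.congr {K : Type} {Γ : K → Type} {σ : Type} [DecidableEq K] {p : Prog Γ σ} {v S n v' S' v₁ S₁}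
    (h : Exec p v S n v' S') (hv : v' = v₁) (hS : S' = S₁) : Exec p v S n v₁ S₁ := by
  subst hv hS
  exact h

theorem run_pushBit (j : ℕ) (f : Bool → Bool) :
    Run w D q (.pushBit (A := A) j f) 1 c (c.setWork j (f c.bit :: c.work j)) := by
  unfold Run
  rw [State.stk_setWork]
  exact Exec.push _ _ _ _

theorem run_setBit (f : Bool → Bool) :
    Run w D q (.setBit (A := A) f) 1 c (c.setBit (f c.bit)) := by
  unfold Run
  rw [State.stk_setBit]
  exact Exec.load _ _ _

theorem run_popBit (j : ℕ) (f : Bool → Option Bool → Bool) :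
    Run w D q (.popBit (A := A) j f) 1 c
      ((c.setWork j (c.work j).tail).setBit (f c.bit (c.work j).head?)) := by
  unfold Run
  rw [State.stk_setBit, State.stk_setWork]
  exact Exec.pop _ _ _ _

theorem run_peekBit (j : ℕ) (f : Bool → Option Bool → Bool) :
    Run w D q (.peekBit (A := A) j f) 1 c (c.setBit (f c.bit (c.work j).head?)) := by
  unfold Run
  rw [State.stk_setBit]
  exact Exec.peek _ _ _ _

theorem run_transfer {j j' : ℕ} {b : Bool} {l : List Bool} (h : c.work j = b :: l) (hj : j' ≠ j) :
    Run w D q (.transfer (A := A) j j') 3 c ((c.setWork j l).setWork j' (b :: c.work j')) := by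
  unfold Run
  have e : (c.setWork j l).setWork j' (b :: c.work j') =
      (c.setWork j l).setWork j' (b :: (c.setWork j l).work j') := by
    simp [State.setWork, hj]
  rw [e, State.stk_setWork]
  refine Exec.seq (n := 1) (m := 2) (v' := ⟨c.bit, b, none, q⟩)
    (S' := (c.setWork j l).stk w D) ?_ (Exec.seq (n := 1) (m := 1) (Exec.push _ _ _ _)
      (Exec.load _ _ _))
  rw [State.stk_setWork]
  exact (Exec.pop _ _ _ _).congr (by simp [State.stk, h]) (by simp [State.stk, h])

theorem run_moveRight [Inhabited Sig] {i : ℕ} (hi : i < D) (hx : c.pos i < w.length) :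
    Run w D q (.moveRight (A := A) i) 3 c (c.setPos i (c.pos i + 1)) := by
  unfold Run
  rw [State.stk_setPos _ _ _ hi]
  have e : c.stk (A := A) w D (.right i) = w[c.pos i] :: w.drop (c.pos i + 1) := by
    simp [State.stk, hi]
  have e' : c.stk (A := A) w D (.left i) = (w.take (c.pos i)).reverse := by
    simp [State.stk, hi]
  refine Exec.seq (n := 1) (m := 2) (Exec.pop _ _ _ _) (Exec.seq (n := 1) (m := 1)
    (Exec.push _ _ _ _) ((Exec.load _ _ _).congr rfl ?_))
  rw [e, update_of_ne (by simp), e', update_comm (by simp)]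
  rw [← List.take_concat_get' w (c.pos i) hx, List.reverse_append]
  simp [hx]

theorem run_moveLeft [Inhabited Sig] {i x : ℕ} (hi : i < D) (hx : x < w.length)
    (h : c.pos i = x + 1) : Run w D q (.moveLeft (A := A) i) 3 c (c.setPos i x) := by
  unfold Run
  rw [State.stk_setPos _ _ _ hi]
  have e : c.stk (A := A) w D (.left i) = w[x] :: (w.take x).reverse := by
    simp only [State.stk, hi, h, if_true]
    rw [← List.take_concat_get' w x hx]
    simp
  have e' : c.stk (A := A) w D (.right i) = w.drop (x + 1) := by
    simp [State.stk, hi, h]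
  refine Exec.seq (n := 1) (m := 2) (Exec.pop _ _ _ _) (Exec.seq (n := 1) (m := 1)
    (Exec.push _ _ _ _) ((Exec.load _ _ _).congr rfl ?_))
  rw [e, update_of_ne (by simp), e']
  simp

/-- The state `c` passes the test `t` iff `b`. -/
def Test (w : List Sig) (D : ℕ) (q : Q) (t : Prog (Stk.Alphabet A Sig) (Reg Q Sig)) (n : ℕ)
    (c : State) (b : Bool) : Prop :=
  Exec t ⟨c.bit, false, none, q⟩ (c.stk w D) n ⟨c.bit, b, none, q⟩ (c.stk w D)

/-- `s j` is the state after `j` rounds. A round costs the body, the test, the branch of the loop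
and the reset of the flag; the reset lets the body start with a clear flag, as `Run` demands. -/
theorem run_repeatWhile {t : Prog (Stk.Alphabet A Sig) (Reg Q Sig)} {s : ℕ → State} {N d : ℕ}
    (ht : ∀ j < N, Test w D q t d (s j) true) (hN : Test w D q t d (s N) false)
    (hp : ∀ j < N, Run w D q p n (s j) (s (j + 1))) :
    Run w D q (.repeatWhile t p) ((n + d + 2) * N + (d + 2)) (s 0) (s N) := by
  -- Here `j` is the number of rounds that remain; the preceding test has set the flag iff `j ≠ 0`.
  have key : ∀ j ≤ N, Exec (.loop (fun v => v.flag) (.seq (.load fun v => { v with flag := false })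
      (.seq p t))) ⟨(s (N - j)).bit, decide (j ≠ 0), none, q⟩ ((s (N - j)).stk w D)
      ((n + d + 2) * j + 1) ⟨(s N).bit, false, none, q⟩ ((s N).stk w D) := by
    intro j
    induction j with
    | zero => exact fun _ => (Exec.loop_false (by simp)).weaken (by simp)
    | succ j ih =>
      intro hj
      have ih := ih (by omega)
      have e : N - (j + 1) + 1 = N - j := by omega
      have hp := hp (N - (j + 1)) (by omega)
      rw [e] at hp
      refine (Exec.loop_true (n := 1 + (n + d)) (m := (n + d + 2) * j + 1) (by simp)
        (Exec.seq (Exec.load _ _ _) (Exec.seq hp.exec ?_)) ih).weaken (by ring_nf; omega)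
      by_cases h : j = 0
      · subst h
        simpa [Test] using hN
      · have := ht (N - j) (by omega)
        simpa [Test, h] using this
  have key := key N le_rfl
  rw [Nat.sub_self] at key
  have first : Exec t ⟨(s 0).bit, false, none, q⟩ ((s 0).stk w D) d
      ⟨(s 0).bit, decide (N ≠ 0), none, q⟩ ((s 0).stk w D) := by
    by_cases h : N = 0
    · subst h
      simpa [Test] using hN
    · have := ht 0 (by omega)
      simpa [Test, h] using this
  exact (Exec.seq first (Exec.seq key (Exec.load _ _ _))).weaken (by omega)

theorem test_test (k : Stk) (f : Option (k.Alphabet A Sig) → Bool) :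
    Test w D q (.test k f) 1 c (f (c.stk w D k).head?) :=
  Exec.peek _ _ _ _

@[simp] theorem State.setPos_setPos (c : State) (i x y : ℕ) :
    (c.setPos i x).setPos i y = c.setPos i y := by simp [State.setPos]

@[simp] theorem State.setPos_self (c : State) (i : ℕ) : c.setPos i (c.pos i) = c := by
  simp [State.setPos]

theorem State.setPos_of_eq {c : State} {i x : ℕ} (h : c.pos i = x) : c.setPos i x = c := by
  simp [← h]

@[simp] theorem State.setPos_pos (c : State) (i x : ℕ) : (c.setPos i x).pos i = x := by
  simp [State.setPos]

@[simp] theorem State.setWork_self (c : State) (i : ℕ) : c.setWork i (c.work i) = c := by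
  simp [State.setWork]

theorem State.setWork_of_eq {c : State} {j : ℕ} {l : List Bool} (h : c.work j = l) :
    c.setWork j l = c := by
  simp [← h]

@[simp] theorem State.setWork_work (c : State) (i : ℕ) (x : List Bool) :
    (c.setWork i x).work i = x := by
  simp [State.setWork]

/-- Loop over all the positions: `F x` is the state before the round `x`, with the pointer at the
beginning. -/
theorem run_forAll [Inhabited Sig] {i : ℕ} (hi : i < D) (F : ℕ → State)
    (hF : ∀ x ≤ w.length, (F x).pos i = 0)
    (hp : ∀ x < w.length, Run w D q p n ((F x).setPos i x) ((F (x + 1)).setPos i x)) :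
    Run w D q (.forAll i p) ((n + 12) * w.length + 6) (F 0) (F w.length) := by
  have h1 : Run w D q (.repeatWhile (.test (.right i) Option.isSome) (.seq p (.moveRight i)))
      ((n + 3 + 1 + 2) * w.length + (1 + 2)) ((F 0).setPos i 0)
      ((F w.length).setPos i w.length) := by
    refine run_repeatWhile (s := fun x => (F x).setPos i x) (n := n + 3) (d := 1) (fun x hx => ?_) ?_ fun x hx => ?_
    · convert test_test (A := A) (.right i) Option.isSome
      simp [State.stk, hi, hx]
    · convert test_test (A := A) (.right i) Option.isSome
      simp [State.stk, hi]
    · refine (hp x hx).seq ?_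
      have := run_moveRight (A := A) (q := q) (w := w) (c := (F (x + 1)).setPos i x) hi
        (by simpa using hx)
      simpa using this
  have h2 : Run w D q (.repeatWhile (.test (A := A) (.left i) Option.isSome) (.moveLeft i))
      ((3 + 1 + 2) * w.length + (1 + 2)) ((F w.length).setPos i w.length)
      ((F w.length).setPos i 0) := by
    have := run_repeatWhile (A := A) (w := w) (D := D) (q := q) (p := .moveLeft i)
      (t := .test (.left i) Option.isSome) (n := 3) (d := 1)
      (s := fun x => (F w.length).setPos i (w.length - x)) (N := w.length)
      (fun x hx => ?_) ?_ fun x hx => ?_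
    · simpa using this
    · convert test_test (A := A) (.left i) Option.isSome
      have : ¬ (w.length ≤ x ∨ w = []) := by
        rintro (h | rfl)
        · omega
        · simp at hx
      simp only [State.stk, hi, State.setPos_pos, if_true]
      rw [Eq.comm, List.isSome_head?]
      simpa [or_comm, Nat.sub_eq_zero_iff_le] using this
    · convert test_test (A := A) (.left i) Option.isSome
      simp [State.stk, hi]
    · have := run_moveLeft (A := A) (q := q) (w := w) (c := (F w.length).setPos i (w.length - x))
        (x := w.length - (x + 1)) hi (by omega) (by simp; omega)
      simpa using this
  have e0 : (F 0).setPos i 0 = F 0 := by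
    conv_rhs => rw [← (F 0).setPos_self i, hF 0 (by omega)]
  have e1 : (F w.length).setPos i 0 = F w.length := by
    conv_rhs => rw [← (F w.length).setPos_self i, hF _ le_rfl]
  rw [e0] at h1
  rw [e1] at h2
  exact (h1.seq h2).weaken (by ring_nf; omega)

theorem run_clear (j : ℕ) {N : ℕ} (hN : (c.work j).length ≤ N) :
    Run w D q (.clear (A := A) j) (4 * N + 3) c (c.setWork j []) := by
  have := run_repeatWhile (A := A) (w := w) (D := D) (q := q) (p := .popBit j fun b _ => b)
    (t := .test (.work j) Option.isSome) (n := 1) (d := 1)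
    (s := fun x => c.setWork j ((c.work j).drop x)) (N := (c.work j).length)
    (fun x hx => ?_) ?_ fun x hx => ?_
  · refine Run.weaken (n := (1 + 1 + 2) * (c.work j).length + (1 + 2)) ?_ (by omega)
    simpa [Prog.clear] using this
  · convert test_test (A := A) (.work j) Option.isSome
    simp [State.stk, hx]
  · convert test_test (A := A) (.work j) Option.isSome
    simp [State.stk]
  · convert run_popBit (A := A) (w := w) (D := D) (q := q) j (fun b _ => b) using 1
    simp [State.setBit, State.setWork]

/-- The bits arrive in reverse order. The iteration of operators relies on this, since it writes new
sets in reverse. -/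
theorem run_transferAll {j j' : ℕ} (hj : j' ≠ j) {N : ℕ} (hN : (c.work j).length ≤ N) :
    Run w D q (.transferAll (A := A) j j') (6 * N + 3) c
      ((c.setWork j []).setWork j' ((c.work j).reverse ++ c.work j')) := by
  have := run_repeatWhile (A := A) (w := w) (D := D) (q := q) (p := .transfer j j')
    (t := .test (.work j) Option.isSome) (n := 3) (d := 1)
    (s := fun x => (c.setWork j ((c.work j).drop x)).setWork j'
      (((c.work j).take x).reverse ++ c.work j')) (N := (c.work j).length)
    (fun x hx => ?_) ?_ fun x hx => ?_
  · have e : (c.setWork j (c.work j)).setWork j' (c.work j') = c := by simp [State.setWork]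
    refine Run.weaken (n := (3 + 1 + 2) * (c.work j).length + (1 + 2)) ?_ (by omega)
    simpa [Prog.transferAll, e] using this
  · convert test_test (A := A) (.work j) Option.isSome
    simp [State.stk, hx, State.setWork, hj.symm]
  · convert test_test (A := A) (.work j) Option.isSome
    simp [State.stk, State.setWork, hj.symm]
  · convert run_transfer (A := A) (w := w) (D := D) (q := q) (b := (c.work j)[x])
      (l := (c.work j).drop (x + 1)) (j := j) (j' := j') ?_ hj using 1
    · rw [← List.take_concat_get' (c.work j) x hx, List.reverse_append]
      simp [State.setWork, update_comm hj]
    · simp [State.setWork, hj.symm]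

end StackProg

/-! ### Compilation of formulas, and correctness for the atomic ones -/

namespace StackProg

open Function

/-- The program that evaluates a formula. The pointer variables are represented by the pointers
`ρ a < k`, and the set variables by the stacks `2 * τ s + 2` for `τ s < l`. -/
def Formula.compile {A Sig Q : Type} [Inhabited Sig] : {α β : Type} → Formula Sig α β →
    (α → ℕ) → (β → ℕ) → ℕ → ℕ → Prog (Stk.Alphabet A Sig) (Reg Q Sig)
  | _, _, letter p a, ρ, _, _, _ =>
    .peek (.right (ρ a)) fun v o => { v with bit := o.elim false p }
  | _, _, lt a b, ρ, _, _, _ =>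
    -- The general case moves both pointers in parallel, which makes no sense for a single pointer.
    if ρ a = ρ b then .setBit fun _ => false else
    .seq (.repeatWhile
        (.seq (.peek (.left (ρ a)) fun v o => { v with flag := o.isSome })
          (.peek (.left (ρ b)) fun v o => { v with flag := v.flag && o.isSome }))
        (.seq (.moveLeft (ρ a)) (.seq (.moveLeft (ρ b)) (.pushBit 1 fun _ => true))))
      (.seq (.peek (.left (ρ b)) fun v o => { v with bit := o.isSome })
        (.repeatWhile (.test (.work 1) Option.isSome)
          (.seq (.popBit 1 fun b _ => b) (.seq (.moveRight (ρ a)) (.moveRight (ρ b))))))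
  | _, _, mem s a, ρ, τ, _, _ =>
    .seq (.repeatWhile (.test (.left (ρ a)) Option.isSome)
        (.seq (.moveLeft (ρ a)) (.transfer (2 * τ s + 2) 1)))
      (.seq (.peekBit (2 * τ s + 2) fun _ o => o.getD false)
        (.repeatWhile (.test (.work 1) Option.isSome)
          (.seq (.transfer 1 (2 * τ s + 2)) (.moveRight (ρ a)))))
  | _, _, neg φ, ρ, τ, k, l => .seq (φ.compile ρ τ k l) (.setBit fun b => !b)
  | _, _, and φ ψ, ρ, τ, k, l =>
    .seq (φ.compile ρ τ k l) (.seq (.pushBit 0 id) (.seq (ψ.compile ρ τ k l)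
      (.popBit 0 fun b o => b && o.getD false)))
  | _, _, ex φ, ρ, τ, k, l =>
    .seq (.pushBit 0 fun _ => false) (.seq (.setBit fun _ => false)
      (.seq (.forAll k (.seq (φ.compile (cons k ρ) τ (k + 1) l)
          (.seq (.popBit 0 fun b o => b || o.getD false)
            (.seq (.pushBit 0 id) (.setBit fun _ => false)))))
        (.popBit 0 fun _ o => o.getD false)))
  | _, _, le φ₁ φ₂ ψ₁ ψ₂, ρ, τ, k, l =>
    let add p : Prog (Stk.Alphabet A Sig) (Reg Q Sig) :=
      .forAll k (.seq p (.seq (.ite (fun v => v.bit) (.pushBit 0 id) (.setBit id))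
        (.setBit fun _ => false)))
    -- Truncated subtraction: the `false` below the unary counter is never popped.
    let sub p : Prog (Stk.Alphabet A Sig) (Reg Q Sig) :=
      .forAll k (.seq p (.seq
        (.peek (.work 0) fun v o => { v with flag := v.bit && o.getD false })
        (.seq (.ite (fun v => v.flag) (.pop (.work 0) fun v _ => v) (.load id))
          (.load fun v => { v with bit := false, flag := false }))))
    .seq (.pushBit 0 fun _ => false) (.seq (.setBit fun _ => false)
      (.seq (add (φ₁.compile (cons k ρ) τ (k + 1) l))
        (.seq (add (φ₂.compile (cons k ρ) τ (k + 1) l))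
          (.seq (sub (ψ₁.compile (cons k ρ) τ (k + 1) l))
            (.seq (sub (ψ₂.compile (cons k ρ) τ (k + 1) l))
              (.seq (.peekBit 0 fun _ o => !(o.getD true))
                (.seq (.repeatWhile (.test (.work 0) fun o => o.getD false)
                    (.popBit 0 fun b _ => b))
                  (.popBit 0 fun b _ => b))))))))
  | _, _, iter φ ψ, ρ, τ, k, l =>
    .seq (.setBit fun _ => false) (.seq (.forAll k (.pushBit (2 * l + 2) fun _ => false))
      (.seq (.forAll k (.seq
          (.forAll (k + 1) (.seq (φ.compile (cons (k + 1) (cons k ρ)) (cons l τ) (k + 2) (l + 1))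
            (.seq (.pushBit (2 * l + 3) id) (.setBit fun _ => false))))
          (.seq (.clear (2 * l + 2)) (.transferAll (2 * l + 3) (2 * l + 2)))))
        (.seq (ψ.compile ρ (cons l τ) k (l + 1)) (.clear (2 * l + 2)))))

/-- The bits of a set of numbers below `n`. -/
noncomputable def bits (n : ℕ) (X : Set ℕ) : List Bool := by
  classical exact (List.range n).map fun x => decide (x ∈ X)

/-- The truth value of a proposition. -/
noncomputable def truth (P : Prop) : Bool := by classical exact decide P

@[simp] theorem truth_eq_true (P : Prop) : truth P = true ↔ P := by simp [truth]

@[simp] theorem truth_eq_false (P : Prop) : truth P = false ↔ ¬ P := by simp [truth]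

theorem truth_eq {P : Prop} {b : Bool} (h : b = true ↔ P) : truth P = b := by
  rw [Bool.eq_iff_iff, truth_eq_true, h]

@[simp] theorem length_bits (n : ℕ) (X : Set ℕ) : (bits n X).length = n := by simp [bits]

theorem getElem?_bits {n x : ℕ} (X : Set ℕ) (h : x < n) : (bits n X)[x]? = some (truth (x ∈ X)) := by
  simp [bits, truth, h]

theorem bits_succ (n : ℕ) (X : Set ℕ) : bits (n + 1) X = bits n X ++ [truth (n ∈ X)] := by
  simp [bits, truth, List.range_succ]

/-- The state `c` represents the values `e` and `X` of the variables. -/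
structure Represents {Sig α β : Type} (w : List Sig) (c : State) (ρ : α → ℕ) (τ : β → ℕ) (k l : ℕ)
    (e : α → ℕ) (X : β → Set ℕ) : Prop where
  pos : ∀ a, c.pos (ρ a) = e a
  lt_length : ∀ a, e a < w.length
  lt_k : ∀ a, ρ a < k
  lt_l : ∀ b, τ b < l
  set : ∀ b, c.work (2 * τ b + 2) = bits w.length (X b)
  -- These fields make it possible to allocate new variables. The stack `0` is left unconstrained,
  -- because connectives save intermediate results there.
  free : ∀ i, k ≤ i → c.pos i = 0
  empty : ∀ j, 2 * l + 2 ≤ j → c.work j = []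
  temp : c.work 1 = []

namespace Represents

variable {Sig α β : Type} {w : List Sig} {c : State} {ρ : α → ℕ} {τ : β → ℕ} {k l : ℕ} {e : α → ℕ}
  {X : β → Set ℕ}

theorem setBit (h : Represents w c ρ τ k l e X) (b : Bool) :
    Represents w (c.setBit b) ρ τ k l e X :=
  ⟨h.pos, h.lt_length, h.lt_k, h.lt_l, h.set, h.free, h.empty, h.temp⟩

theorem setWork_zero (h : Represents w c ρ τ k l e X) (L : List Bool) :
    Represents w (c.setWork 0 L) ρ τ k l e X where
  pos := h.pos
  lt_length := h.lt_length
  lt_k := h.lt_k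
  lt_l := h.lt_l
  set b := by simpa [State.setWork] using h.set b
  free := h.free
  empty j hj := by
    have : j ≠ 0 := by omega
    simpa [State.setWork, this] using h.empty j hj
  temp := by simpa [State.setWork] using h.temp

theorem cons_pos (h : Represents w c ρ τ k l e X) {x : ℕ} (hx : x < w.length) :
    Represents w (c.setPos k x) (cons k ρ) τ (k + 1) l (cons x e) X where
  pos a := by
    cases a with
    | none => simp
    | some a =>
      have := (h.lt_k a).ne
      simpa [State.setPos, this] using h.pos a
  lt_length a := by
    cases a with
    | none => exact hx
    | some a => exact h.lt_length a
  lt_k a := by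
    cases a with
    | none => simp
    | some a => have := h.lt_k a; simp; omega
  lt_l := h.lt_l
  set := h.set
  free i hi := by
    have : i ≠ k := by omega
    simpa [State.setPos, this] using h.free i (by omega)
  empty := h.empty
  temp := h.temp

theorem cons_set (h : Represents w c ρ τ k l e X) (Y : Set ℕ) :
    Represents w (c.setWork (2 * l + 2) (bits w.length Y)) ρ (cons l τ) k (l + 1) e (cons Y X) where
  pos := h.pos
  lt_length := h.lt_length
  lt_k := h.lt_k
  lt_l b := by
    cases b with
    | none => simp
    | some b => have := h.lt_l b; simp; omega
  set b := by
    cases b with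
    | none => simp
    | some b =>
      have := (h.lt_l b).ne
      simpa [State.setWork, this] using h.set b
  free := h.free
  empty j hj := by
    have : j ≠ 2 * l + 2 := by omega
    simpa [State.setWork, this] using h.empty j (by omega)
  temp := by simpa [State.setWork] using h.temp

/-- The stack `2 * l + 3` is the scratch companion of the stack `2 * l + 2` of the newest set
variable; no field of `Represents` mentions it once `l + 1` sets are allocated. -/
theorem setWork_new {j : ℕ} (h : Represents w c ρ τ k (l + 1) e X) (L : List Bool)
    (hj : j = 2 * l + 3) : Represents w (c.setWork j L) ρ τ k (l + 1) e X where
  pos := h.pos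
  lt_length := h.lt_length
  lt_k := h.lt_k
  lt_l := h.lt_l
  set b := by
    have : 2 * τ b + 2 ≠ j := by omega
    simpa [State.setWork, this] using h.set b
  free := h.free
  empty i hi := by
    have : i ≠ j := by omega
    simpa [State.setWork, this] using h.empty i hi
  temp := by
    have : 1 ≠ j := by omega
    simpa [State.setWork, this] using h.temp

end Represents

section atoms

variable {A Sig Q α β : Type} [Inhabited Sig] {w : List Sig} {D : ℕ} {q : Q} {c : State} {ρ : α → ℕ}
  {τ : β → ℕ} {k l : ℕ} {e : α → ℕ} {X : β → Set ℕ}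

theorem run_letter (p : Sig → Bool) (a : α) (hk : k ≤ D) (h : Represents w c ρ τ k l e X) :
    Run w D q ((Formula.letter p a : Formula Sig α β).compile (A := A) ρ τ k l) 1 c
      (c.setBit (truth ((Formula.letter p a : Formula Sig α β).eval w e X))) := by
  unfold Run
  rw [State.stk_setBit]
  refine (Exec.peek _ _ _ _).congr ?_ rfl
  have h1 := (h.lt_k a).trans_le hk
  have h2 := h.lt_length a
  simp only [State.stk, h1, if_true, h.pos, List.head?_drop, State.setBit, Formula.eval]
  rw [truth_eq (b := (w[e a]?).elim false p)]
  cases w[e a]? <;> simp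

/-- Both pointers move left in parallel until one of them reaches the beginning, and each step
leaves a bit on the stack `1`. Then `e a < e b` iff something is left of the second pointer, and the
stack `1` says how often to move back. -/
theorem run_lt (a b : α) (hk : k ≤ D) (h : Represents w c ρ τ k l e X) :
    Run w D q ((Formula.lt a b : Formula Sig α β).compile (A := A) ρ τ k l)
      (24 * w.length + 20) c
      (c.setBit (truth ((Formula.lt a b : Formula Sig α β).eval w e X))) := by
  rw [Formula.compile]
  simp only [Formula.eval]
  split_ifs with hab
  · have : e a = e b := by rw [← h.pos, ← h.pos, hab]
    rw [this]
    rw [show truth (e b < e b) = false by simp]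
    exact Run.weaken (n := 1) (run_setBit _) (by omega)
  have ha := (h.lt_k a).trans_le hk
  have hb := (h.lt_k b).trans_le hk
  have hea := h.lt_length a
  have heb := h.lt_length b
  set N := min (e a) (e b) with hN
  let s : ℕ → State := fun j =>
    ((c.setPos (ρ a) (e a - j)).setPos (ρ b) (e b - j)).setWork 1 (List.replicate j true)
  have sa : ∀ j, (s j).pos (ρ a) = e a - j := fun j => by simp [s, State.setWork, State.setPos, hab]
  have sb : ∀ j, (s j).pos (ρ b) = e b - j := fun j => by simp [s, State.setWork, State.setPos]
  have s0 : s 0 = c := by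
    simp only [s, List.replicate_zero, Nat.sub_zero]
    rw [State.setPos_of_eq (h.pos a), State.setPos_of_eq (h.pos b), State.setWork_of_eq h.temp]
  have hd : ∀ x, x < w.length → ((w.take x).reverse.head?.isSome = true ↔ x ≠ 0) := fun x hx => by
    rw [List.isSome_head?]
    have : w ≠ [] := by rintro rfl; simp at hx
    simp [this]
  have r1 : Run w D q (.repeatWhile
        (.seq (.peek (.left (ρ a)) fun v o => { v with flag := o.isSome })
          (.peek (.left (ρ b)) fun v o => { v with flag := v.flag && o.isSome }))
        (.seq (.moveLeft (A := A) (ρ a)) (.seq (.moveLeft (ρ b)) (.pushBit 1 fun _ => true))))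
        ((3 + (3 + 1) + (1 + 1) + 2) * N + ((1 + 1) + 2)) (s 0) (s N) := by
    have ht : ∀ j b', (b' = true ↔ j < N) → Test w D q
        (.seq (.peek (.left (ρ a)) fun v o => { v with flag := o.isSome })
          (.peek (.left (ρ b)) fun v o => { v with flag := v.flag && o.isSome }) :
          Prog (Stk.Alphabet A Sig) (Reg Q Sig)) (1 + 1) (s j) b' := by
      intro j b' hb'
      refine Exec.seq (Exec.peek _ _ _ _) ((Exec.peek _ _ _ _).congr ?_ rfl)
      simp only [State.stk, ha, hb, if_true, sa, sb]
      congr 1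
      rw [Bool.eq_iff_iff, hb', Bool.and_eq_true, hd _ (by omega), hd _ (by omega)]
      omega
    refine run_repeatWhile (fun j hj => ht j _ (by simpa using hj)) (ht N _ (by simp))
      fun j hj => ?_
    have m1 := run_moveLeft (A := A) (w := w) (q := q) (c := s j) (x := e a - (j + 1)) ha (by omega)
      (by rw [sa]; omega)
    have m2 := run_moveLeft (A := A) (w := w) (q := q) (c := (s j).setPos (ρ a) (e a - (j + 1)))
      (x := e b - (j + 1)) hb (by omega)
      (by simp only [State.setPos]; rw [update_of_ne (Ne.symm hab), sb]; omega)
    have m3 := run_pushBit (A := A) (w := w) (D := D) (q := q)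
      (c := ((s j).setPos (ρ a) (e a - (j + 1))).setPos (ρ b) (e b - (j + 1))) 1 fun _ => true
    convert m1.seq (m2.seq m3) using 1
    simp only [s, State.setWork, State.setPos, update_self, update_idem, List.replicate_succ]
    rw [update_comm (Ne.symm hab), update_idem, update_comm hab, update_idem,
      update_comm (Ne.symm hab)]
  have r2 : Run w D q (.peek (.left (ρ b)) fun v o => { v with bit := o.isSome } :
      Prog (Stk.Alphabet A Sig) (Reg Q Sig)) 1 (s N) ((s N).setBit (truth (e a < e b))) := by
    unfold Run
    rw [State.stk_setBit]
    refine (Exec.peek _ _ _ _).congr ?_ rfl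
    simp only [State.stk, hb, if_true, sb, State.setBit]
    congr 1
    rw [Bool.eq_iff_iff, truth_eq_true, hd _ (by omega)]
    omega
  have r3 : Run w D q (.repeatWhile (.test (.work 1) Option.isSome)
          (.seq (.popBit 1 fun b _ => b) (.seq (.moveRight (A := A) (ρ a)) (.moveRight (ρ b)))))
          ((1 + (3 + 3) + 1 + 2) * N + (1 + 2)) ((s N).setBit (truth (e a < e b)))
          ((s 0).setBit (truth (e a < e b))) := by
    have := run_repeatWhile (A := A) (w := w) (D := D) (q := q)
      (t := .test (.work 1) Option.isSome) (n := 1 + (3 + 3)) (d := 1)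
      (p := .seq (.popBit 1 fun b _ => b) (.seq (.moveRight (A := A) (ρ a)) (.moveRight (ρ b))))
      (s := fun j => (s (N - j)).setBit (truth (e a < e b))) (N := N)
      (fun j hj => ?_) ?_ fun j hj => ?_
    · simpa using this
    · convert test_test (A := A) (.work 1) Option.isSome
      have : N - j ≠ 0 := by omega
      rw [Eq.comm, List.isSome_head?]
      simp [State.stk, State.setBit, s, this]
    · convert test_test (A := A) (.work 1) Option.isSome
      simp [State.stk, State.setBit, s]
    · obtain ⟨i, hi⟩ : ∃ i, N - j = i + 1 := ⟨N - j - 1, by omega⟩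
      have hi' : N - (j + 1) = i := by omega
      simp only [hi, hi']
      have m1 := run_popBit (A := A) (w := w) (D := D) (q := q)
        (c := (s (i + 1)).setBit (truth (e a < e b))) 1 fun b _ => b
      refine m1.seq ?_
      have m2 := run_moveRight (A := A) (w := w) (q := q) (c := State.setBit
        (((s (i + 1)).setBit (truth (e a < e b))).setWork 1 (List.replicate i true))
          (truth (e a < e b))) ha (by
            change (s (i + 1)).pos (ρ a) < _
            rw [sa]; omega)
      have m3 := run_moveRight (A := A) (w := w) (q := q) (c := State.setPos (State.setBit
        (((s (i + 1)).setBit (truth (e a < e b))).setWork 1 (List.replicate i true))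
          (truth (e a < e b))) (ρ a) (e a - i)) hb (by
            simp only [State.setPos]
            rw [update_of_ne (Ne.symm hab)]
            change (s (i + 1)).pos (ρ b) < _
            rw [sb]; omega)
      convert Run.seq (c' := State.setPos (State.setBit
        (((s (i + 1)).setBit (truth (e a < e b))).setWork 1 (List.replicate i true))
          (truth (e a < e b))) (ρ a) (e a - i)) ?_ m3 using 1
      · have e1 : e b - (i + 1) + 1 = e b - i := by omega
        have e2 : (((State.setPos (State.setBit
            (((s (i + 1)).setBit (truth (e a < e b))).setWork 1 (List.replicate i true))
            (truth (e a < e b))) (ρ a) (e a - i))).pos (ρ b)) = e b - (i + 1) := by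
          simp only [State.setPos]
          rw [update_of_ne (Ne.symm hab)]
          exact sb _
        rw [e2, e1]
        simp only [s, State.setWork, State.setPos, State.setBit, update_idem]
        rw [update_comm (Ne.symm hab), update_idem, update_comm hab, update_idem,
          update_comm (Ne.symm hab)]
      · have e1 : e a - (i + 1) + 1 = e a - i := by omega
        have e2 : (State.setBit (((s (i + 1)).setBit (truth (e a < e b))).setWork 1
            (List.replicate i true)) (truth (e a < e b))).pos (ρ a) = e a - (i + 1) := sa _
        rw [e2, e1] at m2
        convert m2 using 1
        simp [s, State.setBit, State.setWork, List.replicate_succ]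
  rw [s0] at r1 r3
  exact (r1.seq (r2.seq r3)).weaken (by omega)

/-- The bit of the position `e a` lies at depth `e a` in the stack of the set. Moving the pointer to
the beginning while unloading one bit per step onto the stack `1` exposes it; the reverse process
restores the state. -/
theorem run_mem (s : β) (a : α) (hk : k ≤ D) (h : Represents w c ρ τ k l e X) :
    Run w D q ((Formula.mem s a : Formula Sig α β).compile (A := A) ρ τ k l)
      (24 * w.length + 20) c
      (c.setBit (truth ((Formula.mem s a : Formula Sig α β).eval w e X))) := by
  rw [Formula.compile]
  simp only [Formula.eval]
  have ha := (h.lt_k a).trans_le hk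
  have hea := h.lt_length a
  set i := ρ a
  set j := 2 * τ s + 2 with hj
  have j1 : 1 ≠ j := by omega
  set S := bits w.length (X s) with hS
  have lS : S.length = w.length := length_bits _ _
  let st : ℕ → State := fun x =>
    ((c.setPos i (e a - x)).setWork j (S.drop x)).setWork 1 (S.take x).reverse
  have st0 : st 0 = c := by
    simp only [st, List.take_zero, Nat.sub_zero, List.drop_zero, List.reverse_nil]
    rw [State.setPos_of_eq (h.pos a), State.setWork_of_eq (h.set s), State.setWork_of_eq h.temp]
  have p1 : ∀ x, (st x).pos i = e a - x := fun x => by simp [st, State.setWork, State.setPos]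
  have p2 : ∀ x, (st x).work j = S.drop x := fun x => by simp [st, State.setWork, j1.symm]
  have p3 : ∀ x, (st x).work 1 = (S.take x).reverse := fun x => by simp [st, State.setWork]
  have r1 : Run w D q (.repeatWhile (.test (.left i) Option.isSome)
        (.seq (.moveLeft (A := A) i) (.transfer j 1))) ((3 + 3 + 1 + 2) * e a + (1 + 2)) (st 0)
        (st (e a)) := by
    refine run_repeatWhile (d := 1) (fun x hx => ?_) ?_ fun x hx => ?_
    · convert test_test (A := A) (.left i) Option.isSome
      rw [Eq.comm, List.isSome_head?]
      have : w ≠ [] := by rintro rfl; simp at hea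
      simp only [State.stk, ha, p1, if_true]
      simp [this]
      omega
    · convert test_test (A := A) (.left i) Option.isSome
      simp [State.stk, p1]
    · have m1 := run_moveLeft (A := A) (w := w) (q := q) (c := st x) (x := e a - (x + 1)) ha
        (by omega) (by rw [p1]; omega)
      refine m1.seq ?_
      convert run_transfer (A := A) (j := j) (j' := 1) (b := S[x]) (l := S.drop (x + 1)) ?_ j1
        using 1
      · change _ = State.setWork _ _ (_ :: (st x).work 1)
        rw [p3]
        simp only [st, State.setWork, State.setPos, update_idem]
        rw [← List.take_concat_get' S x (by omega), List.reverse_append]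
        congr 1
        rw [update_comm j1, update_idem, update_idem]
        rfl
      · change (st x).work j = _
        rw [p2]
        exact List.drop_eq_getElem_cons (by omega)
  have r2 : Run w D q (.peekBit (A := A) j fun _ o => o.getD false) 1 (st (e a))
      ((st (e a)).setBit (truth (e a ∈ X s))) := by
    convert run_peekBit _ _
    rw [p2, List.head?_drop, hS, getElem?_bits _ hea]
    rfl
  have r3 : Run w D q (.repeatWhile (.test (.work 1) Option.isSome)
          (.seq (.transfer (A := A) 1 j) (.moveRight i))) ((3 + 3 + 1 + 2) * e a + (1 + 2))
          ((st (e a)).setBit (truth (e a ∈ X s))) ((st 0).setBit (truth (e a ∈ X s))) := by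
    have := run_repeatWhile (A := A) (w := w) (D := D) (q := q)
      (t := .test (.work 1) Option.isSome) (n := 3 + 3) (d := 1)
      (p := .seq (.transfer (A := A) 1 j) (.moveRight i))
      (s := fun x => (st (e a - x)).setBit (truth (e a ∈ X s))) (N := e a)
      (fun x hx => ?_) ?_ fun x hx => ?_
    · simpa using this
    · convert test_test (A := A) (.work 1) Option.isSome
      rw [Eq.comm, List.isSome_head?]
      change (st _).work 1 ≠ []
      rw [p3, ← List.length_pos_iff]
      simp
      omega
    · convert test_test (A := A) (.work 1) Option.isSome
      change false = ((st _).work 1).head?.isSome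
      rw [p3]
      simp
    · obtain ⟨y, hy⟩ : ∃ y, e a - x = y + 1 := ⟨e a - x - 1, by omega⟩
      have hy' : e a - (x + 1) = y := by omega
      have hyS : y < S.length := by omega
      simp only [hy, hy']
      have m1 := run_transfer (A := A) (w := w) (D := D) (q := q)
        (c := (st (y + 1)).setBit (truth (e a ∈ X s))) (j := 1) (j' := j) (b := S[y])
        (l := (S.take y).reverse) (by
          change (st _).work 1 = _
          rw [p3, ← List.take_concat_get' S y hyS, List.reverse_append]
          rfl) j1.symm
      refine m1.seq ?_
      convert run_moveRight (A := A) ha ?_ using 1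
      · change _ = State.setPos (State.setWork _ _ (_ :: (st (y + 1)).work j)) _
          ((st (y + 1)).pos i + 1)
        rw [p1, p2, ← List.drop_eq_getElem_cons hyS]
        have : e a - (y + 1) + 1 = e a - y := by omega
        simp only [st, State.setWork, State.setPos, State.setBit, update_idem, this]
        rw [update_comm j1, update_idem, update_comm j1.symm]
      · change (st (y + 1)).pos i < _
        rw [p1]
        omega
  rw [st0] at r1 r3
  exact (r1.seq (r2.seq r3)).weaken (by omega)

end atoms

end StackProg

/-! ### Evaluation of compound formulas in polynomial time -/

namespace StackProg

open Function

variable {A Sig Q α β : Type} {w : List Sig} {D : ℕ} {q : Q} {c : State} {ρ : α → ℕ}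
  {τ : β → ℕ} {k l : ℕ} {e : α → ℕ} {X : β → Set ℕ}

/-- The state `c` with a counter on top of the stack `0`. -/
def State.counter (c : State) (a : ℕ) : State :=
  (c.setWork 0 (List.replicate a true ++ false :: c.work 0)).setBit false

theorem count_zero (P : ℕ → Prop) : Formula.count 0 P = 0 := by
  simp [Formula.count]

theorem count_succ (n : ℕ) (P : ℕ → Prop) :
    Formula.count (n + 1) P = Formula.count n P + if truth (P n) then 1 else 0 := by
  classical
  simp [Formula.count, Nat.count_succ, truth]

theorem truth_not (P : Prop) : truth (¬ P) = !truth P := by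
  rw [Bool.eq_iff_iff]
  simp [truth_eq_true, truth_eq_false]

theorem truth_and (P P' : Prop) : truth (P ∧ P') = (truth P && truth P') := by
  rw [Bool.eq_iff_iff]
  simp [truth_eq_true]

theorem State.stk_work (j : ℕ) : c.stk (A := A) w D (.work j) = c.work j := rfl

theorem Run.congr {p p₁ : Prog (Stk.Alphabet A Sig) (Reg Q Sig)} {n m : ℕ} {c' c₁ : State}
    (h : Run w D q p n c c') (hp : p₁ = p) (hn : n ≤ m) (hc : c₁ = c') : Run w D q p₁ m c c₁ := by
  subst hp hc
  exact h.weaken hn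

theorem Represents.counter (h : Represents w c ρ τ k l e X) (a : ℕ) :
    Represents w (c.counter a) ρ τ k l e X := (h.setWork_zero _).setBit _

variable [Inhabited Sig]

/-- The counter is a block of `true` above a `false` on the stack `0`. The hypothesis on `p` covers
all counter values, as the value changes from one position to the next. -/
theorem run_counter_add {p : Prog (Stk.Alphabet A Sig) (Reg Q Sig)} {P : ℕ → Prop} {n : ℕ}
    (hk : k < D) (hc : c.pos k = 0)
    (hp : ∀ x < w.length, ∀ a, Run w D q p n ((c.counter a).setPos k x)
      (((c.counter a).setPos k x).setBit (truth (P x)))) (a : ℕ) :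
    Run w D q (.forAll k (.seq p (.seq (.ite (fun v => v.bit) (.pushBit 0 id) (.setBit id))
      (.setBit fun _ => false)))) ((n + 15) * w.length + 6) (c.counter a)
      (c.counter (a + Formula.count w.length P)) := by
  have := run_forAll (A := A) (w := w) (q := q) (n := n + (2 + 1)) (p := .seq p (.seq (.ite (fun v => v.bit)
    (.pushBit 0 id) (.setBit id)) (.setBit fun _ => false))) hk
    (fun x => c.counter (a + Formula.count x P)) (fun x _ => hc) fun x hx => ?_
  · rw [count_zero] at this
    exact this
  refine (hp x hx _).seq (Run.seq (c' := ((c.counter (a + Formula.count (x + 1) P)).setPos k x).setBit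
    (truth (P x))) ?_ (run_setBit (A := A) (w := w) (D := D) (q := q)
      (c := ((c.counter (a + Formula.count (x + 1) P)).setPos k x).setBit (truth (P x))) _))
  cases hb : truth (P x) with
  | false =>
    refine Exec.ite_false rfl ?_
    have := run_setBit (A := A) (w := w) (D := D) (q := q)
      (c := (((c.counter (a + Formula.count x P)).setPos k x).setBit false)) id
    rw [count_succ, hb]
    exact this
  | true =>
    refine Exec.ite_true rfl ?_
    have := run_pushBit (A := A) (w := w) (D := D) (q := q)
      (c := (((c.counter (a + Formula.count x P)).setPos k x).setBit true)) 0 id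
    convert this using 2
    rw [count_succ, hb]
    simp [State.setWork, State.setBit, State.setPos, State.counter, ← add_assoc,
      List.replicate_succ]
    rfl

/-- One `true` is removed per solution as long as there is one, whence the truncated subtraction. -/
theorem run_counter_sub {p : Prog (Stk.Alphabet A Sig) (Reg Q Sig)} {P : ℕ → Prop} {n : ℕ}
    (hk : k < D) (hc : c.pos k = 0)
    (hp : ∀ x < w.length, ∀ a, Run w D q p n ((c.counter a).setPos k x)
      (((c.counter a).setPos k x).setBit (truth (P x)))) (a : ℕ) :
    Run w D q (.forAll k (.seq p (.seq
        (.peek (.work 0) fun v o => { v with flag := v.bit && o.getD false })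
        (.seq (.ite (fun v => v.flag) (.pop (.work 0) fun v _ => v) (.load id))
          (.load fun v => { v with bit := false, flag := false }))))) ((n + 16) * w.length + 6)
      (c.counter a) (c.counter (a - Formula.count w.length P)) := by
  have := run_forAll (A := A) (w := w) (q := q) (n := n + (1 + (2 + 1))) (p := .seq p (.seq
        (.peek (.work 0) fun v o => { v with flag := v.bit && o.getD false })
        (.seq (.ite (fun v => v.flag) (.pop (.work 0) fun v _ => v) (.load id))
          (.load fun v => { v with bit := false, flag := false })))) hk
    (fun x => c.counter (a - Formula.count x P)) (fun x _ => hc) fun x hx => ?_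
  · rw [count_zero] at this
    exact this
  refine (hp x hx _).seq ?_
  have hh : ∀ b : ℕ, ((((c.counter b).setPos k x).setBit (truth (P x))).stk (A := A) w D
      (.work 0)).head?.getD false = decide (b ≠ 0) := by
    intro b
    cases b <;> simp [State.stk, State.setBit, State.setPos, State.counter, State.setWork,
      List.replicate_succ]
  refine Exec.seq (Exec.peek _ _ _ _) (Exec.seq (m := 1) ?_ ((Exec.load _ ⟨truth (P x),
    truth (P x) && decide (a - Formula.count x P ≠ 0), none, q⟩
    (((c.counter (a - Formula.count (x + 1) P)).setPos k x).stk w D)).congr ?_ rfl))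
  · rw [hh]
    by_cases hb : (truth (P x) && decide (a - Formula.count x P ≠ 0)) = true
    · refine Exec.ite_true hb ((Exec.pop _ _ _ _).congr rfl ?_)
      rw [← State.stk_setWork, ← State.stk_setBit ((c.counter (a - Formula.count (x + 1) P)).setPos k x)
        (truth (P x))]
      congr 1
      simp only [Bool.and_eq_true, decide_eq_true_eq] at hb
      obtain ⟨d, hd⟩ : ∃ d, a - Formula.count x P = d + 1 :=
        ⟨a - Formula.count x P - 1, by have := hb.2; omega⟩
      have hd' : a - Formula.count (x + 1) P = d := by
        rw [count_succ, hb.1]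
        simp
        omega
      rw [hd, hd']
      simp [State.stk_work, State.setWork, State.setBit, State.setPos, State.counter,
        List.replicate_succ]
    · have hb' := Bool.not_eq_true _ ▸ hb
      refine (Exec.ite_false hb' ((Exec.load _ _ _).congr rfl ?_))
      have : a - Formula.count (x + 1) P = a - Formula.count x P := by
        rw [count_succ]
        cases h : truth (P x)
        · simp
        · simp only [h, Bool.true_and, decide_eq_true_eq, not_not] at hb
          omega
      rw [this]
      rfl
  · rfl

/-- `φ` is evaluated correctly, in time bounded by `P`. -/
def Formula.RunsIn (A Q : Type) (φ : Formula Sig α β) (P : Polynomial ℕ) : Prop :=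
  ∀ (w : List Sig) (D : ℕ) (q : Q) (c : State) (ρ : α → ℕ) (τ : β → ℕ) (k l : ℕ) (e : α → ℕ)
    (X : β → Set ℕ), k + φ.depth ≤ D → Represents w c ρ τ k l e X →
    Run w D q (φ.compile (A := A) ρ τ k l) (P.eval w.length) c (c.setBit (truth (φ.eval w e X)))

theorem Formula.RunsIn.neg {φ : Formula Sig α β} {P : Polynomial ℕ} (h : φ.RunsIn A Q P) :
    φ.neg.RunsIn A Q (P + 1) := by
  intro w D q c ρ τ k l e X hD hc
  have := (h w D q c ρ τ k l e X hD hc).seq (run_setBit (A := A) (fun b => !b))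
  refine this.congr rfl (by simp) ?_
  simp [State.setBit, Formula.eval, truth_not]

theorem Formula.RunsIn.and {φ ψ : Formula Sig α β} {P P' : Polynomial ℕ} (h : φ.RunsIn A Q P)
    (h' : ψ.RunsIn A Q P') : (φ.and ψ).RunsIn A Q (P + (1 + (P' + 1))) := by
  intro w D q c ρ τ k l e X hD hc
  rw [Formula.depth] at hD
  have r1 := h w D q c ρ τ k l e X (by omega) hc
  have r2 := run_pushBit (A := A) (w := w) (D := D) (q := q)
    (c := c.setBit (truth (φ.eval w e X))) 0 id
  have r3 := h' w D q _ ρ τ k l e X (by omega) ((hc.setBit (truth (φ.eval w e X))).setWork_zero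
    (truth (φ.eval w e X) :: c.work 0))
  have r4 := run_popBit (A := A) (w := w) (D := D) (q := q) (c := State.setBit
    ((c.setBit (truth (φ.eval w e X))).setWork 0 (truth (φ.eval w e X) :: c.work 0))
    (truth (ψ.eval w e X))) 0 fun b o => b && o.getD false
  refine (r1.seq (r2.seq (r3.seq r4))).congr rfl (by simp) ?_
  simp [State.setBit, State.setWork, Formula.eval, truth_and, Bool.and_comm]

/-- Invariant: after `x` rounds the top of the stack `0` tells whether some `y < x` is a witness,
and the result bit is `false`. -/
theorem Formula.RunsIn.ex {φ : Formula Sig (Option α) β} {P : Polynomial ℕ} (h : φ.RunsIn A Q P) :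
    φ.ex.RunsIn A Q ((P + 15) * Polynomial.X + 9) := by
  intro w D q c ρ τ k l e X hD hc
  rw [Formula.depth] at hD
  let S : ℕ → Prop := fun x => ∃ y < x, φ.eval w (cons y e) X
  let F : ℕ → State := fun x => (c.setWork 0 (truth (S x) :: c.work 0)).setBit false
  have hS : ∀ x, S (x + 1) ↔ S x ∨ φ.eval w (cons x e) X := fun x => by
    simp only [S, Nat.lt_succ_iff_lt_or_eq, or_and_right, exists_or, exists_eq_left]
  have r1 := run_pushBit (A := A) (w := w) (D := D) (q := q) (c := c) 0 fun _ => false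
  have r2 := run_setBit (A := A) (w := w) (D := D) (q := q) (c := c.setWork 0 (false :: c.work 0))
    fun _ => false
  have e0 : (c.setWork 0 (false :: c.work 0)).setBit false = F 0 := by
    have : truth (S 0) = false := by simp [S]
    simp only [F, this]
  have r3 : Run w D q _ _ (F 0) (F w.length) :=
    run_forAll (A := A) (w := w) (q := q) (i := k) (D := D) (n := P.eval w.length + (1 + (1 + 1)))
    (p := .seq (φ.compile (cons k ρ) τ (k + 1) l) (.seq (.popBit 0 fun b o => b || o.getD false)
            (.seq (.pushBit 0 id) (.setBit fun _ => false)))) (by omega) F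
    (fun x _ => hc.free k le_rfl) fun x hx => by
      have hF : Represents w (F x) ρ τ k l e X := (hc.setWork_zero _).setBit _
      have s1 := h w D q _ (cons k ρ) τ (k + 1) l (cons x e) X (by omega) (hF.cons_pos hx)
      have s2 := run_popBit (A := A) (w := w) (D := D) (q := q) (c := ((F x).setPos k x).setBit
        (truth (φ.eval w (cons x e) X))) 0 fun b o => b || o.getD false
      refine s1.seq (s2.seq (Run.seq (run_pushBit (A := A) 0 id) ?_))
      convert run_setBit (A := A) (w := w) (D := D) (q := q) _ using 1
      simp only [F, State.setBit, State.setWork, State.setPos, update_self, update_idem,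
        List.head?_cons, Option.getD_some, List.tail_cons, id]
      congr 3
      rw [Bool.eq_iff_iff]
      simp only [truth_eq_true, Bool.or_eq_true, hS, or_comm]
  have r4 := run_popBit (A := A) (w := w) (D := D) (q := q) (c := F w.length) 0
    fun _ o => o.getD false
  rw [e0] at r2
  have := r1.seq (r2.seq (r3.seq r4))
  refine (this.weaken (m := (P.eval w.length + 15) * w.length + 9) (by ring_nf; omega)).congr rfl
    (by simp) ?_
  simp [F, State.setBit, State.setWork, Formula.eval, S]

/-- The inequality `n₁ + n₂ ≤ n₃ + n₄` holds iff the truncated difference `n₁ + n₂ - n₃ - n₄`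
vanishes, so that one unary counter suffices. -/
theorem Formula.RunsIn.le {φ₁ φ₂ ψ₁ ψ₂ : Formula Sig (Option α) β} {P₁ P₂ P₃ P₄ : Polynomial ℕ}
    (h₁ : φ₁.RunsIn A Q P₁) (h₂ : φ₂.RunsIn A Q P₂) (h₃ : ψ₁.RunsIn A Q P₃)
    (h₄ : ψ₂.RunsIn A Q P₄) : (Formula.le φ₁ φ₂ ψ₁ ψ₂).RunsIn A Q
      ((P₁ + P₂ + P₃ + P₄ + 80) * Polynomial.X + 40) := by
  intro w D q c ρ τ k l e X hD hc
  rw [Formula.depth] at hD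
  have key : ∀ {φ : Formula Sig (Option α) β} {P : Polynomial ℕ}, φ.RunsIn A Q P →
      φ.depth + k + 1 ≤ D → ∀ x < w.length, ∀ a, Run w D q (φ.compile (A := A) (cons k ρ) τ (k + 1) l)
        (P.eval w.length) ((c.counter a).setPos k x) (((c.counter a).setPos k x).setBit
          (truth (φ.eval w (cons x e) X))) := fun h hd x hx a =>
    h w D q _ (cons k ρ) τ (k + 1) l (cons x e) X (by omega) ((hc.counter a).cons_pos hx)
  have hk : k < D := by omega
  have hc0 := hc.free k le_rfl
  have r1 := run_pushBit (A := A) (w := w) (D := D) (q := q) (c := c) 0 fun _ => false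
  have r2 := run_setBit (A := A) (w := w) (D := D) (q := q) (c := c.setWork 0 (false :: c.work 0))
    fun _ => false
  have e0 : (c.setWork 0 (false :: c.work 0)).setBit false = c.counter 0 := rfl
  rw [e0] at r2
  have a1 := run_counter_add hk hc0 (key h₁ (by omega)) 0
  have a2 := run_counter_add hk hc0 (key h₂ (by omega))
    (0 + Formula.count w.length fun x => φ₁.eval w (cons x e) X)
  have s1 := run_counter_sub hk hc0 (key h₃ (by omega))
    (0 + Formula.count w.length (fun x => φ₁.eval w (cons x e) X) +
      Formula.count w.length fun x => φ₂.eval w (cons x e) X)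
  have s2 := run_counter_sub hk hc0 (key h₄ (by omega))
    (0 + Formula.count w.length (fun x => φ₁.eval w (cons x e) X) +
      Formula.count w.length (fun x => φ₂.eval w (cons x e) X) -
      Formula.count w.length (fun x => ψ₁.eval w (cons x e) X))
  set n₁ := Formula.count w.length (fun x => φ₁.eval w (cons x e) X) with hn₁
  set n₂ := Formula.count w.length (fun x => φ₂.eval w (cons x e) X) with hn₂
  set n₃ := Formula.count w.length (fun x => ψ₁.eval w (cons x e) X) with hn₃
  set n₄ := Formula.count w.length (fun x => ψ₂.eval w (cons x e) X) with hn₄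
  have hb : ∀ P : ℕ → Prop, Formula.count w.length P ≤ w.length := fun P => by
    classical
    exact Nat.count_le _
  have hn₁' := hb fun x => φ₁.eval w (cons x e) X
  have hn₂' := hb fun x => φ₂.eval w (cons x e) X
  rw [← hn₁] at hn₁'
  rw [← hn₂] at hn₂'
  set N := 0 + n₁ + n₂ - n₃ - n₄ with hN
  set b := truth (n₁ + n₂ ≤ n₃ + n₄) with hbd
  have r3 : Run w D q (.peekBit (A := A) 0 fun _ o => !(o.getD true)) 1 (c.counter N)
      ((c.counter N).setBit b) := by
    convert run_peekBit _ _
    rw [hbd, truth_eq]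
    cases h : N <;> simp [State.counter, State.setBit, State.setWork, List.replicate_succ] <;> omega
  let s : ℕ → State := fun j => (c.counter (N - j)).setBit b
  have r4 : Run w D q (.repeatWhile (.test (.work 0) fun o => o.getD false)
                    (.popBit (A := A) 0 fun b _ => b)) ((1 + 1 + 2) * N + (1 + 2)) (s 0) (s N) := by
    refine run_repeatWhile (fun j hj => ?_) ?_ fun j hj => ?_
    · convert test_test _ _
      obtain ⟨i, hi⟩ : ∃ i, N - j = i + 1 := ⟨N - j - 1, by omega⟩
      simp only [s, hi]
      simp [State.stk, State.counter, State.setBit, State.setWork, List.replicate_succ]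
    · convert test_test _ _
      simp [s, State.stk, State.counter, State.setBit, State.setWork]
    · convert run_popBit _ _ using 1
      obtain ⟨i, hi⟩ : ∃ i, N - j = i + 1 := ⟨N - j - 1, by omega⟩
      have hi' : N - (j + 1) = i := by omega
      simp only [s, hi, hi']
      simp [State.counter, State.setBit, State.setWork, List.replicate_succ]
  have r5 := run_popBit (A := A) (w := w) (D := D) (q := q) (c := s N) 0 fun b _ => b
  have := r1.seq (r2.seq (a1.seq (a2.seq (s1.seq (s2.seq (r3.seq (r4.seq r5)))))))
  have hT : Polynomial.eval w.length ((P₁ + P₂ + P₃ + P₄ + 80) * Polynomial.X + 40) =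
      (P₁.eval w.length + P₂.eval w.length + P₃.eval w.length + P₄.eval w.length + 80) * w.length
        + 40 := by
    simp
  rw [hT]
  refine this.congr rfl ?_ ?_
  rotate_left
  · simp [s, State.counter, State.setBit, State.setWork, Formula.eval, hbd]
    rfl
  · have : N ≤ 2 * w.length := by omega
    nlinarith

/-- The stack `2 * l + 2` holds the current set, position `0` on top. A round pushes the bits of the
new set onto the stack `2 * l + 3` in the order of positions, hence reversed; the transfer back
reverses them again. The pointer `k` serves as the number of the round. -/
theorem Formula.RunsIn.iter {φ : Formula Sig (Option (Option α)) (Option β)}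
    {ψ : Formula Sig α (Option β)} {P P' : Polynomial ℕ} (h : φ.RunsIn A Q P)
    (h' : ψ.RunsIn A Q P') : (Formula.iter φ ψ).RunsIn A Q
      ((P + 14) * Polynomial.X * Polynomial.X + 60 * Polynomial.X + P' + 40 +
        22 * Polynomial.X * Polynomial.X) := by
  intro w D q c ρ τ k l e X hD hc
  rw [Formula.depth] at hD
  set O : ℕ → Set ℕ → Set ℕ := fun y Y =>
      {x | x < w.length ∧ φ.eval w (cons x (cons y e)) (cons Y X)} with hO
  have hk : k < D := by omega
  have hk0 := hc.free k le_rfl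
  set j := 2 * l + 2 with hj
  have r1 := run_setBit (A := A) (w := w) (D := D) (q := q) (c := c) fun _ => false
  have r2 : Run w D q (.forAll (A := A) k (.pushBit j fun _ => false)) ((1 + 12) * w.length + 6)
      (c.setBit false) ((c.setBit false).setWork j (bits w.length ∅)) := by
    have := run_forAll (A := A) (w := w) (q := q) (i := k) (D := D) (n := 1)
      (p := .pushBit j fun _ => false) hk
      (fun x => (c.setBit false).setWork j (List.replicate x false)) (fun x _ => hk0) fun x hx => ?_
    · have e0 : (c.setBit false).setWork j (List.replicate 0 false) = c.setBit false :=
        State.setWork_of_eq (hc.empty _ le_rfl)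
      have e1 : bits w.length ∅ = List.replicate w.length false := by
        rw [List.eq_replicate_iff]
        exact ⟨by simp, fun b hb => by
          have : ¬ w = [] ∧ b = false := by simpa [bits] using hb
          exact this.2⟩
      rw [e0] at this
      rw [e1]
      exact this
    · convert run_pushBit _ _ using 1
      simp [State.setBit, State.setWork, State.setPos, List.replicate_succ]
  let F : ℕ → State := fun y => (c.setBit false).setWork j (bits w.length (Formula.iterate O y))
  have hF : ∀ y, Represents w (F y) ρ (cons l τ) k (l + 1) e (cons (Formula.iterate O y) X) :=
    fun y => (hc.setBit false).cons_set _
  have r3 := by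
    refine run_forAll (A := A) (w := w) (q := q) (i := k) (D := D)
      (n := ((P.eval w.length + (1 + 1)) + 12) * w.length + 6 +
        ((4 * w.length + 3) + (6 * w.length + 3)))
      (p := .seq
          (.forAll (k + 1) (.seq (φ.compile (cons (k + 1) (cons k ρ)) (cons l τ) (k + 2) (l + 1))
            (.seq (.pushBit (2 * l + 3) id) (.setBit fun _ => false))))
          (.seq (.clear j) (.transferAll (2 * l + 3) j))) hk F (fun y _ => hk0) fun y hy => ?_
    let G : ℕ → State := fun x => ((F y).setPos k y).setWork (2 * l + 3)
      (bits x (O y (Formula.iterate O y))).reverse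
    have hG : ∀ x, Represents w (G x) (cons k ρ) (cons l τ) (k + 1) (l + 1) (cons y e)
        (cons (Formula.iterate O y) X) := fun x => ((hF y).cons_pos hy).setWork_new _ rfl
    have s1 : Run w D q _ _ (G 0) (G w.length) :=
      run_forAll (A := A) (w := w) (q := q) (i := k + 1) (D := D)
        (n := P.eval w.length + (1 + 1)) (p := .seq (φ.compile (cons (k + 1) (cons k ρ)) (cons l τ)
          (k + 2) (l + 1)) (.seq (.pushBit (2 * l + 3) id) (.setBit fun _ => false))) (by omega) G
        (fun x _ => (hG x).free _ le_rfl) fun x hx => by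
        have t1 := h w D q _ (cons (k + 1) (cons k ρ)) (cons l τ) (k + 2) (l + 1)
          (cons x (cons y e)) (cons (Formula.iterate O y) X) (by omega) ((hG x).cons_pos hx)
        refine t1.seq (Run.seq (run_pushBit (A := A) (2 * l + 3) id) ?_)
        convert run_setBit _ using 1
        have : (x ∈ O y (Formula.iterate O y)) ↔ Formula.eval w φ (cons x (cons y e))
            (cons (Formula.iterate O y) X) := by simp [hO, hx]
        simp only [G, F, State.setBit, State.setWork, State.setPos, update_self, update_idem, id,
          bits_succ, this, List.reverse_append]
        rfl
    have e0 : G 0 = (F y).setPos k y := State.setWork_of_eq (by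
      simp only [F, State.setBit, State.setWork, State.setPos]
      rw [update_of_ne (by omega), hc.empty _ (by omega)]
      simp [bits])
    rw [e0] at s1
    have s2 := run_clear (A := A) (w := w) (D := D) (q := q) (c := G w.length) j (N := w.length) (by
      simp only [G, F, State.setBit, State.setWork, State.setPos]
      rw [update_of_ne (by omega)]
      simp)
    have s3 := run_transferAll (A := A) (w := w) (D := D) (q := q) (c := (G w.length).setWork j [])
      (j := 2 * l + 3) (j' := j) (by omega) (N := w.length) (by
        simp only [G, F, State.setBit, State.setWork, State.setPos]
        rw [update_of_ne (by omega)]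
        simp)
    convert s1.seq (s2.seq s3) using 1
    have hne : j ≠ 2 * l + 3 := by omega
    have hem : c.work (2 * l + 3) = [] := hc.empty _ (by omega)
    simp only [G, F, State.setBit, State.setWork, State.setPos, Formula.iterate]
    congr 1
    funext i
    by_cases hi : i = j
    · subst hi
      rw [update_of_ne hne.symm]
      simp
    · by_cases hi' : i = 2 * l + 3
      · subst hi'
        simp [hne.symm, hem]
      · simp [hi, hi']
  have r4 := h' w D q _ ρ (cons l τ) k (l + 1) e _ (by omega) (hF w.length)
  have r5 := run_clear (A := A) (w := w) (D := D) (q := q) (c := (F w.length).setBit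
    (truth (ψ.eval w e (cons (Formula.iterate O w.length) X)))) j (N := w.length) (by
      simp [F, State.setBit, State.setWork])
  have := r1.seq (r2.seq (r3.seq (r4.seq r5)))
  refine (this.weaken (m := (P.eval w.length + 14) * w.length * w.length + 60 * w.length +
    P'.eval w.length + 40 + 22 * w.length * w.length) (by nlinarith)).congr rfl (by simp) ?_
  · simp only [F, State.setBit, State.setWork, Formula.eval, update_idem]
    rw [← hc.empty j le_rfl, update_eq_self]

/-- Formulas are evaluated in polynomial time. -/
theorem Formula.exists_runsIn (A Q : Type) {α β : Type} (φ : Formula Sig α β) :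
    ∃ P, φ.RunsIn A Q P := by
  induction φ with
  | letter p a =>
    refine ⟨1, fun w D q c ρ τ k l e X hD hc => ?_⟩
    simpa using run_letter p a (by omega) hc
  | lt a b =>
    refine ⟨24 * Polynomial.X + 20, fun w D q c ρ τ k l e X hD hc => ?_⟩
    simpa using run_lt a b (by omega) hc
  | mem s a =>
    refine ⟨24 * Polynomial.X + 20, fun w D q c ρ τ k l e X hD hc => ?_⟩
    simpa using run_mem s a (by omega) hc
  | neg _ ih =>
    obtain ⟨P, h⟩ := ih
    exact ⟨_, h.neg⟩
  | and _ _ ih ih' =>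
    obtain ⟨P, h⟩ := ih
    obtain ⟨P', h'⟩ := ih'
    exact ⟨_, h.and h'⟩
  | ex _ ih =>
    obtain ⟨P, h⟩ := ih
    exact ⟨_, h.ex⟩
  | le _ _ _ _ ih₁ ih₂ ih₃ ih₄ =>
    obtain ⟨P₁, h₁⟩ := ih₁
    obtain ⟨P₂, h₂⟩ := ih₂
    obtain ⟨P₃, h₃⟩ := ih₃
    obtain ⟨P₄, h₄⟩ := ih₄
    exact ⟨_, h₁.le h₂ h₃ h₄⟩
  | iter _ _ ih ih' =>
    obtain ⟨P, h⟩ := ih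
    obtain ⟨P', h'⟩ := ih'
    exact ⟨_, h.iter h'⟩

end StackProg

/-! ### Properties that are defined by formulas are decidable in polynomial time -/

namespace StackProg

open Function

/-- A letter-to-letter transducer. -/
structure Mealy (A Sig Q : Type) where
  init : Q
  out : Q → A → Sig
  next : Q → A → Q

/-- The output of a transducer, started in the state `q`. -/
def Mealy.run {A Sig Q : Type} (M : Mealy A Sig Q) : Q → List A → List Sig
  | _, [] => []
  | q, a :: l => M.out q a :: M.run (M.next q a) l

theorem Mealy.length_run {A Sig Q : Type} (M : Mealy A Sig Q) (q : Q) (l : List A) :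
    (M.run q l).length = l.length := by
  induction l generalizing q with
  | nil => rfl
  | cons a l ih => simp [Mealy.run, ih]

variable {A Sig Q : Type}

/-- A loop that consumes the stack `k`. The invariant is indexed by what remains on `k`; unlike in
`run_repeatWhile`, the stacks need not represent a `State`, as is the case before the pointers are
set up and after they are removed. -/
theorem exec_drain {k : Stk} {p : Prog (Stk.Alphabet A Sig) (Reg Q Sig)} {n : ℕ}
    (I : List (k.Alphabet A Sig) → Reg Q Sig → (∀ k : Stk, List (k.Alphabet A Sig)) → Prop)
    (hk : ∀ l v S, I l v S → S k = l ∧ v.flag = false)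
    (h : ∀ a l v S, I (a :: l) v S → ∃ v' S', Exec p v S n v' S' ∧ I l v' S')
    {l : List (k.Alphabet A Sig)} {v : Reg Q Sig} {S : ∀ k : Stk, List (k.Alphabet A Sig)}
    (hI : I l v S) : ∃ v' S', Exec (.repeatWhile (.test k Option.isSome) p) v S
      ((n + 3) * l.length + 3) v' S' ∧ I [] v' S' := by
  have key : ∀ (l : List (k.Alphabet A Sig)) v S, I l v S → ∃ v' S',
      Exec (.loop (fun v => v.flag) (.seq (.load fun v => { v with flag := false })
        (.seq p (.test k Option.isSome)))) { v with flag := l.head?.isSome } S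
        ((n + 3) * l.length + 1) v' S' ∧ I [] v' S' := by
    intro l
    induction l with
    | nil =>
      intro v S hI
      have e : { v with flag := ([] : List (k.Alphabet A Sig)).head?.isSome } = v := by
        have := (hk _ _ _ hI).2
        cases v
        simp_all
      rw [e]
      exact ⟨v, S, (Exec.loop_false (hk _ _ _ hI).2).weaken (by simp), hI⟩
    | cons a l ih =>
      intro v S hI
      obtain ⟨v₁, S₁, h₁, hI₁⟩ := h a l v S hI
      obtain ⟨v₂, S₂, h₂, hI₂⟩ := ih v₁ S₁ hI₁
      have t : Exec (.test k Option.isSome) v₁ S₁ 1 { v₁ with flag := l.head?.isSome } S₁ := by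
        rw [← (hk _ _ _ hI₁).1]
        exact Exec.peek _ _ _ _
      have e : { v with flag := false } = v := by
        have := (hk _ _ _ hI).2
        cases v
        simp_all
      have l₁ : Exec (.load fun v => { v with flag := false })
          { v with flag := (a :: l).head?.isSome } S 1 v S :=
        (Exec.load _ _ _).congr e rfl
      exact ⟨v₂, S₂, (Exec.loop_true rfl (l₁.seq (h₁.seq t)) h₂).weaken (by
        simp only [List.length_cons]; ring_nf; omega), hI₂⟩
  obtain ⟨v', S', h', hI'⟩ := key l v S hI
  have e : { v' with flag := false } = v' := by
    have := (hk _ _ _ hI').2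
    cases v'
    simp_all
  have t : Exec (.test k Option.isSome) v S 1 { v with flag := l.head?.isSome } S := by
    rw [← (hk _ _ _ hI).1]
    exact Exec.peek _ _ _ _
  exact ⟨v', S', (t.seq (h'.seq ((Exec.load _ _ _).congr e rfl))).weaken (by omega), hI'⟩

namespace Prog

/-- Read the input and write the output of the transducer. -/
def read [Inhabited Sig] (M : Mealy A Sig Q) : Prog (Stk.Alphabet A Sig) (Reg Q Sig) :=
  repeatWhile (test .inp Option.isSome) (.seq (.pop .inp fun v o => o.elim v fun a =>
      { v with sym := some (M.out v.q a), q := M.next v.q a })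
    (.seq (.push (.left 0) fun v => v.sym.getD default) (.load fun v => { v with sym := none })))

/-- Push the symbol in the register on the stacks that represent the right parts of the word. -/
def pushAll [Inhabited Sig] : ℕ → Prog (Stk.Alphabet A Sig) (Reg Q Sig)
  | 0 => .load id
  | i + 1 => .seq (pushAll i) (.push (.right i) fun v => v.sym.getD default)

/-- Distribute the word to the pointers. -/
def distribute [Inhabited Sig] (D : ℕ) : Prog (Stk.Alphabet A Sig) (Reg Q Sig) :=
  repeatWhile (test (.left 0) Option.isSome) (.seq (.pop (.left 0) fun v o => { v with sym := o })
    (.seq (pushAll D) (.load fun v => { v with sym := none })))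

/-- Remove the word. -/
def clearAll : ℕ → Prog (Stk.Alphabet A Sig) (Reg Q Sig)
  | 0 => .load id
  | i + 1 => .seq (repeatWhile (test (.right i) Option.isSome) (.pop (.right i) fun v _ => v))
      (clearAll i)

end Prog

/-- The stacks when the word has been partly distributed to `D` pointers. -/
def splitStk (D : ℕ) (L R : List Sig) : (k : Stk) → List (k.Alphabet A Sig)
  | .inp => []
  | .out => []
  | .left i => if i = 0 then L else []
  | .right i => if i < D then R else []
  | .work _ => []

/-- The output piles up on `left 0` in reverse; distributing it from there to the right halves of
all pointers restores the order and puts the pointers at the beginning. -/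
theorem exec_read [Inhabited Sig] (M : Mealy A Sig Q) (x : List A) (q : Q) :
    ∃ q', Exec (.read M) ⟨false, false, none, q⟩ (update (fun _ => []) .inp x)
      (6 * x.length + 3) ⟨false, false, none, q'⟩ (splitStk 0 (M.run q x).reverse []) := by
  have key := exec_drain (A := A) (Sig := Sig) (Q := Q) (k := .inp) (n := 3)
    (p := .seq (.pop .inp fun v o => o.elim v fun a =>
      { v with sym := some (M.out v.q a), q := M.next v.q a })
    (.seq (.push (.left 0) fun v => v.sym.getD default) (.load fun v => { v with sym := none })))
    (fun l v S => ∃ q' L, v = ⟨false, false, none, q'⟩ ∧ S = update (splitStk 0 L []) .inp l ∧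
      L.reverse ++ M.run q' l = M.run q x) ?_ ?_ (l := x) (v := ⟨false, false, none, q⟩)
      (S := update (fun _ => []) .inp x) ⟨q, [], rfl, ?_, rfl⟩
  · obtain ⟨v', S', h, q', L, hv, hS, hL⟩ := key
    subst hv hS
    refine ⟨q', h.congr rfl ?_⟩
    rw [← hL]
    simp only [Mealy.run, List.append_nil, List.reverse_reverse]
    exact update_eq_self _ _
  · rintro l v S ⟨q', L, rfl, rfl, -⟩
    simp
  · rintro a l v S ⟨q', L, rfl, rfl, hL⟩
    refine ⟨_, _, Exec.seq (n := 1) (m := 2) (Exec.pop _ _ _ _) (Exec.seq (n := 1) (m := 1)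
      (Exec.push _ _ _ _) (Exec.load _ _ _)), M.next q' a, M.out q' a :: L, ?_, ?_, ?_⟩
    · simp
    · funext k
      cases k with
      | left i =>
        by_cases hi : i = 0
        · subst hi
          simp [splitStk]
        · simp [splitStk, hi, update]
      | _ => simp [splitStk, update]
    · simpa [Mealy.run] using hL
  · congr 1
    funext k
    cases k <;> simp [splitStk]

theorem exec_pushAll [Inhabited Sig] (v : Reg Q Sig) (L R : List Sig) {D i : ℕ} (hi : i ≤ D) :
    Exec (.pushAll (A := A) i) v (splitStk D L R) (i + 1) v (fun k => match k with
      | .right j => if j < i then v.sym.getD default :: R else if j < D then R else []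
      | k => splitStk D L R k) := by
  induction i with
  | zero =>
    refine (Exec.load _ _ _).congr rfl ?_
    funext k
    cases k <;> simp [splitStk]
  | succ i ih =>
    refine Exec.seq (n := i + 1) (m := 1) (ih (by omega)) ((Exec.push _ _ _ _).congr rfl ?_)
    funext k
    cases k with
    | right j =>
      by_cases h : j = i
      · subst h
        have : j < D := by omega
        simp [this]
      · rw [update_of_ne (by simpa using h)]
        have : j < i ↔ j < i + 1 := by omega
        simp only [this]
    | _ => rw [update_of_ne (by simp)]

theorem exec_distribute [Inhabited Sig] (w : List Sig) (D : ℕ) (b : Bool) (q : Q) :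
    Exec (.distribute (A := A) D) ⟨b, false, none, q⟩ (splitStk 0 w.reverse [])
      ((D + 6) * w.length + 3) ⟨b, false, none, q⟩ (splitStk D [] w) := by
  have e : splitStk (A := A) 0 w.reverse [] = splitStk D w.reverse [] := by
    funext k
    cases k <;> simp [splitStk]
  rw [e]
  have key := exec_drain (A := A) (Sig := Sig) (Q := Q) (k := .left 0)
    (n := D + 3) (p := .seq (.pop (.left 0) fun v o => { v with sym := o })
    (.seq (.pushAll D) (.load fun v => { v with sym := none })))
    (fun l v S => ∃ R, v = ⟨b, false, none, q⟩ ∧ S = splitStk D l R ∧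
      l.reverse ++ R = w) ?_ ?_ (l := w.reverse) (v := ⟨b, false, none, q⟩)
      (S := splitStk D w.reverse []) ⟨[], rfl, rfl, by simp⟩
  · obtain ⟨v', S', h, R, hv, hS, hR⟩ := key
    subst hv hS
    simp only [List.reverse_nil, List.nil_append] at hR
    subst hR
    have : D + 3 + 3 = D + 6 := by omega
    rw [List.length_reverse, this] at h
    exact h
  · rintro l v S ⟨R, rfl, rfl, -⟩
    simp [splitStk]
  · rintro a l v S ⟨R, rfl, rfl, hR⟩
    refine ⟨_, _, (Exec.seq (n := 1) (m := D + 1 + 1) ((Exec.pop _ _ _ _).congr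
      (v₁ := ⟨b, false, some a, q⟩) rfl ?_)
      (Exec.seq (n := D + 1) (m := 1) (exec_pushAll _ l R le_rfl) (Exec.load _ _ _))).weaken
        (by omega), a :: R, rfl, ?_, ?_⟩
    · funext k
      cases k with
      | left i =>
        by_cases hi : i = 0
        · subst hi
          simp [splitStk]
        · simp [splitStk, hi, update]
      | _ => simp [splitStk, update]
    · funext k
      cases k with
      | right i => by_cases hi : i < D <;> simp [splitStk, hi]
      | _ => rfl
    · simpa using hR

theorem exec_clearAll (w : List Sig) (D : ℕ) (b : Bool) (q : Q) :
    Exec (.clearAll (A := A) D) ⟨b, false, none, q⟩ (splitStk D [] w)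
      (D * (4 * w.length + 3) + 1) ⟨b, false, none, q⟩ (fun _ => []) := by
  induction D with
  | zero =>
    refine (Exec.load _ _ _).congr rfl ?_ |>.weaken (by simp)
    funext k
    cases k <;> simp [splitStk]
  | succ i ih =>
    have key := exec_drain (A := A) (Sig := Sig) (Q := Q) (k := .right i)
      (n := 1) (p := .pop (.right i) fun v _ => v)
      (fun l v S => v = ⟨b, false, none, q⟩ ∧ S = update (splitStk i [] w) (.right i) l) ?_ ?_
      (l := w) (v := ⟨b, false, none, q⟩) (S := splitStk (i + 1) [] w) ⟨rfl, ?_⟩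
    · obtain ⟨v', S', h, hv, hS⟩ := key
      subst hv
      refine (Exec.seq (h.congr rfl ?_) ih).weaken ?_
      · rw [hS]
        funext k
        cases k with
        | right j =>
          by_cases hi : j = i
          · subst hi; simp [splitStk]
          · rw [update_of_ne (by simpa using hi)]
        | _ => simp [splitStk, update]
      · ring_nf
        omega
    · rintro l v S ⟨rfl, rfl⟩
      simp
    · rintro a l v S ⟨rfl, rfl⟩
      refine ⟨_, _, Exec.pop _ _ _ _, rfl, ?_⟩
      simp
    · funext k
      cases k with
      | right j =>
        by_cases hi : j = i
        · subst hi; simp [splitStk]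
        · rw [update_of_ne (by simpa using hi)]
          have : j < i ↔ j < i + 1 := by omega
          simp [splitStk, this]
      | _ => simp [splitStk, update]

/-- A property that is defined by a formula on the output of a transducer is decidable in polynomial
time. -/
theorem Formula.decidableInPolyTime [Inhabited Sig] [Fintype Sig] [Fintype Q] [Fintype A]
    {α : Type} {enc : α → List A} (M : Mealy A Sig Q) (φ : Formula Sig Empty Empty)
    (f : α → Bool)
    (h : ∀ a, f a = true ↔ φ.eval (M.run M.init (enc a)) Empty.elim Empty.elim) :
    Nonempty (Turing.TM2ComputableInPolyTime enc Computability.encodeBool f) := by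
  obtain ⟨P, hP⟩ := φ.exists_runsIn A Q
  -- A sentence has no free pointers, so its depth is the number of pointers needed.
  set D := φ.depth with hD
  refine Prog.decidableInPolyTime (Γ := Stk.Alphabet A Sig) (.seq (.read M) (.seq (.distribute D)
    (.seq (φ.compile Empty.elim Empty.elim 0 0) (.clearAll D)))) .inp .out (by simp)
    (⟨false, false, none, M.init⟩ : Reg Q Sig) (Equiv.refl A) (Equiv.refl Bool) Reg.bit f
    (6 * Polynomial.X + 3 + ((Polynomial.C (D + 6) * Polynomial.X + 3) + (P +
      (Polynomial.C D * (4 * Polynomial.X + 3) + 1)))) fun a => ?_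
  set w := M.run M.init (enc a) with hw
  have hl : w.length = (enc a).length := M.length_run _ _
  obtain ⟨q, h1⟩ := exec_read M (enc a) M.init
  have h2 := exec_distribute (A := A) w D false q
  let c : State := ⟨false, fun _ => 0, fun _ => []⟩
  have h3 := hP w D q c Empty.elim Empty.elim 0 0 Empty.elim Empty.elim (by omega)
    ⟨fun a => a.elim, fun a => a.elim, fun a => a.elim, fun a => a.elim, fun a => a.elim,
      fun _ _ => rfl, fun _ _ => rfl, rfl⟩
  have hc : ∀ b, (c.setBit b).stk (A := A) w D = splitStk D [] w := by
    intro b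
    funext k
    cases k <;> simp [State.stk, splitStk, c, State.setBit]
  have h3' := h3.exec
  rw [hc] at h3'
  have hc' : c.stk (A := A) w D = splitStk D [] w := hc false
  rw [hc'] at h3'
  have h4 := exec_clearAll (A := A) w D (truth (φ.eval w Empty.elim Empty.elim)) q
  refine ⟨⟨truth (φ.eval w Empty.elim Empty.elim), false, none, q⟩, truth_eq (h a), ?_⟩
  simp only [Equiv.refl_symm, Equiv.coe_refl, List.map_id]
  exact (h1.seq (h2.seq (h3'.seq h4))).weaken (by simp [hl])

end StackProg

/-! ### Definable properties -/

namespace StackProg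

variable {Sig α β : Type}

/-- A property of words, positions and sets of positions that is defined by a formula. -/
def Definable (P : List Sig → (α → ℕ) → (β → Set ℕ) → Prop) : Prop :=
  ∃ φ : Formula Sig α β, ∀ w e X, φ.eval w e X ↔ P w e X

namespace Definable

variable {P Q : List Sig → (α → ℕ) → (β → Set ℕ) → Prop}

theorem congr (h : Definable P) (hQ : ∀ w e X, Q w e X ↔ P w e X) : Definable Q :=
  h.imp fun _ h w e X => (h w e X).trans (hQ w e X).symm

theorem letter (p : Sig → Prop) (a : α) :
    Definable (β := β) fun w e _ => ∃ s, w[e a]? = some s ∧ p s := by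
  classical
  exact ⟨.letter (fun s => decide (p s)) a, fun w e X => by simp [Formula.eval]⟩

theorem lt (a b : α) : Definable (Sig := Sig) (β := β) fun _ e _ => e a < e b :=
  ⟨.lt a b, fun _ _ _ => Iff.rfl⟩

theorem mem (s : β) (a : α) : Definable (Sig := Sig) fun _ e X => e a ∈ X s :=
  ⟨.mem s a, fun _ _ _ => Iff.rfl⟩

theorem not (h : Definable P) : Definable fun w e X => ¬ P w e X := by
  obtain ⟨φ, h⟩ := h
  exact ⟨.neg φ, fun w e X => not_congr (h w e X)⟩

theorem and (h : Definable P) (h' : Definable Q) : Definable fun w e X => P w e X ∧ Q w e X := by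
  obtain ⟨φ, h⟩ := h
  obtain ⟨ψ, h'⟩ := h'
  exact ⟨.and φ ψ, fun w e X => and_congr (h w e X) (h' w e X)⟩

theorem or (h : Definable P) (h' : Definable Q) : Definable fun w e X => P w e X ∨ Q w e X :=
  (h.not.and h'.not).not.congr fun _ _ _ => by tauto

theorem imp (h : Definable P) (h' : Definable Q) : Definable fun w e X => P w e X → Q w e X :=
  (h.and h'.not).not.congr fun _ _ _ => by tauto

theorem iff (h : Definable P) (h' : Definable Q) : Definable fun w e X => (P w e X ↔ Q w e X) :=
  ((h.imp h').and (h'.imp h)).congr fun _ _ _ => by tauto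

theorem ne (a b : α) : Definable (Sig := Sig) (β := β) fun _ e _ => e a ≠ e b :=
  ((lt a b).or (lt b a)).congr fun _ _ _ => by omega

theorem eq (a b : α) : Definable (Sig := Sig) (β := β) fun _ e _ => e a = e b :=
  (ne a b).not.congr fun _ _ _ => by omega

theorem le (a b : α) : Definable (Sig := Sig) (β := β) fun _ e _ => e a ≤ e b :=
  (lt b a).not.congr fun _ _ _ => by omega

/-- The bound position is a separate argument of `R`. This lets unification match a property written
with an ordinary quantifier, so that proofs of definability merely repeat the connectives. -/
theorem ex {R : List Sig → (α → ℕ) → (β → Set ℕ) → ℕ → Prop}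
    (h : Definable fun w (e : Option α → ℕ) X => R w (fun a => e (some a)) X (e none)) :
    Definable fun w e X => ∃ x < w.length, R w e X x := by
  obtain ⟨φ, h⟩ := h
  refine ⟨.ex φ, fun w e X => ?_⟩
  simp [Formula.eval, h]

theorem all {R : List Sig → (α → ℕ) → (β → Set ℕ) → ℕ → Prop}
    (h : Definable fun w (e : Option α → ℕ) X => R w (fun a => e (some a)) X (e none)) :
    Definable fun w e X => ∀ x < w.length, R w e X x :=
  (ex (R := fun w e X x => ¬ R w e X x) h.not).not.congr fun _ _ _ => by simp

theorem count_add_le {R₁ R₂ R₃ R₄ : List Sig → (α → ℕ) → (β → Set ℕ) → ℕ → Prop}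
    (h₁ : Definable fun w (e : Option α → ℕ) X => R₁ w (fun a => e (some a)) X (e none))
    (h₂ : Definable fun w (e : Option α → ℕ) X => R₂ w (fun a => e (some a)) X (e none))
    (h₃ : Definable fun w (e : Option α → ℕ) X => R₃ w (fun a => e (some a)) X (e none))
    (h₄ : Definable fun w (e : Option α → ℕ) X => R₄ w (fun a => e (some a)) X (e none)) :
    Definable fun w e X => Formula.count w.length (R₁ w e X) + Formula.count w.length (R₂ w e X) ≤
      Formula.count w.length (R₃ w e X) + Formula.count w.length (R₄ w e X) := by
  obtain ⟨φ₁, h₁⟩ := h₁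
  obtain ⟨φ₂, h₂⟩ := h₂
  obtain ⟨φ₃, h₃⟩ := h₃
  obtain ⟨φ₄, h₄⟩ := h₄
  refine ⟨.le φ₁ φ₂ φ₃ φ₄, fun w e X => ?_⟩
  simp [Formula.eval, h₁, h₂, h₃, h₄]

theorem count_eq {R₁ R₂ : List Sig → (α → ℕ) → (β → Set ℕ) → ℕ → Prop}
    (h₁ : Definable fun w (e : Option α → ℕ) X => R₁ w (fun a => e (some a)) X (e none))
    (h₂ : Definable fun w (e : Option α → ℕ) X => R₂ w (fun a => e (some a)) X (e none)) :
    Definable fun w e X =>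
      Formula.count w.length (R₁ w e X) = Formula.count w.length (R₂ w e X) :=
  ((count_add_le h₁ h₁ h₂ h₂).and (count_add_le h₂ h₂ h₁ h₁)).congr fun _ _ _ => by omega

/-- `R` is the context in which the iterated set is used; the logic has no terms for sets. -/
theorem iterate {F : List Sig → (α → ℕ) → (β → Set ℕ) → ℕ → Set ℕ → ℕ → Prop}
    {R : List Sig → (α → ℕ) → (β → Set ℕ) → Set ℕ → Prop}
    (h : Definable fun w (e : Option (Option α) → ℕ) (X : Option β → Set ℕ) =>
      F w (fun a => e (some (some a))) (fun s => X (some s)) (e (some none)) (X none) (e none))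
    (h' : Definable fun w e (X : Option β → Set ℕ) => R w e (fun s => X (some s)) (X none)) :
    Definable fun w e X => R w e X
      (Formula.iterate (fun y Y => {x | x < w.length ∧ F w e X y Y x}) w.length) := by
  obtain ⟨φ, h⟩ := h
  obtain ⟨ψ, h'⟩ := h'
  refine ⟨.iter φ ψ, fun w e X => ?_⟩
  simp [Formula.eval, h, h']

end Definable

/-- A definable property of words is decidable in polynomial time, after the application of a
transducer. -/
theorem Definable.decidableInPolyTime {A Q α : Type} [Inhabited Sig] [Fintype Sig] [Fintype Q]
    [Fintype A] {enc : α → List A} (M : Mealy A Sig Q) {P : List Sig → Prop}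
    (hP : Definable fun w (_ : Empty → ℕ) (_ : Empty → Set ℕ) => P w) (f : α → Bool)
    (h : ∀ a, f a = true ↔ P (M.run M.init (enc a))) :
    Nonempty (Turing.TM2ComputableInPolyTime enc Computability.encodeBool f) := by
  obtain ⟨φ, hφ⟩ := hP
  exact φ.decidableInPolyTime M f fun a => (h a).trans (hφ _ _ _).symm

end StackProg

/-! ### Selections of approval ballots with bounded scores -/

namespace GSVoting

open Finset Function

/-- Every voter `i` has a set `L i` of ballots; the ballot `x` approves the two candidates in `T x`,
and the ballots of a voter have candidates in common. The score of the candidate `c` is required to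
be a number `k` with `ok c k`. -/
structure Ballots (ι : Type) where
  C : Finset ℕ
  L : ι → Finset ℕ
  T : ℕ → Finset ℕ
  ok : ℕ → ℕ → Prop
  subset : ∀ i, ∀ x ∈ L i, T x ⊆ C
  card_two : ∀ i, ∀ x ∈ L i, #(T x) = 2
  inter : ∀ i, ∀ x ∈ L i, ∀ y ∈ L i, ∃ c ∈ T x, c ∈ T y
  ok_mono : ∀ c k l, k ≤ l → ok c l → ok c k

namespace Ballots

variable {ι : Type} [Fintype ι] (B : Ballots ι)

/-- The number of approvals of `c`. -/
def score (s : ι → ℕ) (c : ℕ) : ℕ := #{i | c ∈ B.T (s i)}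

/-- Replacing the ballot of `i` by `e` moves an approval from `x` to `y`. -/
def Arrow (s : ι → ℕ) (i : ι) (e x y : ℕ) : Prop :=
  e ∈ B.L i ∧ x ∈ B.T (s i) ∧ x ∉ B.T e ∧ y ∈ B.T e ∧ y ∉ B.T (s i)

/-- The candidates from which an approval can be moved in `j - 1` steps to a candidate whose score
may be increased. -/
def layer (s : ι → ℕ) : ℕ → Set ℕ
  | 0 => ∅
  | j + 1 => {c | c ∈ B.C ∧ (B.ok c (B.score s c + 1) ∨
      ∃ i e y, B.Arrow s i e c y ∧ y ∈ layer s j)}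

/-- A layer without candidates that have too many approvals. -/
def Free (s : ι → ℕ) (j : ℕ) : Prop := ∀ c ∈ B.layer s j, B.ok c (B.score s c)

/-- The first step of a shortest path of moves from a candidate with too many approvals. -/
def Good (J : ℕ) (s : ι → ℕ) (i : ι) (e : ℕ) : Prop :=
  ∃ x y, ∃ j < J, B.Arrow s i e x y ∧ ¬ B.ok x (B.score s x) ∧ y ∈ B.layer s j ∧ B.Free s j

/-- The sequence `s` of selections arises by good moves, as long as there are any. -/
structure Improving [DecidableEq ι] (J : ℕ) (s : ℕ → ι → ℕ) : Prop where
  mem : ∀ i, s 0 i ∈ B.L i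
  step : ∀ n, (∃ i e, B.Good J (s n) i e ∧ s (n + 1) = update (s n) i e) ∨
    ((∀ i e, ¬ B.Good J (s n) i e) ∧ s (n + 1) = s n)

/-- The total number of approvals in excess. -/
noncomputable def excess (s : ι → ℕ) : ℕ := by
  classical exact ∑ c ∈ B.C, #{k ∈ range (B.score s c) | ¬ B.ok c (k + 1)}

/-- The length of a shortest path, if there is one. -/
noncomputable def dist (s : ι → ℕ) : ℕ := by
  classical exact if h : ∃ j, ¬ B.Free s j then Nat.find h else 0

variable {B} {s t : ι → ℕ} {i : ι} {e x y J : ℕ}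

omit [Fintype ι] in
-- Two pairs with a common candidate that are not equal share exactly one, so a change of ballot
-- moves a single approval and leaves all other scores alone.
theorem Arrow.exists_common (h : B.Arrow s i e x y) (hs : s i ∈ B.L i) :
    ∃ t, B.T (s i) = {x, t} ∧ B.T e = {y, t} ∧ t ≠ x ∧ t ≠ y ∧ x ≠ y := by
  obtain ⟨he, h1, h2, h3, h4⟩ := h
  obtain ⟨t, ht, ht'⟩ := B.inter i _ hs _ he
  have hx : t ≠ x := by rintro rfl; exact h2 ht'
  have hy : t ≠ y := by rintro rfl; exact h4 ht
  refine ⟨t, ?_, ?_, hx, hy, by rintro rfl; exact h4 h1⟩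
  · refine (eq_of_subset_of_card_le ?_ ?_).symm
    · simp [insert_subset_iff, h1, ht]
    · rw [B.card_two i _ hs, card_pair hx.symm]
  · refine (eq_of_subset_of_card_le ?_ ?_).symm
    · simp [insert_subset_iff, h3, ht']
    · rw [B.card_two i _ he, card_pair hy.symm]

theorem layer_subset_succ (j : ℕ) : B.layer s j ⊆ B.layer s (j + 1) := by
  induction j with
  | zero => exact Set.empty_subset _
  | succ j ih =>
    rintro c ⟨hc, h | ⟨i, e, y, h, hy⟩⟩
    · exact ⟨hc, Or.inl h⟩
    · exact ⟨hc, Or.inr ⟨i, e, y, h, ih hy⟩⟩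

theorem layer_mono {j k : ℕ} (h : j ≤ k) : B.layer s j ⊆ B.layer s k :=
  monotone_nat_of_le_succ (f := B.layer s) layer_subset_succ h

theorem layer_subset (j : ℕ) : B.layer s j ⊆ ↑B.C := by
  cases j with
  | zero => exact Set.empty_subset _
  | succ j => exact fun c h => h.1

theorem Free.of_le {j k : ℕ} (h : B.Free s k) (hj : j ≤ k) : B.Free s j :=
  fun c hc => h c (layer_mono hj hc)

/-- The layers grow strictly up to the first one that is not free: if two consecutive layers agree,
all later ones agree with them, and an earlier layer would fail to be free. -/
theorem dist_le : B.dist s ≤ #B.C := by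
  classical
  unfold dist
  split_ifs with h
  · have hne : ∀ j < Nat.find h, B.layer s j ≠ B.layer s (j + 1) := by
      intro j hj he
      have : ∀ k, B.layer s (j + k) = B.layer s j := by
        intro k
        induction k with
        | zero => rfl
        | succ k ih =>
          rw [← add_assoc, layer, ih]
          exact he.symm
      have h1 := Nat.find_spec h
      obtain ⟨k, hk⟩ := Nat.exists_eq_add_of_le hj.le
      rw [hk, Free, this] at h1
      exact Nat.find_min h hj h1
    have key : ∀ j ≤ Nat.find h, j ≤ (B.layer s j).ncard := by
      intro j
      induction j with
      | zero => simp
      | succ j ih =>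
        intro hj
        exact (Nat.succ_le_succ (ih (by omega))).trans (Set.ncard_lt_ncard
          ((layer_subset_succ j).ssubset_of_ne (hne j hj)) (B.C.finite_toSet.subset (layer_subset _)))
    refine (key _ le_rfl).trans ?_
    rw [← Set.ncard_coe_finset]
    exact Set.ncard_le_ncard (layer_subset _) B.C.finite_toSet
  · exact Nat.zero_le _

variable [DecidableEq ι]

theorem score_update (s : ι → ℕ) (i : ι) (e c : ℕ) :
    B.score (update s i e) c + (if c ∈ B.T (s i) then 1 else 0) =
      B.score s c + (if c ∈ B.T e then 1 else 0) := by
  have h : ∀ t : ι → ℕ, B.score t c = #{j | j ≠ i ∧ c ∈ B.T (t j)} +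
      if c ∈ B.T (t i) then 1 else 0 := by
    intro t
    have : (univ.filter fun j => c ∈ B.T (t j)) = (univ.filter fun j => j ≠ i ∧ c ∈ B.T (t j)) ∪
        if c ∈ B.T (t i) then {i} else ∅ := by
      ext j
      by_cases hj : j = i
      · subst hj
        split_ifs with h <;> simp [h]
      · split_ifs with h <;> simp [hj]
    rw [score, this, card_union_of_disjoint]
    · split_ifs <;> simp
    · split_ifs <;> simp
  rw [h s, h (update s i e)]
  have : (univ.filter fun j => j ≠ i ∧ c ∈ B.T (update s i e j)) =
      univ.filter fun j => j ≠ i ∧ c ∈ B.T (s j) := by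
    ext j
    by_cases hj : j = i
    · simp [hj]
    · simp [hj]
  rw [this]
  simp
  omega

theorem Arrow.score_left (h : B.Arrow s i e x y) :
    B.score (update s i e) x + 1 = B.score s x := by
  have := B.score_update s i e x
  simpa [h.2.1, h.2.2.1] using this

theorem Arrow.score_right (h : B.Arrow s i e x y) :
    B.score (update s i e) y = B.score s y + 1 := by
  have := B.score_update s i e y
  simpa [h.2.2.2.1, h.2.2.2.2] using this

theorem Arrow.score_other (h : B.Arrow s i e x y) (hs : s i ∈ B.L i) {c : ℕ} (hx : c ≠ x)
    (hy : c ≠ y) : B.score (update s i e) c = B.score s c := by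
  obtain ⟨t, h1, h2, -⟩ := h.exists_common hs
  have := B.score_update s i e c
  simpa [h1, h2, hx, hy] using this

/-- A move along the first edge of a shortest path does not destroy the paths of length up to `j`.
Only arrows of the voter `i` himself are in danger; if one of them started at a candidate `c` of a
layer, the three ballots would form a triangle on `x`, `c`, `y`, and `x` would lie in a layer that
is free of overfull candidates. -/
theorem Good.layer_subset (hs : ∀ i, s i ∈ B.L i) (h : B.Arrow s i e x y)
    (hx : ¬ B.ok x (B.score s x)) {j : ℕ} (hj : B.Free s j) (hy : ¬ B.ok y (B.score s y + 1)) :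
    ∀ k ≤ j, B.layer s k ⊆ B.layer (update s i e) k := by
  intro k
  induction k with
  | zero => exact fun _ => Set.empty_subset _
  | succ k ih =>
    rintro hk c ⟨hc, h'⟩
    have hcx : c ≠ x := by
      rintro rfl
      exact hx (hj _ (layer_mono hk ⟨hc, h'⟩))
    obtain h' | ⟨i', e', y', h', hy'⟩ := h'
    · refine ⟨hc, Or.inl ?_⟩
      have hcy : c ≠ y := by rintro rfl; exact hy h'
      rwa [h.score_other (hs i) hcx hcy]
    · refine ⟨hc, Or.inr ⟨i', e', y', ?_, ih (by omega) hy'⟩⟩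
      by_cases hi : i' = i
      -- The current ballot is `{x, c}`, the new one `{y, c}`, and the arrow from `c` leads to `{y',
      -- x}`. The last two must meet, so `y' = y`.
      · exfalso
        subst hi
        obtain ⟨t, h1, h2, htx, hty, hxy⟩ := h.exists_common (hs i')
        have hct : c = t := by
          have := h'.2.1
          rw [h1] at this
          simpa [hcx] using this
        subst hct
        obtain ⟨t', h1', h2', -, -, -⟩ := h'.exists_common (hs i')
        have hxt : x = t' := by
          have : x ∈ B.T (s i') := h.2.1
          rw [h1'] at this
          simpa [hcx.symm] using this
        subst hxt
        obtain ⟨d, hd, hd'⟩ := B.inter i' _ h.1 _ h'.1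
        rw [h2] at hd
        rw [h2'] at hd'
        simp only [mem_insert, mem_singleton] at hd hd'
        have : y' = y := by
          rcases hd with rfl | rfl <;> rcases hd' with rfl | rfl
          · rfl
          · exact (hxy rfl).elim
          · exact (h'.2.2.2.2 h'.2.1).elim
          · exact (hcx rfl).elim
        subst this
        -- The arrow from `x` to `y`, with `y` in layer `k`, puts `x` into layer `k + 1`.
        exact hx (hj x (layer_mono hk ⟨B.subset _ _ (hs i') h.2.1, Or.inr ⟨i', e, _, h, hy'⟩⟩))
      · simpa [Arrow, hi] using h'

omit [DecidableEq ι] in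
-- A move changes only the scores of `x` and `y`. Here `g c k` is the number of approvals of `c`
-- beyond its bound when it has `k`.
theorem excess_eq_add {x y : ℕ} (hx : x ∈ B.C) (hy : y ∈ B.C) (hxy : x ≠ y) :
    ∃ g : (ℕ → ℕ → ℕ), (∀ c k, g c (k + 1) = g c k + (by classical exact if B.ok c (k + 1) then 0 else 1)) ∧
      ∀ t : ι → ℕ, B.excess t = g x (B.score t x) + g y (B.score t y) +
        ∑ c ∈ (B.C.erase x).erase y, g c (B.score t c) := by
  classical
  refine ⟨fun c k => #{k ∈ range k | ¬ B.ok c (k + 1)}, fun c k => ?_, fun t => ?_⟩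
  · beta_reduce
    rw [range_add_one, filter_insert]
    split_ifs <;> simp_all
  · rw [excess, ← add_sum_erase _ _ hx, ← add_sum_erase _ _ (mem_erase.2 ⟨hxy.symm, hy⟩), add_assoc]

/-- The approval taken from `x` was in excess. If `y` had room, the total excess drops by one, which
outweighs any change of the distance, bounded by `#B.C`. Otherwise the excess has moved to `y`,
which is nearer to a candidate with room. -/
theorem Good.measure_lt (hs : ∀ i, s i ∈ B.L i) (h : B.Good J s i e) :
    B.excess (update s i e) * #B.C + B.dist (update s i e) < B.excess s * #B.C + B.dist s := by
  classical
  obtain ⟨x, y, j, -, h, hx, hyj, hj⟩ := h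
  obtain ⟨t, h1, h2, htx, hty, hxy⟩ := h.exists_common (hs i)
  have hxC : x ∈ B.C := B.subset _ _ (hs i) h.2.1
  have hyC : y ∈ B.C := B.subset _ _ h.1 h.2.2.2.1
  obtain ⟨g, hg, hex⟩ := B.excess_eq_add hxC hyC hxy
  have hbad : ∃ j, ¬ B.Free s j := ⟨j + 1, fun hf => hx (hf x ⟨hxC, Or.inr ⟨i, e, y, h, hyj⟩⟩)⟩
  have hds : B.dist s = Nat.find hbad := by rw [dist, dif_pos hbad]
  have hjd : j < B.dist s := by
    rw [hds]
    by_contra hc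
    exact Nat.find_spec hbad (hj.of_le (by omega))
  have hsum : ∑ c ∈ (B.C.erase x).erase y, g c (B.score (update s i e) c) =
      ∑ c ∈ (B.C.erase x).erase y, g c (B.score s c) := by
    refine sum_congr rfl fun c hc => ?_
    simp only [mem_erase] at hc
    rw [h.score_other (hs i) hc.2.1 hc.1]
  have hgx : g x (B.score s x) = g x (B.score (update s i e) x) + 1 := by
    have := hg x (B.score (update s i e) x)
    rw [h.score_left, if_neg hx] at this
    exact this
  have hgy := hg y (B.score s y)
  rw [← h.score_right] at hgy
  have e1 := hex s
  have e2 := hex (update s i e)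
  rw [hsum] at e2
  by_cases hy : B.ok y (B.score s y + 1)
  · rw [h.score_right, if_pos hy, ← h.score_right] at hgy
    have : B.excess s = B.excess (update s i e) + 1 := by omega
    rw [this, add_mul, one_mul]
    have := B.dist_le (s := update s i e)
    omega
  · rw [h.score_right, if_neg hy, ← h.score_right] at hgy
    have : B.excess s = B.excess (update s i e) := by omega
    rw [this]
    -- `y` is now overfull and still belongs to layer `j`.
    have hy' : ¬ B.Free (update s i e) j := fun hf =>
      hy (h.score_right ▸ hf y (Good.layer_subset hs h hx hj hy j le_rfl hyj))
    have : B.dist (update s i e) ≤ j := by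
      rw [dist, dif_pos ⟨j, hy'⟩]
      exact Nat.find_min' _ hy'
    omega

omit [DecidableEq ι] in
theorem excess_le (s : ι → ℕ) (hs : ∀ i, s i ∈ B.L i) : B.excess s ≤ 2 * Fintype.card ι := by
  classical
  calc B.excess s ≤ ∑ c ∈ B.C, B.score s c := by
        refine sum_le_sum fun c _ => ?_
        exact (card_filter_le _ _).trans (card_range _).le
    _ = ∑ i, #(B.T (s i)) := by
        simp only [score, card_filter]
        rw [sum_comm]
        refine sum_congr rfl fun i _ => ?_
        rw [← card_filter, filter_mem_eq_inter, inter_eq_right.2 (B.subset _ _ (hs i))]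
    _ = 2 * Fintype.card ι := by
        rw [sum_congr rfl fun i _ => B.card_two i _ (hs i)]
        simp [mul_comm]

omit [DecidableEq ι] in
-- A cut argument. Without good moves every layer is free, so the overfull `c` lies in no layer. Let
-- `A` be the set of candidates in no layer. No arrow leaves `A`, so no selection gives `A` fewer
-- approvals in total than `s`. But `A` has no room under `s`, so admissible scores would be at most
-- those of `s` on `A`, and smaller at `c`.
theorem not_good (hJ : #B.C < J) (hs : ∀ i, s i ∈ B.L i) (h : ∀ i e, ¬ B.Good J s i e) {c : ℕ}
    (hcC : c ∈ B.C) (hc : ¬ B.ok c (B.score s c)) (ht : ∀ i, t i ∈ B.L i) :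
    ∃ d ∈ B.C, ¬ B.ok d (B.score t d) := by
  classical
  by_contra! hok
  have hfree : ∀ j, B.Free s j := by
    by_contra! hbad
    have hle := B.dist_le (s := s)
    have hds : B.dist s = Nat.find hbad := by rw [dist, dif_pos hbad]
    have hsp := Nat.find_spec hbad
    have hmin := fun m hm => Nat.find_min hbad (m := m) hm
    rw [← hds] at hsp hmin
    cases hd : B.dist s with
    | zero =>
      rw [hd] at hsp
      exact hsp fun c hc => hc.elim
    | succ j =>
      rw [hd] at hsp
      simp only [Free, not_forall] at hsp
      obtain ⟨x, ⟨hxC, hx | ⟨i, e, y, h', hy⟩⟩, hx'⟩ := hsp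
      · exact hx' (B.ok_mono _ _ _ (Nat.le_succ _) hx)
      · exact h i e ⟨x, y, j, by omega, h', hx', hy, not_not.1 (hmin j (by omega))⟩
  -- The candidates from which no room can be reached.
  let A : Finset ℕ := B.C.filter fun c => ∀ j, c ∉ B.layer s j
  have hcA : c ∈ A := mem_filter.2 ⟨hcC, fun j hj => hc (hfree j c hj)⟩
  have hle : ∀ d ∈ A, B.score t d ≤ B.score s d := by
    intro d hd
    rw [mem_filter] at hd
    by_contra! hlt
    exact hd.2 1 ⟨hd.1, Or.inl (B.ok_mono _ _ _ hlt (hok d hd.1))⟩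
  have hlt : B.score t c < B.score s c := by
    by_contra! hle
    exact hc (B.ok_mono _ _ _ hle (hok c hcC))
  have hsum : ∀ r : ι → ℕ, ∑ d ∈ A, B.score r d = ∑ i, #(A ∩ B.T (r i)) := by
    intro r
    simp only [score, card_filter]
    rw [sum_comm]
    refine sum_congr rfl fun i _ => ?_
    rw [← card_filter, filter_mem_eq_inter]
  have h1 : ∑ d ∈ A, B.score t d < ∑ d ∈ A, B.score s d := sum_lt_sum hle ⟨c, hcA, hlt⟩
  have h2 : ∑ d ∈ A, B.score s d ≤ ∑ d ∈ A, B.score t d := by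
    rw [hsum, hsum]
    refine sum_le_sum fun i _ => ?_
    by_cases hsub : A ∩ B.T (s i) ⊆ A ∩ B.T (t i)
    · exact card_le_card hsub
    · obtain ⟨x, hx, hx'⟩ := not_subset.1 hsub
      rw [mem_inter] at hx
      have hxt : x ∉ B.T (t i) := fun h' => hx' (mem_inter.2 ⟨hx.1, h'⟩)
      obtain ⟨y, hy, hy'⟩ : ∃ y ∈ B.T (t i), y ∉ B.T (s i) := by
        by_contra! hcon
        have := eq_of_subset_of_card_le hcon (by rw [B.card_two i _ (hs i), B.card_two i _ (ht i)])
        exact hxt (this ▸ hx.2)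
      have harr : B.Arrow s i (t i) x y := ⟨ht i, hx.2, hxt, hy, hy'⟩
      -- If `y` were in a layer, the arrow would put `x` into the next one.
      have hyA : y ∈ A := by
        refine mem_filter.2 ⟨B.subset _ _ (ht i) hy, fun j hj => ?_⟩
        exact (mem_filter.1 hx.1).2 (j + 1) ⟨(mem_filter.1 hx.1).1, Or.inr ⟨i, t i, y, harr, hj⟩⟩
      obtain ⟨u, e1, e2, hux, huy, hxy⟩ := harr.exists_common (hs i)
      rw [e1, e2]
      have : A ∩ {y, u} = insert y ((A ∩ {x, u}).erase x) := by
        ext d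
        simp only [mem_inter, mem_insert, mem_singleton, mem_erase]
        constructor
        · rintro ⟨hd, rfl | rfl⟩
          · exact Or.inl rfl
          · exact Or.inr ⟨hux, hd, Or.inr rfl⟩
        · rintro (rfl | ⟨hne, hd, rfl | rfl⟩)
          · exact ⟨hyA, Or.inl rfl⟩
          · exact (hne rfl).elim
          · exact ⟨hd, Or.inr rfl⟩
      rw [this, card_insert_of_notMem, card_erase_of_mem]
      · omega
      · simp [hx.1]
      · simp [hxy.symm, huy.symm]
  omega

namespace Improving

variable {S : ℕ → ι → ℕ}

theorem mem_all (h : B.Improving J S) (n : ℕ) (i : ι) : S n i ∈ B.L i := by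
  induction n generalizing i with
  | zero => exact h.mem i
  | succ n ih =>
    obtain ⟨i', e, hg, hS⟩ | ⟨-, hS⟩ := h.step n
    · rw [hS]
      by_cases hi : i = i'
      · subst hi
        obtain ⟨_, _, _, _, ha, _⟩ := hg
        simpa using ha.1
      · simpa [hi] using ih i
    · rw [hS]
      exact ih i

/-- The measure starts at no more than `(2 * Fintype.card ι + 1) * #B.C`: there are two approvals
per voter, and the distance is at most `#B.C`. Every good move decreases it. -/
theorem stuck (h : B.Improving J S) {n : ℕ} (hn : (2 * Fintype.card ι + 1) * #B.C ≤ n) (i : ι)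
    (e : ℕ) : ¬ B.Good J (S n) i e := by
  have key : ∀ n, (∀ i e, ¬ B.Good J (S n) i e) ∨
      B.excess (S n) * #B.C + B.dist (S n) + n ≤ (2 * Fintype.card ι + 1) * #B.C := by
    intro n
    induction n with
    | zero =>
      right
      have h1 := Nat.mul_le_mul_right #B.C (B.excess_le (S 0) h.mem)
      have h2 := B.dist_le (s := S 0)
      rw [add_mul, one_mul]
      omega
    | succ n ih =>
      obtain ⟨i', e, hg, hS⟩ | ⟨hg, hS⟩ := h.step n
      · right
        have := hg.measure_lt (h.mem_all n)
        rw [← hS] at this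
        have := ih.resolve_left fun h' => h' _ _ hg
        omega
      · left
        rw [hS]
        exact hg
  obtain h' | h' := key n
  · exact h' i e
  · intro hg
    have := hg.measure_lt (h.mem_all n)
    omega

/-- Good moves lead to admissible scores, if these are possible at all. -/
theorem ok (h : B.Improving J S) (hJ : #B.C < J) {n : ℕ}
    (hn : (2 * Fintype.card ι + 1) * #B.C ≤ n) (ht : ∀ i, t i ∈ B.L i)
    (hok : ∀ c ∈ B.C, B.ok c (B.score t c)) {c : ℕ} (hc : c ∈ B.C) :
    B.ok c (B.score (S n) c) := by
  by_contra hcon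
  obtain ⟨d, hd, hd'⟩ := not_good hJ (h.mem_all n) (h.stuck hn) hc hcon ht
  exact hd' (hok d hd)

/-- Moves take approvals only from candidates whose score is not admissible, and an admissible `k`
lies strictly below such a score. Hence the lower bounds persist. -/
theorem le_score (h : B.Improving J S) {c k : ℕ} (hok : B.ok c k) (hk : k ≤ B.score (S 0) c)
    (n : ℕ) : k ≤ B.score (S n) c := by
  induction n with
  | zero => exact hk
  | succ n ih =>
    obtain ⟨i, e, ⟨x, y, j, -, ha, hx, -, -⟩, hS⟩ | ⟨-, hS⟩ := h.step n
    · rw [hS]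
      by_cases hcx : c = x
      · subst hcx
        have h1 := ha.score_left
        by_contra! hlt
        exact hx (B.ok_mono _ _ _ (by omega) hok)
      · by_cases hcy : c = y
        · subst hcy
          have h1 := ha.score_right
          omega
        · rwa [ha.score_other (h.mem_all n i) hcx hcy]
    · rwa [hS]

end Improving

end Ballots

end GSVoting

/-! ### Starting selections that favour two given candidates -/

namespace GSVoting

open Finset Function

namespace Ballots

variable {ι : Type} [Fintype ι] {B : Ballots ι} {s s' t : ι → ℕ} {p q z : ℕ} {own : ι → ℕ}

/-- The ballot `x` is at least as good as `y`, if a voter tries to approve `p`, and then `q`. -/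
def weight (B : Ballots ι) (p q x : ℕ) : ℕ :=
  2 * (if p ∈ B.T x then 1 else 0) + if q ∈ B.T x then 1 else 0

/-- The voters before `z` prefer to approve `p`, and the others prefer to approve `q`. -/
def Threshold (B : Ballots ι) (own : ι → ℕ) (p q z : ℕ) (s : ι → ℕ) : Prop :=
  ∀ i, s i ∈ B.L i ∧ ∀ e ∈ B.L i, (z ≤ own i → B.weight q p e ≤ B.weight q p (s i)) ∧
    (own i < z → B.weight p q e ≤ B.weight p q (s i))

omit [Fintype ι] in
theorem mem_of_weight_le {x y : ℕ} (h : B.weight p q x ≤ B.weight p q y) (hx : p ∈ B.T x) :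
    p ∈ B.T y := by
  by_contra hy
  simp only [weight, hx, hy, if_true, if_false] at h
  split_ifs at h <;> omega

omit [Fintype ι] in
-- The preference for `p` over `q` only decides between ballots that approve exactly one of them, so
-- a ballot of maximal weight also approves as many of the two as possible.
theorem add_le_of_weight_le {x y : ℕ} (h : B.weight p q x ≤ B.weight p q y) :
    (if p ∈ B.T x then 1 else 0) + (if q ∈ B.T x then 1 else 0) ≤
      (if p ∈ B.T y then 1 else 0) + if q ∈ B.T y then 1 else 0 := by
  unfold weight at h
  split_ifs at h ⊢ <;> omega

theorem Threshold.add_le (h : B.Threshold own p q z s) (ht : ∀ i, t i ∈ B.L i) :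
    B.score t p + B.score t q ≤ B.score s p + B.score s q := by
  simp only [score, card_filter, ← sum_add_distrib]
  refine sum_le_sum fun i _ => ?_
  obtain h' | h' := le_or_gt z (own i)
  · have := add_le_of_weight_le (((h i).2 _ (ht i)).1 h')
    omega
  · exact add_le_of_weight_le (((h i).2 _ (ht i)).2 h')

/-- Only the voter with `own i = z` changes his preference. For later voters both ballots have
maximal weight, and the weight determines which of `p`, `q` is approved. -/
theorem Threshold.succ_le (hown : Injective own) (h : B.Threshold own p q (z + 1) s)
    (h' : B.Threshold own p q z s') : B.score s p ≤ B.score s' p + 1 := by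
  classical
  have hsub : (univ.filter fun i => p ∈ B.T (s i)) ⊆
      (univ.filter fun i => p ∈ B.T (s' i)) ∪ univ.filter fun i => own i = z := by
    intro i hi
    simp only [mem_filter, mem_univ, true_and, mem_union] at hi ⊢
    by_cases hz : own i = z
    · exact Or.inr hz
    · left
      obtain hlt | hlt := lt_or_gt_of_ne hz
      · exact mem_of_weight_le (((h' i).2 _ (h i).1).2 hlt) hi
      · have h1 := ((h' i).2 _ (h i).1).1 hlt.le
        have h2 := ((h i).2 _ (h' i).1).1 hlt
        have h3 : B.weight q p (s i) = B.weight q p (s' i) := le_antisymm h1 h2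
        by_contra hp
        simp only [weight, hi, hp, if_true, if_false] at h3
        split_ifs at h3 <;> omega
  refine (card_le_card hsub).trans ((card_union_le _ _).trans (Nat.add_le_add_left ?_ _))
  refine card_le_one.2 fun i hi j hj => hown ?_
  rw [(mem_filter.1 hi).2, (mem_filter.1 hj).2]

/-- For some threshold the scores of `p` and `q` are large enough. -/
theorem exists_threshold (hown : Injective own) {S : ℕ → ι → ℕ}
    (hS : ∀ z, B.Threshold own p q z (S z)) {Z : ℕ} (hZ : ∀ i, own i < Z)
    (ht : ∀ i, t i ∈ B.L i) :
    ∃ z ≤ Z, B.score t p ≤ B.score (S z) p ∧ B.score t q ≤ B.score (S z) q := by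
  classical
  have hex : B.score t p ≤ B.score (S Z) p := by
    refine card_le_card fun i hi => ?_
    simp only [mem_filter, mem_univ, true_and] at hi ⊢
    exact mem_of_weight_le (((hS Z i).2 _ (ht i)).2 (hZ i)) hi
  have hex' : ∃ z, B.score t p ≤ B.score (S z) p := ⟨Z, hex⟩
  -- Take the least threshold at which `p` has enough. If it is `0`, every voter favours `q`.
  -- Otherwise the previous threshold gave `p` too little, so now `p` has no more than in `t`; since
  -- the joint score is maximal, `q` has at least as much as in `t`.
  refine ⟨Nat.find hex', Nat.find_min' hex' hex, Nat.find_spec hex', ?_⟩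
  cases hz : Nat.find hex' with
  | zero =>
    refine card_le_card fun i hi => ?_
    simp only [mem_filter, mem_univ, true_and] at hi ⊢
    exact mem_of_weight_le (((hS 0 i).2 _ (ht i)).1 (Nat.zero_le _)) hi
  | succ z =>
    have h1 := Nat.find_min hex' (m := z) (by omega)
    have h2 := (hS (z + 1)).succ_le hown (hS z)
    have h3 := (hS (z + 1)).add_le ht
    omega

end Ballots

/-! ### The algorithm on sets of positions -/

/-- The numbers below `size` serve as candidates and as ballots; ballots are related by `Same` if
they belong to the same voter. `Late x z` compares the voter of the ballot `x` with a threshold. -/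
structure Arena where
  size : ℕ
  Cand : ℕ → Prop
  Same : ℕ → ℕ → Prop
  Late : ℕ → ℕ → Prop
  Top : ℕ → ℕ → Prop
  Pref : ℕ → ℕ → Prop

/-- The candidate `p` is to win, by means of `k` approvals, when the first voter approves `a`
and `b`. -/
structure Target where
  a : ℕ
  b : ℕ
  p : ℕ
  k : ℕ

open StackProg.Formula (count iterate)

namespace Target

/-- If the candidates `c` and `p` get as many approvals as there are solutions of `R` and `S`,
then `p` is not defeated by `c`. -/
def Below (N : ℕ) (t : Target) (R S : ℕ → Prop) (c : ℕ) : Prop :=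
  count N R + count N (fun x => (x = c ∧ (c = t.a ∨ c = t.b)) ∨ (x = t.p ∧ c < t.p)) ≤
    count N S + count N fun x => x = t.p ∧ (t.p = t.a ∨ t.p = t.b)

/-- If the candidates `c` and `p` get `k` and `l` approvals, then `p` is not defeated by `c`. -/
def Bound (t : Target) (c k l : ℕ) : Prop :=
  k + (if c = t.a ∨ c = t.b then 1 else 0) + (if c < t.p then 1 else 0) ≤
    l + if t.p = t.a ∨ t.p = t.b then 1 else 0

end Target

namespace Arena

variable (A : Arena)

def Arrow (X : Set ℕ) (e x y : ℕ) : Prop :=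
  ∃ b < A.size, b ∈ X ∧ A.Same b e ∧ A.Top b x ∧ ¬ A.Top e x ∧ A.Top e y ∧ ¬ A.Top b y

/-- The score of `c` is not too large. -/
def Ok (t t' : Target) (X : Set ℕ) (c : ℕ) : Prop :=
  t.Below A.size (fun x => x ∈ X ∧ A.Top x c) (fun x => x < t.k) c ∧
    t'.Below A.size (fun x => x ∈ X ∧ A.Top x c) (fun x => x < t'.k) c

/-- The score of `c` may be increased. -/
def Room (t t' : Target) (X : Set ℕ) (c : ℕ) : Prop :=
  t.Below A.size (fun x => (x ∈ X ∧ A.Top x c) ∨ x = c) (fun x => x < t.k) c ∧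
    t'.Below A.size (fun x => (x ∈ X ∧ A.Top x c) ∨ x = c) (fun x => x < t'.k) c

/-- Breadth-first search. -/
def layer (t t' : Target) (X : Set ℕ) (j : ℕ) : Set ℕ :=
  iterate (fun r Y => {c | c < A.size ∧ ((r < j ∧ A.Cand c ∧ (A.Room t t' X c ∨
    ∃ e < A.size, ∃ y < A.size, A.Arrow X e c y ∧ y ∈ Y)) ∨ (¬ r < j ∧ c ∈ Y))}) A.size

def Good (t t' : Target) (X : Set ℕ) (e : ℕ) : Prop :=
  ∃ x < A.size, ∃ y < A.size, ∃ j < A.size, A.Arrow X e x y ∧ ¬ A.Ok t t' X x ∧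
    y ∈ A.layer t t' X j ∧ ∀ c < A.size, c ∈ A.layer t t' X j → A.Ok t t' X c

/-- Choosing the least good ballot makes a round a function of the current set. -/
def First (t t' : Target) (X : Set ℕ) (e : ℕ) : Prop :=
  A.Good t t' X e ∧ ∀ e' < A.size, e' < e → ¬ A.Good t t' X e'

/-- The ballot `x` is better than `y`, if a voter tries to approve `p`, and then `q`. -/
def Better (p q x y : ℕ) : Prop :=
  (A.Top x p ∧ ¬ A.Top y p) ∨ ((A.Top x p ↔ A.Top y p) ∧ A.Top x q ∧ ¬ A.Top y q)

/-- The selection to start with. -/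
def Initial (p q z x : ℕ) : Prop :=
  A.Same x x ∧ ∀ y < A.size, A.Same x y →
    ((A.Late x z → A.Better q p x y ∨ (¬ A.Better q p y x ∧ x ≤ y)) ∧
      (¬ A.Late x z → A.Better p q x y ∨ (¬ A.Better p q y x ∧ x ≤ y)))

/-- The selection after all the moves. -/
def final (t t' : Target) (z : ℕ) : Set ℕ :=
  iterate (fun r X => {x | x < A.size ∧ ((¬ (∃ r' < A.size, r' < r) ∧ A.Initial t.p t'.p z x) ∨
    ((∃ r' < A.size, r' < r) ∧ (A.First t t' X x ∨
      (x ∈ X ∧ ∀ e < A.size, A.First t t' X e → ¬ A.Same x e))))}) A.size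

def Wins (t : Target) (X : Set ℕ) : Prop :=
  ∀ c < A.size, A.Cand c → t.Below A.size (fun x => x ∈ X ∧ A.Top x c)
    (fun x => x ∈ X ∧ A.Top x t.p) c

/-- In some selection the first voter prefers the winner obtained by the approval of `a'`
and `b'` to the winner obtained by the approval of `a` and `b`. -/
def Profitable (a b a' b' : ℕ) : Prop :=
  ∃ p < A.size, ∃ q < A.size, ∃ k < A.size, ∃ l < A.size, ∃ z < A.size,
    A.Cand p ∧ A.Cand q ∧ A.Pref q p ∧
      A.Wins ⟨a, b, p, k⟩ (A.final ⟨a, b, p, k⟩ ⟨a', b', q, l⟩ z) ∧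
      A.Wins ⟨a', b', q, l⟩ (A.final ⟨a, b, p, k⟩ ⟨a', b', q, l⟩ z)

end Arena

theorem count_eq_card (N : ℕ) (P : ℕ → Prop) [DecidablePred P] :
    count N P = #{x ∈ range N | P x} := by
  classical
  rw [count, Nat.count_eq_card_filter_range]
  congr

theorem count_lt {N k : ℕ} (h : k ≤ N) : count N (fun x => x < k) = k := by
  rw [count_eq_card]
  have : (range N).filter (fun x => x < k) = range k := by
    ext x
    simp
    omega
  rw [this, card_range]

theorem count_eq_and {N a : ℕ} (h : a < N) (P : Prop) [Decidable P] :
    count N (fun x => x = a ∧ P) = if P then 1 else 0 := by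
  rw [count_eq_card]
  split_ifs with hP
  · rw [card_eq_one]
    refine ⟨a, ?_⟩
    ext x
    simp only [hP, mem_filter, mem_range, and_true, mem_singleton]
    exact ⟨fun h' => h'.2, fun h' => ⟨h' ▸ h, h'⟩⟩
  · simp [hP]

theorem count_or {N : ℕ} {P Q : ℕ → Prop} (h : ∀ x < N, P x → ¬ Q x) :
    count N (fun x => P x ∨ Q x) = count N P + count N Q := by
  classical
  rw [count_eq_card, count_eq_card, count_eq_card, filter_or, card_union_of_disjoint]
  rw [disjoint_filter]
  intro x hx
  exact h x (mem_range.1 hx)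

/-- The disjuncts counted together in `Below` exclude each other, since `x = c` and `x = t.p` would
give `c < c`; they are merged because a formula compares sums of two counts only. -/
theorem Target.below_iff {N : ℕ} {t : Target} (hp : t.p < N) {R S : ℕ → Prop} {c : ℕ} (hc : c < N) :
    t.Below N R S c ↔ t.Bound c (count N R) (count N S) := by
  rw [Below, Bound, count_or, count_eq_and hc, count_eq_and hp, count_eq_and hp, add_assoc]
  rintro x - ⟨rfl, -⟩ ⟨h, h'⟩
  omega

/-- The arena `A` describes the ballots `B`. -/
structure Arena.Models {ι : Type} (A : Arena) (B : Ballots ι) (own : ι → ℕ) : Prop where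
  cand : ∀ c, A.Cand c ↔ c ∈ B.C
  same : ∀ x y, A.Same x y ↔ ∃ i, x ∈ B.L i ∧ y ∈ B.L i
  top : ∀ i, ∀ x ∈ B.L i, ∀ c, A.Top x c ↔ c ∈ B.T x
  late : ∀ i, ∀ x ∈ B.L i, ∀ z, A.Late x z ↔ z ≤ own i
  cand_lt : ∀ c ∈ B.C, c < A.size
  ballot_lt : ∀ i, ∀ x ∈ B.L i, x < A.size
  inj : ∀ i j, ∀ x ∈ B.L i, x ∈ B.L j → i = j
  notMem : ∀ c ∈ B.C, ∀ i, c ∉ B.L i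

end GSVoting

/-! ### Correctness of the algorithm on sets of positions -/

namespace GSVoting

open Finset Function
open StackProg.Formula (count iterate)

/-- The ballots `B` with the restrictions on the scores that are imposed by two targets. -/
def Ballots.restrict {ι : Type} (B : Ballots ι) (t t' : Target) : Ballots ι :=
  { B with
    ok := fun c k => t.Bound c k t.k ∧ t'.Bound c k t'.k
    ok_mono := fun c k l h => by
      unfold Target.Bound
      omega }

/-- An iteration always has `N` rounds; an operator that becomes idle after round `j` simulates
exactly `j` of them. -/
theorem iterate_stop {N j : ℕ} {F : ℕ → Set ℕ → Set ℕ} {G : ℕ → Set ℕ} (h0 : G 0 = ∅)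
    (hlt : ∀ r < j, F r (G r) = G (r + 1)) (hge : ∀ r, j ≤ r → F r (G j) = G j) (hj : j ≤ N) :
    iterate F N = G j := by
  have h1 : ∀ r ≤ j, iterate F r = G r := by
    intro r
    induction r with
    | zero => exact fun _ => h0.symm
    | succ r ih => exact fun h => by rw [iterate, ih (by omega), hlt r (by omega)]
  obtain ⟨d, rfl⟩ := Nat.exists_eq_add_of_le hj
  clear hj
  induction d with
  | zero => exact h1 _ le_rfl
  | succ d ih => rw [← add_assoc, iterate, ih, hge _ (by omega)]

namespace Arena.Models

variable {ι : Type} {A : Arena} {B : Ballots ι} {own : ι → ℕ} {t t' : Target} {s s' : ι → ℕ}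

variable [Fintype ι]

/-- Different voters have different ballots, so counting chosen ballots is counting voters. -/
theorem count_score (hM : A.Models B own) (hs : ∀ i, s i ∈ B.L i) (c : ℕ) :
    count A.size (fun x => x ∈ Set.range s ∧ A.Top x c) = B.score s c := by
  classical
  rw [count_eq_card, Ballots.score]
  refine (card_bij (fun i _ => s i) ?_ ?_ ?_).symm
  · intro i hi
    rw [mem_filter] at hi
    rw [mem_filter, Finset.mem_range]
    exact ⟨hM.ballot_lt i _ (hs i), ⟨i, rfl⟩, (hM.top i _ (hs i) c).2 hi.2⟩
  · intro i _ j _ h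
    exact hM.inj i j _ (hs i) (h ▸ hs j)
  · intro x hx
    rw [mem_filter] at hx
    obtain ⟨-, ⟨i, rfl⟩, hx⟩ := hx
    exact ⟨i, mem_filter.2 ⟨mem_univ _, (hM.top i _ (hs i) c).1 hx⟩, rfl⟩

/-- The position of a candidate is not a ballot; it provides the one additional solution. -/
theorem count_score_succ (hM : A.Models B own) (hs : ∀ i, s i ∈ B.L i) {c : ℕ} (hc : c ∈ B.C) :
    count A.size (fun x => (x ∈ Set.range s ∧ A.Top x c) ∨ x = c) = B.score s c + 1 := by
  rw [count_or, hM.count_score hs]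
  · have := count_eq_and (hM.cand_lt c hc) True
    simpa using this
  · rintro x - ⟨⟨i, rfl⟩, -⟩ rfl
    exact hM.notMem _ hc i (hs i)

theorem score_lt (hcard : Fintype.card ι < A.size) (c : ℕ) :
    B.score s c < A.size :=
  ((card_filter_le _ _).trans card_univ.le).trans_lt hcard

omit [Fintype ι] in
theorem arrow_iff (hM : A.Models B own) (hs : ∀ i, s i ∈ B.L i) {e x y : ℕ} :
    A.Arrow (Set.range s) e x y ↔ ∃ i, B.Arrow s i e x y := by
  constructor
  · rintro ⟨b, -, ⟨i, rfl⟩, hsame, h1, h2, h3, h4⟩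
    obtain ⟨j, hj, he⟩ := (hM.same _ _).1 hsame
    obtain rfl := hM.inj i j _ (hs i) hj
    exact ⟨i, he, (hM.top i _ hj _).1 h1, fun h => h2 ((hM.top i _ he _).2 h),
      (hM.top i _ he _).1 h3, fun h => h4 ((hM.top i _ hj _).2 h)⟩
  · rintro ⟨i, he, h1, h2, h3, h4⟩
    exact ⟨s i, hM.ballot_lt i _ (hs i), ⟨i, rfl⟩, (hM.same _ _).2 ⟨i, hs i, he⟩,
      (hM.top i _ (hs i) _).2 h1, fun h => h2 ((hM.top i _ he _).1 h),
      (hM.top i _ he _).2 h3, fun h => h4 ((hM.top i _ (hs i) _).1 h)⟩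

/-- The targets refer to positions. -/
structure Fits (A : Arena) (t : Target) : Prop where
  p_lt : t.p < A.size
  k_lt : t.k < A.size

theorem ok_iff (hM : A.Models B own) (ht : Fits A t) (ht' : Fits A t') (hs : ∀ i, s i ∈ B.L i)
    {c : ℕ} (hc : c ∈ B.C) : A.Ok t t' (Set.range s) c ↔ (B.restrict t t').ok c (B.score s c) := by
  have := hM.cand_lt c hc
  rw [Arena.Ok, Target.below_iff ht.p_lt this, Target.below_iff ht'.p_lt this, hM.count_score hs,
    count_lt ht.k_lt.le, count_lt ht'.k_lt.le]
  rfl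

theorem room_iff (hM : A.Models B own) (ht : Fits A t) (ht' : Fits A t') (hs : ∀ i, s i ∈ B.L i)
    {c : ℕ} (hc : c ∈ B.C) :
    A.Room t t' (Set.range s) c ↔ (B.restrict t t').ok c (B.score s c + 1) := by
  have := hM.cand_lt c hc
  rw [Arena.Room, Target.below_iff ht.p_lt this, Target.below_iff ht'.p_lt this,
    hM.count_score_succ hs hc, count_lt ht.k_lt.le, count_lt ht'.k_lt.le]
  rfl

theorem layer_eq (hM : A.Models B own) (ht : Fits A t) (ht' : Fits A t') (hs : ∀ i, s i ∈ B.L i)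
    {j : ℕ} (hj : j ≤ A.size) :
    A.layer t t' (Set.range s) j = (B.restrict t t').layer s j := by
  refine iterate_stop rfl (fun r hr => ?_) (fun r hr => ?_) hj
  · ext c
    simp only [hr, true_and, not_true, false_and, or_false, Set.mem_ofPred_eq, hM.cand]
    constructor
    · rintro ⟨-, hc, h | ⟨e, -, y, -, h, hy⟩⟩
      · exact ⟨hc, Or.inl ((hM.room_iff ht ht' hs hc).1 h)⟩
      · obtain ⟨i, h⟩ := (hM.arrow_iff hs).1 h
        exact ⟨hc, Or.inr ⟨i, e, y, h, hy⟩⟩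
    · rintro ⟨hc, h | ⟨i, e, y, h, hy⟩⟩
      · exact ⟨hM.cand_lt c hc, hc, Or.inl ((hM.room_iff ht ht' hs hc).2 h)⟩
      · exact ⟨hM.cand_lt c hc, hc, Or.inr ⟨e, hM.ballot_lt i _ h.1, y,
          hM.cand_lt y (B.subset i _ h.1 h.2.2.2.1), (hM.arrow_iff hs).2 ⟨i, h⟩, hy⟩⟩
  · ext c
    have hr' : ¬ r < j := by omega
    simp only [hr', false_and, not_false_eq_true, true_and, false_or, Set.mem_ofPred_eq]
    exact ⟨fun h => h.2, fun h => ⟨hM.cand_lt c (Ballots.layer_subset (B := B.restrict t t') _ h), h⟩⟩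

theorem good_iff (hM : A.Models B own) (ht : Fits A t) (ht' : Fits A t') (hs : ∀ i, s i ∈ B.L i)
    {e : ℕ} : A.Good t t' (Set.range s) e ↔ ∃ i, (B.restrict t t').Good A.size s i e := by
  constructor
  · rintro ⟨x, -, y, -, j, hj, h, hx, hy, hf⟩
    obtain ⟨i, h⟩ := (hM.arrow_iff hs).1 h
    rw [hM.layer_eq ht ht' hs hj.le] at hy hf
    refine ⟨i, x, y, j, hj, h, fun h' => hx ?_, hy, fun c hc => ?_⟩
    · exact (hM.ok_iff ht ht' hs (B.subset i _ (hs i) h.2.1)).2 h'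
    · have hcC := Ballots.layer_subset (B := B.restrict t t') _ hc
      exact (hM.ok_iff ht ht' hs hcC).1 (hf c (hM.cand_lt c hcC) hc)
  · rintro ⟨i, x, y, j, hj, h, hx, hy, hf⟩
    have hxC := B.subset i _ (hs i) h.2.1
    refine ⟨x, hM.cand_lt x hxC, y, hM.cand_lt y (B.subset i _ h.1 h.2.2.2.1), j, hj,
      (hM.arrow_iff hs).2 ⟨i, h⟩, fun h' => hx ((hM.ok_iff ht ht' hs hxC).1 h'), ?_, ?_⟩
    · rw [hM.layer_eq ht ht' hs hj.le]
      exact hy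
    · rw [hM.layer_eq ht ht' hs hj.le]
      exact fun c _ hc => (hM.ok_iff ht ht' hs
        (Ballots.layer_subset (B := B.restrict t t') _ hc)).2 (hf c hc)

theorem first_eq {X : Set ℕ} {e e' : ℕ} (h : A.First t t' X e) (he : e < A.size)
    (h' : A.First t t' X e') (he' : e' < A.size) : e = e' := by
  rcases lt_trichotomy e e' with hlt | hlt | hlt
  · exact (h'.2 e he hlt h.1).elim
  · exact hlt
  · exact (h.2 e' he' hlt h'.1).elim

open Classical in
/-- A round of the algorithm. -/
theorem exists_step (hM : A.Models B own) (ht : Fits A t) (ht' : Fits A t')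
    (hs : ∀ i, s i ∈ B.L i) : ∃ s' : ι → ℕ, (∀ i, s' i ∈ B.L i) ∧
      ((∃ i e, (B.restrict t t').Good A.size s i e ∧ s' = update s i e) ∨
        ((∀ i e, ¬ (B.restrict t t').Good A.size s i e) ∧ s' = s)) ∧
      ∀ x, (x < A.size ∧ (A.First t t' (Set.range s) x ∨
        (x ∈ Set.range s ∧ ∀ e < A.size, A.First t t' (Set.range s) e → ¬ A.Same x e))) ↔
          x ∈ Set.range s' := by
  by_cases h : ∃ e, A.Good t t' (Set.range s) e
  · have hfirst : A.First t t' (Set.range s) (Nat.find h) :=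
      ⟨Nat.find_spec h, fun e' _ hlt => Nat.find_min h hlt⟩
    set e := Nat.find h
    obtain ⟨i, hi⟩ := (hM.good_iff ht ht' hs).1 hfirst.1
    have heL : e ∈ B.L i := by
      obtain ⟨x, y, j, -, h, -⟩ := hi
      exact h.1
    have hlt := hM.ballot_lt i _ heL
    have hs' : ∀ j, update s i e j ∈ B.L j := by
      intro j
      by_cases hj : j = i
      · subst hj
        simpa using heL
      · simpa [hj] using hs j
    refine ⟨update s i e, hs', Or.inl ⟨i, e, hi, rfl⟩, fun x => ?_⟩
    constructor
    · rintro ⟨hx, h' | ⟨⟨j, rfl⟩, h'⟩⟩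
      · obtain rfl := first_eq h' hx hfirst hlt
        exact ⟨i, by simp⟩
      · refine ⟨j, ?_⟩
        have hj : j ≠ i := by
          rintro rfl
          exact h' e hlt hfirst ((hM.same _ _).2 ⟨j, hs j, heL⟩)
        simp [hj]
    · rintro ⟨j, rfl⟩
      refine ⟨hM.ballot_lt j _ (hs' j), ?_⟩
      by_cases hj : j = i
      · subst hj
        simpa using Or.inl hfirst
      · right
        simp only [update_of_ne hj]
        refine ⟨⟨j, rfl⟩, fun e' he' h' hsame => hj ?_⟩
        obtain rfl := first_eq h' he' hfirst hlt
        obtain ⟨k, hk, hk'⟩ := (hM.same _ _).1 hsame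
        rw [hM.inj j k _ (hs j) hk, hM.inj i k _ heL hk']
  · refine ⟨s, hs, Or.inr ⟨fun i e hg => h ⟨e, (hM.good_iff ht ht' hs).2 ⟨i, hg⟩⟩, rfl⟩,
      fun x => ?_⟩
    constructor
    · rintro ⟨-, h' | h'⟩
      · exact (h ⟨x, h'.1⟩).elim
      · exact h'.1
    · rintro ⟨i, rfl⟩
      exact ⟨hM.ballot_lt i _ (hs i), Or.inr ⟨⟨i, rfl⟩, fun e _ h' => (h ⟨e, h'.1⟩).elim⟩⟩

omit [Fintype ι] in
theorem better_iff (hM : A.Models B own) {i : ι} {x y p q : ℕ} (hx : x ∈ B.L i) (hy : y ∈ B.L i) :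
    A.Better p q x y ↔ B.weight p q y < B.weight p q x := by
  rw [Arena.Better, hM.top i _ hx, hM.top i _ hy, hM.top i _ hx, hM.top i _ hy]
  unfold Ballots.weight
  split_ifs <;> simp_all

/-- The best ballots of a set, ties being broken by the order of the numbers. -/
theorem exists_best (L : Finset ℕ) (hL : L.Nonempty) (f : ℕ → ℕ) :
    ∃ x ∈ L, (∀ y ∈ L, f y ≤ f x) ∧ ∀ y ∈ L, (∀ z ∈ L, f z < f y ∨ (f z ≤ f y ∧ y ≤ z)) ↔ y = x := by
  obtain ⟨m, hm, hmax⟩ := exists_max_image L f hL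
  have hne : (L.filter fun y => f y = f m).Nonempty := ⟨m, by simp [hm]⟩
  have hmem := min'_mem _ hne
  rw [mem_filter] at hmem
  have hbest : ∀ z ∈ L, f z < f (min' _ hne) ∨ (f z ≤ f (min' _ hne) ∧ min' _ hne ≤ z) := by
    intro z hz
    rw [hmem.2]
    by_cases h : f z = f m
    · exact Or.inr ⟨h.le, min'_le _ _ (mem_filter.2 ⟨hz, h⟩)⟩
    · exact Or.inl (lt_of_le_of_ne (hmax z hz) h)
  refine ⟨min' _ hne, hmem.1, fun y hy => (hmax y hy).trans_eq hmem.2.symm, fun y hy => ⟨fun h => ?_, ?_⟩⟩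
  · have h1 := h _ hmem.1
    have h2 := hbest y hy
    omega
  · rintro rfl
    exact hbest

omit [Fintype ι] in
theorem exists_initial (hM : A.Models B own) (hL : ∀ i, (B.L i).Nonempty) (p q z : ℕ) :
    ∃ s : ι → ℕ, B.Threshold own p q z s ∧
      ∀ x, x < A.size ∧ A.Initial p q z x ↔ x ∈ Set.range s := by
  let f : ι → ℕ → ℕ := fun i => if z ≤ own i then B.weight q p else B.weight p q
  choose s hs hmax hbest using fun i => exists_best (B.L i) (hL i) (f i)
  refine ⟨s, fun i => ⟨hs i, fun e he => ⟨fun h => ?_, fun h => ?_⟩⟩, fun x => ?_⟩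
  · simpa [f, h] using hmax i e he
  · simpa [f, not_le.2 h] using hmax i e he
  · have key : ∀ i, ∀ x ∈ B.L i, A.Initial p q z x ↔ x = s i := by
      intro i x hx
      rw [← hbest i x hx, Arena.Initial]
      constructor
      · rintro ⟨-, h⟩ y hy
        have := h y (hM.ballot_lt i y hy) ((hM.same _ _).2 ⟨i, hx, hy⟩)
        rw [hM.late i x hx, hM.better_iff hx hy, hM.better_iff hy hx, hM.better_iff hx hy,
          hM.better_iff hy hx] at this
        by_cases hz : z ≤ own i
        · simpa [f, hz] using this
        · simpa [f, hz] using this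
      · refine fun h => ⟨(hM.same _ _).2 ⟨i, hx, hx⟩, fun y _ hxy => ?_⟩
        obtain ⟨j, hj, hy⟩ := (hM.same _ _).1 hxy
        obtain rfl := hM.inj i j x hx hj
        have := h y hy
        rw [hM.late i x hx, hM.better_iff hx hy, hM.better_iff hy hx, hM.better_iff hx hy,
          hM.better_iff hy hx]
        by_cases hz : z ≤ own i
        · simpa [f, hz] using this
        · simpa [f, hz] using this
    constructor
    · rintro ⟨-, hx⟩
      obtain ⟨i, hi, -⟩ := (hM.same _ _).1 hx.1
      exact ⟨i, ((key i x hi).1 hx).symm⟩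
    · rintro ⟨i, rfl⟩
      exact ⟨hM.ballot_lt i _ (hs i), (key i _ (hs i)).2 rfl⟩

open Classical in
-- Round `0` replaces the empty set by the starting selection, and each of the other `A.size - 1`
-- rounds makes a good move if there is one.
theorem exists_improving (hM : A.Models B own) (ht : Fits A t) (ht' : Fits A t')
    (hL : ∀ i, (B.L i).Nonempty) (z : ℕ) :
    ∃ S : ℕ → ι → ℕ, B.Threshold own t.p t'.p z (S 0) ∧
      (B.restrict t t').Improving A.size S ∧ A.final t t' z = Set.range (S (A.size - 1)) := by
  obtain ⟨s₀, hs₀, h₀⟩ := hM.exists_initial hL t.p t'.p z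
  have hpos : 0 < A.size := by have := ht.p_lt; omega
  have hstep : ∀ s : {s : ι → ℕ // ∀ i, s i ∈ B.L i}, ∃ s' : {s : ι → ℕ // ∀ i, s i ∈ B.L i},
      ((∃ i e, (B.restrict t t').Good A.size s.1 i e ∧ s'.1 = update s.1 i e) ∨
        ((∀ i e, ¬ (B.restrict t t').Good A.size s.1 i e) ∧ s'.1 = s.1)) ∧
      ∀ x, (x < A.size ∧ (A.First t t' (Set.range s.1) x ∨
        (x ∈ Set.range s.1 ∧ ∀ e < A.size, A.First t t' (Set.range s.1) e → ¬ A.Same x e))) ↔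
          x ∈ Set.range s'.1 := fun s => by
    obtain ⟨s', h1, h2, h3⟩ := hM.exists_step ht ht' s.2
    exact ⟨⟨s', h1⟩, h2, h3⟩
  choose g hg hg' using hstep
  let S : ℕ → {s : ι → ℕ // ∀ i, s i ∈ B.L i} := fun n => g^[n] ⟨s₀, fun i => (hs₀ i).1⟩
  have hS : ∀ n, S (n + 1) = g (S n) := fun n => iterate_succ_apply' _ _ _
  refine ⟨fun n => (S n).1, hs₀, ⟨fun i => (S 0).2 i, fun n => ?_⟩, ?_⟩
  · rw [hS]
    exact hg (S n)
  · have key : ∀ n, iterate (fun r X => {x | x < A.size ∧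
        ((¬ (∃ r' < A.size, r' < r) ∧ A.Initial t.p t'.p z x) ∨
        ((∃ r' < A.size, r' < r) ∧ (A.First t t' X x ∨
          (x ∈ X ∧ ∀ e < A.size, A.First t t' X e → ¬ A.Same x e))))}) (n + 1) =
        Set.range (S n).1 := by
      intro n
      induction n with
      | zero =>
        ext x
        refine Iff.trans ?_ (h₀ x)
        simp [iterate]
      | succ n ih =>
        have hr : ∃ r' < A.size, r' < n + 1 := ⟨0, hpos, by omega⟩
        rw [iterate, ih]
        ext x
        rw [hS, ← hg']
        simp only [hr, not_true, false_and, false_or, true_and]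
        exact Iff.rfl
    have := key (A.size - 1)
    rw [Nat.sub_add_cancel hpos] at this
    exact this

/-- The candidate `p` wins if the first voter approves `a` and `b`. -/
def _root_.GSVoting.Ballots.Wins (B : Ballots ι) (a b p : ℕ) (s : ι → ℕ) : Prop :=
  ∀ c ∈ B.C, Target.Bound ⟨a, b, p, 0⟩ c (B.score s c) (B.score s p)

theorem wins_iff (hM : A.Models B own) (hs : ∀ i, s i ∈ B.L i) (hp : t.p < A.size) :
    A.Wins t (Set.range s) ↔ B.Wins t.a t.b t.p s := by
  unfold Arena.Wins Ballots.Wins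
  refine forall_congr' fun c => ?_
  rw [hM.cand]
  constructor
  · intro h hc
    have := h (hM.cand_lt c hc) hc
    rwa [Target.below_iff hp (hM.cand_lt c hc), hM.count_score hs, hM.count_score hs] at this
  · intro h hlt hc
    rw [Target.below_iff hp hlt, hM.count_score hs, hM.count_score hs]
    exact h hc

/-- The algorithm is correct. -/
theorem profitable_iff (hM : A.Models B own) (hown : Injective own) (hlt : ∀ i, own i + 1 < A.size)
    (hL : ∀ i, (B.L i).Nonempty) (hcard : Fintype.card ι < A.size)
    (hsize : (2 * Fintype.card ι + 1) * #B.C < A.size) (a b a' b' : ℕ) :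
    A.Profitable a b a' b' ↔ ∃ s : ι → ℕ, (∀ i, s i ∈ B.L i) ∧ ∃ p ∈ B.C, ∃ q ∈ B.C, A.Pref q p ∧
      B.Wins a b p s ∧ B.Wins a' b' q s := by
  classical
  constructor
  · rintro ⟨p, hp, q, hq, k, hk, l, hl, z, -, hpC, hqC, hpref, h1, h2⟩
    obtain ⟨S, -, hS, hfin⟩ := hM.exists_improving (t := ⟨a, b, p, k⟩) (t' := ⟨a', b', q, l⟩)
      ⟨hp, hk⟩ ⟨hq, hl⟩ hL z
    have hm := hS.mem_all (A.size - 1)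
    rw [hfin] at h1 h2
    exact ⟨_, hm, p, (hM.cand _).1 hpC, q, (hM.cand _).1 hqC, hpref, (hM.wins_iff hm hp).1 h1,
      (hM.wins_iff hm hq).1 h2⟩
  · rintro ⟨s, hs, p, hp, q, hq, hpref, h1, h2⟩
    have hp' := hM.cand_lt p hp
    have hq' := hM.cand_lt q hq
    -- The given selection `s` provides the numbers of approvals to aim at.
    let t : Target := ⟨a, b, p, B.score s p⟩
    let t' : Target := ⟨a', b', q, B.score s q⟩
    have ht : Fits A t := ⟨hp', score_lt hcard p⟩
    have ht' : Fits A t' := ⟨hq', score_lt hcard q⟩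
    choose S hS0 hS hfin using hM.exists_improving ht ht' hL
    obtain ⟨z, hz, hzp, hzq⟩ := Ballots.exists_threshold (Z := A.size - 1) hown hS0
      (fun i => by have := hlt i; omega) hs
    have hok : ∀ c ∈ B.C, (B.restrict t t').ok c (B.score s c) := fun c hc => ⟨h1 c hc, h2 c hc⟩
    have hC : #B.C < A.size := lt_of_le_of_lt (Nat.le_mul_of_pos_left _ (by omega)) hsize
    have hfinal : ∀ c ∈ B.C, (B.restrict t t').ok c (B.score (S z (A.size - 1)) c) := fun c hc =>
      (hS z).ok hC (by change _ * #B.C ≤ _; omega) hs hok hc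
    have hp1 : B.score s p ≤ B.score (S z (A.size - 1)) p := (hS z).le_score (hok p hp) hzp _
    have hq1 : B.score s q ≤ B.score (S z (A.size - 1)) q := (hS z).le_score (hok q hq) hzq _
    have hm := (hS z).mem_all (A.size - 1)
    refine ⟨p, hp', q, hq', _, ht.k_lt, _, ht'.k_lt, z, by omega, (hM.cand p).2 hp, (hM.cand q).2 hq,
      hpref, ?_, ?_⟩
    · rw [hfin z, hM.wins_iff hm hp']
      intro c hc
      -- The bound on `c` refers to the score of `p` in `s`; the actual score of `p` is at least
      -- that, so the bound follows for it.
      have := (hfinal c hc).1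
      simp only [Target.Bound, t] at this ⊢
      omega
    · rw [hfin z, hM.wins_iff hm hq']
      intro c hc
      have := (hfinal c hc).2
      simp only [Target.Bound, t'] at this ⊢
      omega

end Arena.Models

end GSVoting

/-! ### The arena of a word -/

namespace GSVoting

open StackProg Definable
open StackProg.Formula (count)

/-- The symbols of an encoded instance, with a hint of their meaning: the ends of candidates in the
tie-breaking order, in the first vote, and among the top candidates of the other votes, of the
strategies and of a vote under consideration; the beginning of the votes and of the strategies; and
the end of the lists of strategies. -/
inductive Tag
  | bit (b : Bool)
  | tie
  | one (top : Bool)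
  | voterBra
  | voterTop
  | listKet (empty : Bool)
  | ballotBra
  | ballotTop
  | queryTop
  | other
  deriving Fintype

instance : Inhabited Tag := ⟨.other⟩

namespace Tag

variable {α β : Type}

/-- The tag at the position `x` has the property `p`. -/
def At (w : List Tag) (p : Tag → Prop) (x : ℕ) : Prop := ∃ s, w[x]? = some s ∧ p s

def IsBit (s : Tag) : Prop := ∃ b, s = bit b

def IsOne (s : Tag) : Prop := ∃ b, s = one b

def IsListKet (s : Tag) : Prop := ∃ b, s = listKet b

def IsTop (s : Tag) : Prop := s = voterTop ∨ s = ballotTop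

def IsBra (s : Tag) : Prop := s = voterBra ∨ s = ballotBra

/-- There are only bits from `y` to `x`. -/
def Bits (w : List Tag) (y x : ℕ) : Prop :=
  ∀ t < w.length, y ≤ t → t < x → At w IsBit t

/-- The bits before `x` are also bits before `c`. -/
def TokenLE (w : List Tag) (x c : ℕ) : Prop :=
  ∀ y < w.length, y < x → Bits w y x → ∃ z < w.length, z < c ∧ Bits w z c ∧
    count w.length (fun t => y ≤ t ∧ t < x) = count w.length (fun t => z ≤ t ∧ t < c) ∧
    (At w (· = bit true) y ↔ At w (· = bit true) z)

/-- The candidate that ends at `x` is the one that ends at `c` in the tie-breaking order. -/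
def Denotes (w : List Tag) (x c : ℕ) : Prop :=
  At w (· = tie) c ∧ TokenLE w x c ∧ TokenLE w c x

/-- The vote that begins at `b` approves `c`. -/
def Approves (w : List Tag) (b c : ℕ) : Prop :=
  ∃ x < w.length, b < x ∧ At w IsTop x ∧
    (∀ t < w.length, b < t → t < x → ¬ At w IsBra t) ∧ Denotes w x c

/-- The vote of a voter without strategies begins at `b`. -/
def Fixed (w : List Tag) (b : ℕ) : Prop :=
  At w (· = voterBra) b ∧ ∃ k < w.length, At w (· = listKet true) k ∧
    count w.length (fun t => At w (· = voterBra) t ∧ t ≤ b) =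
      count w.length (fun t => At w IsListKet t ∧ t < k)

/-- A ballot of a voter without strategies is itself the position of the voter. Otherwise that
position is the last list end before `b`; it is at least `z` iff some list end before `b` is. -/
def Late (w : List Tag) (b z : ℕ) : Prop :=
  (At w (· = voterBra) b ∧ z ≤ b) ∨
    (At w (· = ballotBra) b ∧ ∃ k < w.length, At w IsListKet k ∧ z ≤ k ∧ k < b)

def Ballot (w : List Tag) (b : ℕ) : Prop := At w (· = ballotBra) b ∨ Fixed w b

/-- Voters are not positions, but two ballots belong to the same voter iff no threshold separates
them. -/
def Same (w : List Tag) (x y : ℕ) : Prop :=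
  Ballot w x ∧ Ballot w y ∧ ∀ z < w.length, (Late w x z ↔ Late w y z)

def Pref (w : List Tag) (q p : ℕ) : Prop :=
  ∃ x < w.length, ∃ y < w.length, At w IsOne x ∧ At w IsOne y ∧ x < y ∧ Denotes w x q ∧
    Denotes w y p

/-- The arena that is encoded by a word. -/
def arena (w : List Tag) : Arena where
  size := w.length
  Cand := At w (· = tie)
  Same := Same w
  Late := Late w
  Top := Approves w
  Pref := Pref w

/-- The position `c` belongs to one of the candidates that are marked by `s`. -/
def Marked (w : List Tag) (s : Tag) (c : ℕ) : Prop :=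
  ∃ x < w.length, At w (· = s) x ∧ Denotes w x c

def Dominates (w : List Tag) (a b a' b' : ℕ) : Prop :=
  ¬ (arena w).Profitable a b a' b' ∧ (arena w).Profitable a' b' a b

/-- A vote is represented by the pair of candidates that it approves. -/
def LevelTwo (w : List Tag) : Prop :=
  ∀ c < w.length, ∀ d < w.length, Marked w queryTop c → Marked w queryTop d → c ≠ d →
    ∀ a < w.length, ∀ b < w.length, At w (· = tie) a → At w (· = tie) b → a ≠ b →
      ¬ Dominates w a b c d

def Improving (w : List Tag) : Prop :=
  ∃ c < w.length, ∃ d < w.length, Marked w (one true) c ∧ Marked w (one true) d ∧ c ≠ d ∧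
    ∃ a < w.length, ∃ b < w.length, Marked w queryTop a ∧ Marked w queryTop b ∧ a ≠ b ∧
      Dominates w a b c d

def ExistsImproving (w : List Tag) : Prop :=
  ∃ c < w.length, ∃ d < w.length, Marked w (one true) c ∧ Marked w (one true) d ∧ c ≠ d ∧
    ∃ a < w.length, ∃ b < w.length, At w (· = tie) a ∧ At w (· = tie) b ∧ a ≠ b ∧
      Dominates w a b c d

theorem definable_at (p : Tag → Prop) (x : α) : Definable (β := β) fun w e _ => At w p (e x) :=
  letter _ _

theorem definable_bits (y x : α) : Definable (β := β) fun w e _ => Bits w (e y) (e x) :=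
  all (imp (le _ _) (imp (lt _ _) (definable_at _ _)))

theorem definable_tokenLE (x c : α) : Definable (β := β) fun w e _ => TokenLE w (e x) (e c) :=
  all (imp (lt _ _) (imp (definable_bits _ _) (ex (and (lt _ _) (and (definable_bits _ _)
    (and (count_eq (and (le _ _) (lt _ _)) (and (le _ _) (lt _ _)))
      (iff (definable_at _ _) (definable_at _ _))))))))

theorem definable_denotes (x c : α) : Definable (β := β) fun w e _ => Denotes w (e x) (e c) :=
  and (definable_at _ _) (and (definable_tokenLE _ _) (definable_tokenLE _ _))

theorem definable_approves (b c : α) : Definable (β := β) fun w e _ => Approves w (e b) (e c) :=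
  ex (and (lt _ _) (and (definable_at _ _)
    (and (all (imp (lt _ _) (imp (lt _ _) (not (definable_at _ _))))) (definable_denotes _ _))))

theorem definable_fixed (b : α) : Definable (β := β) fun w e _ => Fixed w (e b) :=
  and (definable_at _ _) (ex (and (definable_at _ _)
    (count_eq (and (definable_at _ _) (le _ _)) (and (definable_at _ _) (lt _ _)))))

theorem definable_late (b z : α) : Definable (β := β) fun w e _ => Late w (e b) (e z) :=
  or (and (definable_at _ _) (le _ _))
    (and (definable_at _ _) (ex (and (definable_at _ _) (and (le _ _) (lt _ _)))))

theorem definable_ballot (b : α) : Definable (β := β) fun w e _ => Ballot w (e b) :=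
  or (definable_at _ _) (definable_fixed _)

theorem definable_same (x y : α) : Definable (β := β) fun w e _ => Same w (e x) (e y) :=
  and (definable_ballot _) (and (definable_ballot _)
    (all (iff (definable_late _ _) (definable_late _ _))))

theorem definable_pref (q p : α) : Definable (β := β) fun w e _ => Pref w (e q) (e p) :=
  ex (ex (and (definable_at _ _) (and (definable_at _ _) (and (lt _ _)
    (and (definable_denotes _ _) (definable_denotes _ _))))))

theorem definable_arrow (X : β) (e' x y : α) :
    Definable fun w e S => (arena w).Arrow (S X) (e e') (e x) (e y) :=
  ex (and (mem _ _) (and (definable_same _ _) (and (definable_approves _ _)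
    (and (not (definable_approves _ _)) (and (definable_approves _ _)
      (not (definable_approves _ _)))))))

theorem definable_below {R S : List Tag → (α → ℕ) → (β → Set ℕ) → ℕ → Prop}
    (hR : Definable fun w (e : Option α → ℕ) X => R w (fun a => e (some a)) X (e none))
    (hS : Definable fun w (e : Option α → ℕ) X => S w (fun a => e (some a)) X (e none))
    (a b p k c : α) :
    Definable fun w e X => Target.Below w.length ⟨e a, e b, e p, e k⟩ (R w e X) (S w e X) (e c) :=
  count_add_le hR (or (and (eq _ _) (or (eq _ _) (eq _ _))) (and (eq _ _) (lt _ _))) hS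
    (and (eq _ _) (or (eq _ _) (eq _ _)))

section targets

variable (X : β) (a b p k a' b' q l z c : α)

theorem definable_ok : Definable fun w e S =>
    (arena w).Ok ⟨e a, e b, e p, e k⟩ ⟨e a', e b', e q, e l⟩ (S X) (e c) :=
  and (definable_below (and (mem _ _) (definable_approves _ _)) (lt _ _) _ _ _ _ _)
    (definable_below (and (mem _ _) (definable_approves _ _)) (lt _ _) _ _ _ _ _)

theorem definable_room : Definable fun w e S =>
    (arena w).Room ⟨e a, e b, e p, e k⟩ ⟨e a', e b', e q, e l⟩ (S X) (e c) :=
  and (definable_below (or (and (mem _ _) (definable_approves _ _)) (eq _ _)) (lt _ _) _ _ _ _ _)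
    (definable_below (or (and (mem _ _) (definable_approves _ _)) (eq _ _)) (lt _ _) _ _ _ _ _)

/-- The layer is not a formula by itself, but an iteration in front of the property `R` that uses
it. -/
theorem definable_layer {R : List Tag → (α → ℕ) → (β → Set ℕ) → Set ℕ → Prop}
    (hR : Definable fun w e (X : Option β → Set ℕ) => R w e (fun s => X (some s)) (X none)) :
    Definable fun w e S => R w e S
      ((arena w).layer ⟨e a, e b, e p, e k⟩ ⟨e a', e b', e q, e l⟩ (S X) (e c)) :=
  iterate (or (and (lt _ _) (and (definable_at _ _) (or (definable_room _ _ _ _ _ _ _ _ _ _)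
    (ex (ex (and (definable_arrow _ _ _ _) (mem _ _))))))) (and (not (lt _ _)) (mem _ _))) hR

theorem definable_good : Definable fun w e S =>
    (arena w).Good ⟨e a, e b, e p, e k⟩ ⟨e a', e b', e q, e l⟩ (S X) (e c) :=
  ex (ex (ex (and (definable_arrow _ _ _ _) (and (not (definable_ok _ _ _ _ _ _ _ _ _ _))
    (definable_layer (R := fun w e S L => e (some none) ∈ L ∧ ∀ c < w.length, c ∈ L →
      (arena w).Ok ⟨e (some (some (some a))), e (some (some (some b))), e (some (some (some p))),
        e (some (some (some k)))⟩ ⟨e (some (some (some a'))), e (some (some (some b'))),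
        e (some (some (some q))), e (some (some (some l)))⟩ (S X) c) _ _ _ _ _ _ _ _ _ _
      (and (mem _ _) (all (imp (mem _ _) (definable_ok _ _ _ _ _ _ _ _ _ _)))))))))

theorem definable_first : Definable fun w e S =>
    (arena w).First ⟨e a, e b, e p, e k⟩ ⟨e a', e b', e q, e l⟩ (S X) (e c) :=
  and (definable_good _ _ _ _ _ _ _ _ _ _)
    (all (imp (lt _ _) (not (definable_good _ _ _ _ _ _ _ _ _ _))))

theorem definable_better (p q x y : α) :
    Definable (β := β) fun w e _ => (arena w).Better (e p) (e q) (e x) (e y) :=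
  or (and (definable_approves _ _) (not (definable_approves _ _)))
    (and (iff (definable_approves _ _) (definable_approves _ _))
      (and (definable_approves _ _) (not (definable_approves _ _))))

theorem definable_initial (p q z x : α) :
    Definable (β := β) fun w e _ => (arena w).Initial (e p) (e q) (e z) (e x) :=
  and (definable_same _ _) (all (imp (definable_same _ _) (and
    (imp (definable_late _ _) (or (definable_better _ _ _ _)
      (and (not (definable_better _ _ _ _)) (le _ _))))
    (imp (not (definable_late _ _)) (or (definable_better _ _ _ _)
      (and (not (definable_better _ _ _ _)) (le _ _)))))))

theorem definable_final {R : List Tag → (α → ℕ) → (β → Set ℕ) → Set ℕ → Prop}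
    (hR : Definable fun w e (X : Option β → Set ℕ) => R w e (fun s => X (some s)) (X none)) :
    Definable fun w e S => R w e S
      ((arena w).final ⟨e a, e b, e p, e k⟩ ⟨e a', e b', e q, e l⟩ (e z)) :=
  iterate (or (and (not (ex (lt _ _))) (definable_initial _ _ _ _)) (and (ex (lt _ _))
    (or (definable_first _ _ _ _ _ _ _ _ _ _) (and (mem _ _)
      (all (imp (definable_first _ _ _ _ _ _ _ _ _ _) (not (definable_same _ _)))))))) hR

theorem definable_wins : Definable fun w e S => (arena w).Wins ⟨e a, e b, e p, e k⟩ (S X) :=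
  all (imp (definable_at _ _) (definable_below (and (mem _ _) (definable_approves _ _))
    (and (mem _ _) (definable_approves _ _)) _ _ _ _ _))

theorem definable_profitable :
    Definable (β := β) fun w e _ => (arena w).Profitable (e a) (e b) (e a') (e b') :=
  ex (ex (ex (ex (ex (and (definable_at _ _) (and (definable_at _ _) (and (definable_pref _ _)
    (definable_final (R := fun w e _ X =>
      (arena w).Wins ⟨e (some (some (some (some (some a))))), e (some (some (some (some (some b))))),
        e (some (some (some (some none)))), e (some (some none))⟩ X ∧
      (arena w).Wins ⟨e (some (some (some (some (some a'))))),
        e (some (some (some (some (some b'))))), e (some (some (some none))), e (some none)⟩ X)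
      _ _ _ _ _ _ _ _ _ (and (definable_wins _ _ _ _ _) (definable_wins _ _ _ _ _))))))))))

theorem definable_dominates :
    Definable (β := β) fun w e _ => Dominates w (e a) (e b) (e a') (e b') :=
  and (not (definable_profitable _ _ _ _)) (definable_profitable _ _ _ _)

theorem definable_marked (s : Tag) : Definable (β := β) fun w e _ => Marked w s (e c) :=
  ex (and (definable_at _ _) (definable_denotes _ _))

end targets

theorem definable_levelTwo : Definable (α := α) (β := β) fun w _ _ => LevelTwo w :=
  all (all (imp (definable_marked _ _) (imp (definable_marked _ _) (imp (ne _ _)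
    (all (all (imp (definable_at _ _) (imp (definable_at _ _) (imp (ne _ _)
      (not (definable_dominates _ _ _ _)))))))))))

theorem definable_improving : Definable (α := α) (β := β) fun w _ _ => Improving w :=
  ex (ex (and (definable_marked _ _) (and (definable_marked _ _) (and (ne _ _)
    (ex (ex (and (definable_marked _ _) (and (definable_marked _ _) (and (ne _ _)
      (definable_dominates _ _ _ _))))))))))

theorem definable_existsImproving : Definable (α := α) (β := β) fun w _ _ => ExistsImproving w :=
  ex (ex (and (definable_marked _ _) (and (definable_marked _ _) (and (ne _ _)
    (ex (ex (and (definable_at _ _) (and (definable_at _ _) (and (ne _ _)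
      (definable_dominates _ _ _ _))))))))))

end Tag

end GSVoting

/-! ### Words whose positions are addressed by keys -/

namespace GSVoting

open StackProg.Formula (count)

/-- A word; every symbol is accompanied by a key. The keys will be strictly increasing. -/
abbrev Coded : Type := List (List ℕ × Tag)

namespace Coded

def Sorted (W : Coded) : Prop := W.Pairwise fun x y => x.1 < y.1

/-- The underlying word. -/
def tags (W : Coded) : List Tag := W.map Prod.snd

/-- Keys are paths in the nested structure of the encoding, so their lexicographic order is the
order of the symbols. -/
def pre (i : ℕ) (W : Coded) : Coded := W.map fun x => (i :: x.1, x.2)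

/-- A sequence of bits and a symbol that ends it. -/
def token (l : List Bool) (s : Tag) : Coded :=
  (l.mapIdx fun o b => ([o], Tag.bit b)) ++ [([l.length], s)]

/-- A sequence of words between two symbols. -/
def block {n : ℕ} (a z : Tag) (g : Fin n → Coded) : Coded :=
  ([0], a) :: ((List.ofFn fun i : Fin n => pre (i + 1) (g i)).flatten ++ [([n + 1], z)])

variable {W W₀ W' : Coded} {n : ℕ} {a z s : Tag} {g : Fin n → Coded} {k k' : List ℕ}

theorem mem_pre {i : ℕ} : (k, s) ∈ pre i W ↔ ∃ k', k = i :: k' ∧ (k', s) ∈ W := by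
  simp only [pre, List.mem_map, Prod.exists, Prod.mk.injEq]
  constructor
  · rintro ⟨k', s', h, rfl, rfl⟩
    exact ⟨k', rfl, h⟩
  · rintro ⟨k', rfl, h⟩
    exact ⟨k', s, h, rfl, rfl⟩

theorem mem_token {l : List Bool} {t : Tag} : (k, s) ∈ token l t ↔
    (∃ o b, l[o]? = some b ∧ k = [o] ∧ s = .bit b) ∨ (k = [l.length] ∧ s = t) := by
  simp only [token, List.mem_append, List.mem_singleton, Prod.mk.injEq]
  refine or_congr ?_ Iff.rfl
  rw [List.mem_iff_getElem?]
  refine exists_congr fun o => ?_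
  rw [List.getElem?_mapIdx]
  cases l[o]? <;> simp [eq_comm]

theorem mem_block : (k, s) ∈ block a z g ↔
    (k = [0] ∧ s = a) ∨ (∃ i : Fin n, ∃ k', k = (i + 1 : ℕ) :: k' ∧ (k', s) ∈ g i) ∨
      (k = [n + 1] ∧ s = z) := by
  simp only [block, List.mem_cons, List.mem_append, List.mem_flatten, List.mem_ofFn,
    Prod.mk.injEq, List.not_mem_nil, or_false]
  refine or_congr Iff.rfl (or_congr ?_ Iff.rfl)
  constructor
  · rintro ⟨_, ⟨i, rfl⟩, h⟩
    exact ⟨i, mem_pre.1 h⟩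
  · rintro ⟨i, h⟩
    exact ⟨_, ⟨i, rfl⟩, mem_pre.2 h⟩

theorem Sorted.pre (h : W.Sorted) (i : ℕ) : (pre i W).Sorted := by
  rw [Sorted, Coded.pre, List.pairwise_map]
  refine List.Pairwise.imp (fun h => ?_) h
  rw [List.cons_lt_cons_iff]
  exact Or.inr ⟨rfl, h⟩

theorem sorted_token (l : List Bool) (s : Tag) : (token l s).Sorted := by
  rw [Sorted, token, List.pairwise_append]
  refine ⟨?_, by simp, ?_⟩
  · rw [List.pairwise_iff_getElem]
    intro i j hi hj hij
    simp [List.cons_lt_cons_iff, hij]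
  · rintro ⟨k, s⟩ hx y hy
    rw [List.mem_singleton] at hy
    subst hy
    rw [List.mem_mapIdx] at hx
    obtain ⟨o, ho, he⟩ := hx
    rw [Prod.mk.injEq] at he
    rw [← he.1]
    simp [List.cons_lt_cons_iff, ho]

theorem cons_lt_cons_of_lt {i j : ℕ} (h : i < j) (k k' : List ℕ) : i :: k < j :: k' := by
  rw [List.cons_lt_cons_iff]
  exact Or.inl h

theorem sorted_block (h : ∀ i, (g i).Sorted) : (block a z g).Sorted := by
  rw [Sorted, block, List.pairwise_cons, List.pairwise_append]
  refine ⟨?_, ?_, by simp, ?_⟩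
  · rintro ⟨k, s⟩ hx
    simp only [List.mem_append, List.mem_flatten, List.mem_ofFn, List.mem_singleton,
      Prod.mk.injEq] at hx
    obtain ⟨_, ⟨i, rfl⟩, hx⟩ | ⟨rfl, rfl⟩ := hx
    · obtain ⟨k', rfl, -⟩ := mem_pre.1 hx
      exact cons_lt_cons_of_lt (by omega) _ _
    · exact cons_lt_cons_of_lt (by omega) _ _
  · rw [List.pairwise_flatten]
    refine ⟨?_, ?_⟩
    · intro l hl
      rw [List.mem_ofFn] at hl
      obtain ⟨i, rfl⟩ := hl
      exact (h i).pre _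
    · rw [List.pairwise_ofFn]
      rintro i j hij ⟨k, s⟩ hx ⟨k', s'⟩ hy
      obtain ⟨_, rfl, -⟩ := mem_pre.1 hx
      obtain ⟨_, rfl, -⟩ := mem_pre.1 hy
      exact cons_lt_cons_of_lt (by simpa using hij) _ _
  · rintro ⟨k, s⟩ hx y hy
    rw [List.mem_singleton] at hy
    subst hy
    simp only [List.mem_flatten, List.mem_ofFn] at hx
    obtain ⟨_, ⟨i, rfl⟩, hx⟩ := hx
    obtain ⟨k', rfl, -⟩ := mem_pre.1 hx
    exact cons_lt_cons_of_lt (by have := i.2; omega) _ _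

theorem Sorted.append (h : W.Sorted) (h' : W'.Sorted)
    (hlt : ∀ x ∈ W, ∀ y ∈ W', x.1 < y.1) : Sorted (W ++ W') :=
  List.pairwise_append.2 ⟨h, h', hlt⟩

/-- Positions themselves are never computed: their order is read off the keys. -/
theorem Sorted.lt_iff (h : W.Sorted) {x y : ℕ} {s' : Tag} (hx : W[x]? = some (k, s))
    (hy : W[y]? = some (k', s')) : x < y ↔ k < k' := by
  obtain ⟨hx', ex⟩ := List.getElem?_eq_some_iff.1 hx
  obtain ⟨hy', ey⟩ := List.getElem?_eq_some_iff.1 hy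
  have key := List.pairwise_iff_getElem.1 h
  constructor
  · intro hlt
    have := key x y hx' hy' hlt
    rwa [ex, ey] at this
  · intro hlt
    by_contra hge
    obtain rfl | hgt := (not_lt.1 hge).eq_or_lt
    · rw [ex] at ey
      cases ey
      exact lt_irrefl _ hlt
    · have := key y x hy' hx' hgt
      rw [ex, ey] at this
      exact lt_asymm hlt this

theorem Sorted.eq_iff (h : W.Sorted) {x y : ℕ} {s' : Tag} (hx : W[x]? = some (k, s))
    (hy : W[y]? = some (k', s')) : x = y ↔ k = k' := by
  have h1 := h.lt_iff hx hy
  have h2 := h.lt_iff hy hx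
  constructor
  · rintro rfl
    rw [hx] at hy
    cases hy
    rfl
  · rintro rfl
    simp only [lt_irrefl, iff_false] at h1 h2
    omega

@[simp] theorem length_tags (W : Coded) : W.tags.length = W.length := List.length_map _

theorem tags_at {p : Tag → Prop} {x : ℕ} :
    Tag.At W.tags p x ↔ ∃ k s, W[x]? = some (k, s) ∧ p s := by
  simp only [Tag.At, tags, List.getElem?_map, Option.map_eq_some_iff, Prod.exists]
  constructor
  · rintro ⟨s, ⟨k, s', h, rfl⟩, hs⟩
    exact ⟨k, _, h, hs⟩
  · rintro ⟨k, s, h, hs⟩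
    exact ⟨s, ⟨k, s, h, rfl⟩, hs⟩

theorem tags_at_iff {p : Tag → Prop} {x : ℕ} (hx : W[x]? = some (k, s)) :
    Tag.At W.tags p x ↔ p s := by
  simp [tags_at, hx]

theorem lt_of_eq_some {x : ℕ} {y : List ℕ × Tag} (hx : W[x]? = some y) : x < W.tags.length := by
  rw [length_tags]
  exact (List.getElem?_eq_some_iff.1 hx).1

/-- A word that does not end with a bit. -/
def EndsWell (W : Coded) : Prop := ∀ x ∈ W.getLast?, ¬ x.2.IsBit

theorem EndsWell.pre (h : W.EndsWell) (i : ℕ) : (pre i W).EndsWell := by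
  simp only [EndsWell, Coded.pre, List.getLast?_map, Option.mem_def, Option.map_eq_some_iff]
  rintro _ ⟨x, hx, rfl⟩
  exact h x hx

theorem EndsWell.append (h : W.EndsWell) (h' : W'.EndsWell) : EndsWell (W ++ W') := by
  intro x hx
  rw [List.getLast?_append] at hx
  cases hW : W'.getLast? with
  | none =>
    rw [hW] at hx
    exact h x hx
  | some y =>
    rw [hW] at hx
    cases hx
    exact h' _ hW

theorem endsWell_append_singleton (W : Coded) (k : List ℕ) (h : ¬ s.IsBit) :
    EndsWell (W ++ [(k, s)]) := by
  intro x hx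
  rw [List.getLast?_concat] at hx
  cases hx
  exact h

theorem endsWell_token (l : List Bool) (h : ¬ s.IsBit) : (token l s).EndsWell :=
  endsWell_append_singleton _ _ h

theorem endsWell_block (h : ¬ z.IsBit) : (block a z g).EndsWell := by
  rw [block, ← List.cons_append]
  exact endsWell_append_singleton _ _ h

/-- The symbol `s` with the key `k` ends the token `l`. -/
def Tok (W : Coded) (k : List ℕ) (s : Tag) (l : List Bool) : Prop :=
  ∃ W₁ B W₂ : Coded, W = W₁ ++ (B ++ (k, s) :: W₂) ∧ B.tags = l.map Tag.bit ∧ W₁.EndsWell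

theorem Tok.pre {l : List Bool} (h : W.Tok k s l) (i : ℕ) : (pre i W).Tok (i :: k) s l := by
  obtain ⟨W₁, B, W₂, rfl, h, h'⟩ := h
  refine ⟨Coded.pre i W₁, Coded.pre i B, Coded.pre i W₂, by simp [Coded.pre], ?_, h'.pre i⟩
  rw [← h]
  simp [Coded.pre, tags]

theorem Tok.append {l : List Bool} (h : W.Tok k s l) (h₀ : W₀.EndsWell) (W' : Coded) :
    Tok (W₀ ++ (W ++ W')) k s l := by
  obtain ⟨W₁, B, W₂, rfl, h, h'⟩ := h
  exact ⟨W₀ ++ W₁, B, W₂ ++ W', by simp, h, h₀.append h'⟩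

theorem tags_bits (l : List Bool) :
    tags (l.mapIdx fun o b => ([o], Tag.bit b)) = l.map Tag.bit := by
  refine List.ext_getElem? fun o => ?_
  simp only [tags, List.getElem?_map, List.getElem?_mapIdx, Option.map_map]
  rfl

theorem tok_token (l : List Bool) (s : Tag) : (token l s).Tok [l.length] s l :=
  ⟨[], l.mapIdx fun o b => ([o], Tag.bit b), [], by simp [token], tags_bits l, by
    simp [EndsWell]⟩

theorem Tok.block {l : List Bool} {i : Fin n} (h : (g i).Tok k s l) (ha : ¬ a.IsBit)
    (hg : ∀ i, (g i).EndsWell) : (block a z g).Tok ((i + 1 : ℕ) :: k) s l := by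
  obtain ⟨s₁, s₂, hs⟩ := List.append_of_mem (List.mem_ofFn.2 ⟨i, rfl⟩ :
    Coded.pre (i + 1) (g i) ∈ List.ofFn fun i : Fin n => Coded.pre (i + 1) (g i))
  have hmem : ∀ W ∈ s₁, W.EndsWell := by
    intro W hW
    have : W ∈ List.ofFn fun i : Fin n => Coded.pre (i + 1) (g i) := hs ▸ List.mem_append_left _ hW
    obtain ⟨j, rfl⟩ := List.mem_ofFn.1 this
    exact (hg j).pre _
  have hend : EndsWell (([0], a) :: s₁.flatten) := by
    have h0 : EndsWell [(([0] : List ℕ), a)] := endsWell_append_singleton [] _ ha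
    clear hs
    induction s₁ using List.reverseRecOn with
    | nil => exact h0
    | append_singleton t W ih =>
      rw [List.flatten_append, ← List.cons_append]
      refine (ih fun W hW => hmem W (by simp [hW])).append ?_
      simpa using hmem W (by simp)
  have e : Coded.block a z g = (([0], a) :: s₁.flatten) ++ (Coded.pre (i + 1) (g i) ++
      (s₂.flatten ++ [([n + 1], z)])) := by
    rw [Coded.block, hs]
    simp
  rw [e]
  exact (h.pre _).append hend _

end Coded

/-! ### The comparison of tokens -/

namespace Tag

/-- The token `l` ends before the position `x`. -/
def TokenAt (w : List Tag) (x : ℕ) (l : List Bool) : Prop :=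
  ∃ i, x = i + l.length ∧ x < w.length ∧ (∀ o < l.length, w[i + o]? = (l[o]?).map bit) ∧
    ∀ j, i = j + 1 → ¬ At w IsBit j

variable {w : List Tag} {x c : ℕ} {l l' : List Bool}

theorem count_interval {N y x : ℕ} (h : x ≤ N) : count N (fun t => y ≤ t ∧ t < x) = x - y := by
  classical
  rw [count_eq_card]
  have : (Finset.range N).filter (fun t => y ≤ t ∧ t < x) = Finset.Ico y x := by
    ext t
    simp
    omega
  rw [this, Nat.card_Ico]

/-- Bits are matched by their distance `d` to the end of the token, the only end that is marked by a
symbol; the beginning is found as the place before which there is no bit. -/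
theorem tokenLE_iff (h : TokenAt w x l) (h' : TokenAt w c l') : TokenLE w x c ↔
    ∀ d, d < l.length → d < l'.length ∧
      (l[l.length - 1 - d]? = some true ↔ l'[l'.length - 1 - d]? = some true) := by
  -- The uninterrupted run of bits before `x` starts exactly at the beginning `i` of the token.
  have bits : ∀ {x : ℕ} {l : List Bool} {i : ℕ}, x = i + l.length → x < w.length →
      (∀ o < l.length, w[i + o]? = (l[o]?).map bit) → (∀ j, i = j + 1 → ¬ At w IsBit j) →
      ∀ y < x, Bits w y x ↔ i ≤ y := by
    intro x l i hx hlt hl hi y hy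
    constructor
    · intro hb
      by_contra hlt'
      exact hi (i - 1) (by omega) (hb (i - 1) (by omega) (by omega) (by omega))
    · intro hiy t ht hyt htx
      have := hl (t - i) (by omega)
      rw [Nat.add_sub_cancel' (by omega),
        (List.getElem?_eq_getElem (by omega) : l[t - i]? = _)] at this
      exact ⟨_, this, _, rfl⟩
  have value : ∀ {l : List Bool} {i : ℕ}, (∀ o < l.length, w[i + o]? = (l[o]?).map bit) →
      ∀ o < l.length, At w (· = bit true) (i + o) ↔ l[o]? = some true := by
    intro l i hl o ho
    rw [At, hl o ho]
    cases l[o]? <;> simp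
  obtain ⟨i, hx, hxw, hl, hi⟩ := h
  obtain ⟨j, hc, hcw, hl', hj⟩ := h'
  have bx := bits hx hxw hl hi
  have bc := bits hc hcw hl' hj
  have vx := value hl
  have vc := value hl'
  constructor
  · intro h d hd
    obtain ⟨z, hz, hzc, hb, hcount, hv⟩ := h (i + (l.length - 1 - d)) (by omega) (by omega)
      ((bx _ (by omega)).2 (by omega))
    rw [bc z hzc] at hb
    rw [count_interval hxw.le, count_interval hcw.le] at hcount
    have hz' : z = j + (l'.length - 1 - d) := by omega
    subst hz'
    rw [vx _ (by omega), vc _ (by omega)] at hv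
    exact ⟨by omega, hv⟩
  · intro h y hy hyx hb
    rw [bx y hyx] at hb
    obtain ⟨hd, hv⟩ := h (x - 1 - y) (by omega)
    refine ⟨j + (l'.length - 1 - (x - 1 - y)), by omega, by omega, (bc _ (by omega)).2 (by omega),
      ?_, ?_⟩
    · rw [count_interval hxw.le, count_interval hcw.le]
      omega
    · rw [vc _ (by omega), ← hv, ← vx _ (by omega)]
      have : i + (l.length - 1 - (x - 1 - y)) = y := by omega
      rw [this]

/-- The two comparisons force equal lengths, and then equal bits. -/
theorem denotes_iff (h : TokenAt w x l) (h' : TokenAt w c l') :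
    Denotes w x c ↔ At w (· = tie) c ∧ l = l' := by
  rw [Denotes, tokenLE_iff h h', tokenLE_iff h' h]
  refine and_congr Iff.rfl ⟨fun ⟨h1, h2⟩ => ?_, ?_⟩
  · have hlen : l.length = l'.length := by
      by_contra hne
      obtain hlt | hlt := lt_or_gt_of_ne hne
      · have := (h2 l.length hlt).1
        omega
      · have := (h1 l'.length hlt).1
        omega
    refine List.ext_getElem hlen fun o ho ho' => ?_
    have := (h1 (l.length - 1 - o) (by omega)).2
    have e : l.length - 1 - (l.length - 1 - o) = o := by omega
    rw [← hlen, e, List.getElem?_eq_getElem ho, List.getElem?_eq_getElem ho'] at this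
    rw [Bool.eq_iff_iff]
    simpa using this
  · rintro rfl
    exact ⟨fun d hd => ⟨hd, Iff.rfl⟩, fun d hd => ⟨hd, Iff.rfl⟩⟩

theorem _root_.GSVoting.Coded.Tok.tokenAt {W : Coded} {k : List ℕ} {s : Tag} (hW : W.Sorted)
    (h : W.Tok k s l) (hx : W[x]? = some (k, s)) : TokenAt W.tags x l := by
  obtain ⟨W₁, B, W₂, hW', hB, hend⟩ := h
  have hlen : B.length = l.length := by
    have := congrArg List.length hB
    simpa [Coded.tags] using this
  have hx' : W[W₁.length + l.length]? = some (k, s) := by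
    rw [hW', List.getElem?_append_right (by omega), List.getElem?_append_right (by omega)]
    simp [hlen]
  have hxe : x = W₁.length + l.length := (hW.eq_iff hx hx').2 rfl
  refine ⟨W₁.length, hxe, Coded.lt_of_eq_some hx, fun o ho => ?_, fun j hj => ?_⟩
  · have e : W.tags = W₁.tags ++ (l.map bit ++ s :: W₂.tags) := by
      rw [← hB, hW']
      simp [Coded.tags]
    rw [e, List.getElem?_append_right (by simp), List.getElem?_append_left (by simpa using ho)]
    simp
  · have hlt : j < W₁.length := by omega
    have e : W[j]? = some W₁[j] := by
      rw [hW', List.getElem?_append_left hlt, List.getElem?_eq_getElem hlt]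
    rw [Coded.tags_at_iff (k := W₁[j].1) (s := W₁[j].2) e]
    refine hend _ ?_
    rw [List.getLast?_eq_getElem?, hj, Nat.add_sub_cancel, List.getElem?_eq_getElem hlt]
    rfl

end Tag

end GSVoting

/-! ### The tags of an encoded instance -/

namespace GSVoting

open Computability (Γ' encodeNat)
open StackProg Coded

/-- A vote; the symbol `a` begins it, and the symbol `s r` ends the candidate in position `r`. -/
def codedVote {m : ℕ} (a : Tag) (s : ℕ → Tag) (v : Vote m) : Coded :=
  block a .other fun r => token (encodeNat (v r)) (s r)

/-- The sincere vote of the voter `i`. -/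
def codedSincere (I : Instance) (i : Fin I.n) : Coded :=
  if (i : ℕ) = 0 then codedVote .other (fun r => .one (r < 2)) (I.V i) else
    codedVote .voterBra (fun r => if r < 2 then .voterTop else .other) (I.V i)

/-- The strategies of the voter `i`. -/
def codedStrategies (I : Instance) (i : Fin I.n) : Coded :=
  block .other (.listKet (I.A i).isEmpty) fun j : Fin (I.A i).length =>
    codedVote .ballotBra (fun r => if r < 2 then .ballotTop else .other) (I.A i)[j]

/-- An instance, and possibly a vote. -/
def codedInstance (I : Instance) (o : Option (Vote I.m)) : Coded :=
  pre 0 (codedVote .other (fun _ => .tie) I.tie) ++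
    (pre 1 (block .other .other (codedSincere I)) ++
      (pre 2 (block .other .other (codedStrategies I)) ++
        pre 3 (o.elim [] fun v =>
          codedVote .other (fun r => if r < 2 then .queryTop else .other) v)))

/-- The states of the transducer that finds the tags: the part of the input in which it is, the
number of candidates seen in the current vote (up to two), whether this is the first vote, and
whether the current list of strategies is empty so far. -/
inductive Phase
  | start
  | tie
  | toVotes
  | votes (first : Bool)
  | sincere (first : Bool) (k : Fin 3)
  | toLists
  | lists
  | list (empty : Bool)
  | ballot (k : Fin 3)
  | query
  | queried (k : Fin 3)
  deriving Fintype

/-- Counting up to two. -/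
def capped (r : ℕ) : Fin 3 := ⟨min r 2, by omega⟩

def bump (k : Fin 3) : Fin 3 := capped (k + 1)

theorem bump_capped (r : ℕ) : bump (capped r) = capped (r + 1) := by
  simp only [bump, capped, Fin.mk.injEq]
  omega

theorem capped_le (r : ℕ) : ((capped r : Fin 3) : ℕ) ≤ 1 ↔ r ≤ 1 := by
  simp only [capped]
  omega

/-- The transducer that finds the tags. -/
def tagger : Mealy Γ' Tag Phase where
  init := .start
  out
    | _, .bit b => .bit b
    | .tie, .comma => .tie
    | .votes false, .bra => .voterBra
    | .sincere true k, .comma => .one ((k : ℕ) < 2)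
    | .sincere false k, .comma => if (k : ℕ) < 2 then .voterTop else .other
    | .list _, .bra => .ballotBra
    | .list e, .ket => .listKet e
    | .ballot k, .comma => if (k : ℕ) < 2 then .ballotTop else .other
    | .queried k, .comma => if (k : ℕ) < 2 then .queryTop else .other
    | _, _ => .other
  next
    | q, .bit _ => q
    | .start, .bra => .tie
    | .tie, .ket => .toVotes
    | .toVotes, .bra => .votes true
    | .votes b, .bra => .sincere b (capped 0)
    | .votes _, .ket => .toLists
    | .sincere b k, .comma => .sincere b (bump k)
    | .sincere _ _, .ket => .votes false
    | .toLists, .bra => .lists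
    | .lists, .bra => .list true
    | .lists, .ket => .query
    | .list _, .bra => .ballot (capped 0)
    | .list _, .ket => .lists
    | .ballot k, .comma => .ballot (bump k)
    | .ballot _, .ket => .list false
    | .query, .bra => .queried (capped 0)
    | .queried k, .comma => .queried (bump k)
    | .queried _, .ket => .query
    | q, _ => q

/-- From the state `q`, the transducer writes `w` when it reads `x`, and stops in the state `q'`. -/
def Writes (q : Phase) (x : List Γ') (w : List Tag) (q' : Phase) : Prop :=
  tagger.run q x = w ∧ x.foldl tagger.next q = q'

theorem Writes.append {q q' q'' : Phase} {x x' : List Γ'} {w w' : List Tag}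
    (h : Writes q x w q') (h' : Writes q' x' w' q'') : Writes q (x ++ x') (w ++ w') q'' := by
  obtain ⟨rfl, rfl⟩ := h
  obtain ⟨rfl, rfl⟩ := h'
  refine ⟨?_, by simp⟩
  induction x generalizing q with
  | nil => rfl
  | cons a x ih => simp [Mealy.run, ih]

theorem Writes.cons (q : Phase) (a : Γ') {q' : Phase} {x : List Γ'} {w : List Tag}
    (h : Writes (tagger.next q a) x w q') : Writes q (a :: x) (tagger.out q a :: w) q' := by
  obtain ⟨rfl, rfl⟩ := h
  exact ⟨rfl, rfl⟩

theorem writes_nil (q : Phase) : Writes q [] [] q := ⟨rfl, rfl⟩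

theorem writes_single (q : Phase) (a : Γ') : Writes q [a] [tagger.out q a] (tagger.next q a) :=
  ⟨rfl, rfl⟩

theorem writes_bits (q : Phase) (l : List Bool) :
    Writes q (l.map Γ'.bit) (l.map Tag.bit) q := by
  induction l with
  | nil => exact writes_nil q
  | cons b l ih =>
    have := Writes.cons (a := .bit b) (q := q) (by
      have e : tagger.next q (.bit b) = q := by cases q <;> rfl
      rw [e]
      exact ih)
    have e : tagger.out q (.bit b) = .bit b := by cases q <;> rfl
    rwa [e] at this

theorem writes_flatten {n : ℕ} {f : Fin n → List Γ'} {g : Fin n → Coded} {q : ℕ → Phase}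
    (h : ∀ i : Fin n, Writes (q i) (f i) (g i).tags (q (i + 1))) :
    Writes (q 0) (List.ofFn f).flatten (tags (List.ofFn fun i : Fin n => pre (i + 1) (g i)).flatten)
      (q n) := by
  induction n with
  | zero => simpa [tags] using writes_nil _
  | succ n ih =>
    have h1 := ih (f := fun i => f i.castSucc) (g := fun i => g i.castSucc)
      fun i => h i.castSucc
    have h2 := h (Fin.last n)
    rw [List.ofFn_succ', List.ofFn_succ', List.concat_eq_append, List.concat_eq_append]
    have e : (pre (Fin.last n + 1) (g (Fin.last n))).tags = (g (Fin.last n)).tags := by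
      simp [pre, tags]
    have := h1.append h2
    rw [← e] at this
    simpa [tags] using this

theorem writes_block {n : ℕ} {f : Fin n → List Γ'} {g : Fin n → Coded} {q₀ q₁ : Phase} {a z : Tag}
    {q : ℕ → Phase} (h0 : tagger.next q₀ .bra = q 0) (ha : tagger.out q₀ .bra = a)
    (h : ∀ i : Fin n, Writes (q i) (f i) (g i).tags (q (i + 1)))
    (h1 : tagger.next (q n) .ket = q₁) (hz : tagger.out (q n) .ket = z) :
    Writes q₀ (encodeBlock (List.ofFn f)) (block a z g).tags q₁ := by
  have := Writes.cons q₀ .bra (h0 ▸ (writes_flatten h).append (writes_single (q n) .ket))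
  rw [ha, hz, h1] at this
  simpa [encodeBlock, block, tags] using this

theorem writes_vote {m : ℕ} (v : Vote m) {q₀ q₁ : Phase} {a : Tag} {s : ℕ → Tag} {q : ℕ → Phase}
    (h0 : tagger.next q₀ .bra = q 0) (ha : tagger.out q₀ .bra = a)
    (hq : ∀ r, tagger.next (q r) .comma = q (r + 1)) (hs : ∀ r, tagger.out (q r) .comma = s r)
    (h1 : ∀ r, tagger.next (q r) .ket = q₁) (hz : ∀ r, tagger.out (q r) .ket = .other) :
    Writes q₀ (encodeVote v) (codedVote a s v).tags q₁ := by
  refine writes_block h0 ha (fun r => ?_) (h1 m) (hz m)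
  have := (writes_bits (q r) (encodeNat (v r))).append (writes_single (q r) .comma)
  rw [hq, hs] at this
  have e : (token (encodeNat (v r)) (s r)).tags = (encodeNat (v r)).map Tag.bit ++ [s r] := by
    rw [token, tags, List.map_append]
    exact congrArg (· ++ _) (tags_bits _)
  rw [e]
  exact this

theorem writes_sincere (I : Instance) (i : Fin I.n) :
    Writes (.votes ((i : ℕ) = 0)) (encodeVote (I.V i)) (codedSincere I i).tags (.votes false) := by
  unfold codedSincere
  split_ifs with hi
  · simp only [hi, decide_true]
    refine writes_vote _ (q := fun r => .sincere true (capped r)) rfl rfl (fun r => ?_) (fun r => ?_)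
      (fun r => rfl) fun r => rfl
    · simp [tagger, bump_capped]
    · simp [tagger, capped_le]
  · simp only [hi, decide_false]
    refine writes_vote _ (q := fun r => .sincere false (capped r)) rfl rfl (fun r => ?_) (fun r => ?_)
      (fun r => rfl) fun r => rfl
    · simp [tagger, bump_capped]
    · simp [tagger, capped_le]

theorem writes_strategies (I : Instance) (i : Fin I.n) :
    Writes .lists (encodeBlock ((I.A i).map encodeVote)) (codedStrategies I i).tags .lists := by
  have e : (I.A i).map encodeVote =
      List.ofFn fun j : Fin (I.A i).length => encodeVote (I.A i)[j] := by
    refine List.ext_getElem (by simp) fun k h h' => by simp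
  rw [e]
  -- After `j` strategies the transducer only remembers whether `j = 0`, which is what the closing
  -- bracket has to announce.
  refine writes_block (q := fun j => .list (decide (j = 0))) rfl rfl (fun j => ?_) rfl ?_
  · refine writes_vote _ (q := fun r => .ballot (capped r)) rfl rfl (fun r => ?_) (fun r => ?_)
      (fun r => rfl) fun r => rfl
    · simp [tagger, bump_capped]
    · simp [tagger, capped_le]
  · cases I.A i <;> simp [tagger]

theorem writes_instance (I : Instance) : Writes .start (encodeInstance I)
    ((pre 0 (codedVote .other (fun _ => .tie) I.tie)).tags ++
      ((pre 1 (block .other .other (codedSincere I))).tags ++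
        (pre 2 (block .other .other (codedStrategies I))).tags)) .query := by
  have e : ∀ i W, (pre i W).tags = W.tags := fun i W => by simp [pre, tags]
  simp only [e]
  rw [encodeInstance, List.append_assoc]
  refine Writes.append (q' := .toVotes) ?_ (Writes.append (q' := .toLists) ?_ ?_)
  · exact writes_vote _ (q := fun _ => .tie) rfl rfl (fun _ => rfl) (fun _ => rfl) (fun _ => rfl)
      fun _ => rfl
  · refine writes_block (q := fun i => .votes (i = 0)) rfl rfl (fun i => ?_) rfl ?_
    · simpa using writes_sincere I i
    · by_cases h : I.n = 0 <;> simp [h, tagger]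
  · exact writes_block (q := fun _ => .lists) rfl rfl (fun i => writes_strategies I i) rfl rfl

theorem tagger_instance (I : Instance) :
    tagger.run tagger.init (encodeInstance I) = (codedInstance I none).tags := by
  refine (writes_instance I).1.trans ?_
  simp [codedInstance, tags, pre]

theorem tagger_query (q : Query) :
    tagger.run tagger.init (encodeQuery q) = (codedInstance q.1 (some q.2)).tags := by
  have := (writes_instance q.1).append (writes_vote q.2 (a := .other) (q₀ := .query) (q₁ := .query)
    (s := fun r => if r < 2 then .queryTop else .other) (q := fun r => .queried (capped r)) rfl rfl
    (fun r => by simp [tagger, bump_capped]) (fun r => by simp [tagger, capped_le])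
    (fun r => rfl) fun r => rfl)
  refine this.1.trans ?_
  simp only [codedInstance, tags, pre, List.map_append, List.map_map, List.append_assoc]
  rfl

end GSVoting

/-! ### Keys of the marked symbols in an encoded instance -/

namespace GSVoting

open Computability (encodeNat)
open StackProg Coded

/-- The length of the encoding of a candidate. -/
def size {m : ℕ} (c : Fin m) : ℕ := (encodeNat c).length

theorem encodeNat_injective : Function.Injective encodeNat :=
  Function.LeftInverse.injective Computability.decode_encodeNat

/-- The symbols whose tags are used. -/
def Tag.Special (s : Tag) : Prop := s ≠ .other ∧ ¬ s.IsBit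

variable {m : ℕ} {k : List ℕ} {s a : Tag} {f : ℕ → Tag}

/-- Within a token the bits have the keys `0, 1, …`, so the last component of the key of its end is
the length of the token. -/
theorem mem_codedVote (hs : s.Special) (v : Vote m) : (k, s) ∈ codedVote a f v ↔
    (k = [0] ∧ s = a) ∨ ∃ r : Fin m, k = [(r + 1 : ℕ), size (v r)] ∧ s = f r := by
  rw [codedVote, mem_block]
  refine or_congr Iff.rfl ?_
  constructor
  · rintro (⟨r, k', rfl, h⟩ | ⟨-, h⟩)
    · rw [mem_token] at h
      obtain ⟨o, b, -, -, h⟩ | ⟨rfl, h⟩ := h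
      · exact (hs.2 ⟨b, h⟩).elim
      · exact ⟨r, rfl, h⟩
    · exact (hs.1 h).elim
  · rintro ⟨r, rfl, rfl⟩
    exact Or.inl ⟨r, _, rfl, mem_token.2 (Or.inr ⟨rfl, rfl⟩)⟩

theorem tok_codedVote (v : Vote m) (ha : ¬ a.IsBit) (hf : ∀ r, ¬ (f r).IsBit) (r : Fin m) :
    (codedVote a f v).Tok [(r + 1 : ℕ), size (v r)] (f r) (encodeNat (v r)) :=
  (tok_token _ _).block (i := r) (g := fun r => token (encodeNat (v r)) (f r)) ha
    fun i => endsWell_token _ (hf i)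

theorem sorted_codedVote (v : Vote m) : (codedVote a f v).Sorted :=
  sorted_block fun _ => sorted_token _ _

theorem not_isBit_other : ¬ Tag.IsBit .other := by simp [Tag.IsBit]

theorem endsWell_codedVote (v : Vote m) : (codedVote a f v).EndsWell :=
  endsWell_block not_isBit_other

/-- The position of a key. -/
def Coded.pos (W : Coded) (k : List ℕ) : ℕ := (W.map Prod.fst).idxOf k

theorem Coded.Sorted.getElem?_pos {W : Coded} (hW : W.Sorted) (h : (k, s) ∈ W) :
    W[W.pos k]? = some (k, s) := by
  obtain ⟨x, hx⟩ := List.mem_iff_getElem?.1 h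
  have hk : k ∈ W.map Prod.fst := List.mem_map.2 ⟨_, h, rfl⟩
  have hlt : W.pos k < W.length := by
    have := List.idxOf_lt_length_iff.2 hk
    rw [List.length_map] at this
    exact this
  have e : W[W.pos k]? = some ((W[W.pos k]).1, (W[W.pos k]).2) := List.getElem?_eq_getElem hlt
  have e1 : (W[W.pos k]).1 = k := by
    have := List.getElem_idxOf (List.idxOf_lt_length_iff.2 hk)
    rwa [List.getElem_map] at this
  rw [e1] at e
  have := (hW.eq_iff hx e).2 rfl
  rw [← this]
  exact hx

namespace Instance

variable (I : Instance) (o : Option (Vote I.m))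

/-- The first voter. -/
def one : Fin I.n := ⟨0, I.hn⟩

variable {I}

theorem eq_one_iff {i : Fin I.n} : i = I.one ↔ (i : ℕ) = 0 := by
  rw [one, Fin.ext_iff]

theorem sorted_coded : (codedInstance I o).Sorted := by
  have hlt : ∀ {i j : ℕ} {W W' : Coded}, i < j → ∀ x ∈ pre i W, ∀ y ∈ pre j W', x.1 < y.1 := by
    rintro i j W W' hij ⟨k, s⟩ hx ⟨k', s'⟩ hy
    obtain ⟨_, rfl, -⟩ := mem_pre.1 hx
    obtain ⟨_, rfl, -⟩ := mem_pre.1 hy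
    exact cons_lt_cons_of_lt hij _ _
  have h1 : (block .other .other (codedSincere I)).Sorted := sorted_block fun i => by
    unfold codedSincere
    split_ifs <;> exact sorted_codedVote _
  have h2 : (block .other .other (codedStrategies I)).Sorted :=
    sorted_block fun i => sorted_block fun j => sorted_codedVote _
  have h3 : Sorted (o.elim [] fun v =>
      codedVote .other (fun r => if r < 2 then .queryTop else .other) v) := by
    cases o with
    | none => exact List.Pairwise.nil
    | some v =>
      exact sorted_codedVote (a := .other) (f := fun r => if r < 2 then .queryTop else .other) v
  refine ((sorted_codedVote _).pre _).append ((h1.pre _).append ((h2.pre _).append (h3.pre _)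
    (hlt (by omega))) ?_) ?_
  · intro x hx y hy
    obtain hy | hy := List.mem_append.1 hy
    · exact hlt (by omega) x hx y hy
    · exact hlt (by omega) x hx y hy
  · intro x hx y hy
    obtain hy | hy := List.mem_append.1 hy
    · exact hlt (by omega) x hx y hy
    · obtain hy | hy := List.mem_append.1 hy
      · exact hlt (by omega) x hx y hy
      · exact hlt (by omega) x hx y hy

theorem mem_codedVote_if (hs : s.Special) (ha : s ≠ a) {t : Tag} (v : Vote m) :
    (k, s) ∈ codedVote a (fun r => if r < 2 then t else .other) v ↔
      ∃ r : Fin m, k = [(r + 1 : ℕ), size (v r)] ∧ (r : ℕ) < 2 ∧ s = t := by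
  rw [mem_codedVote hs]
  simp only [ha, and_false, false_or]
  refine exists_congr fun r => and_congr Iff.rfl ?_
  have hsn := hs.1
  split_ifs with h <;> simp [h, hsn]

theorem mem_codedSincere (hs : s.Special) {i : Fin I.n} : (k, s) ∈ codedSincere I i ↔
    (i = I.one ∧ ∃ r : Fin I.m, k = [(r + 1 : ℕ), size (I.V i r)] ∧ s = .one ((r : ℕ) < 2)) ∨
    (i ≠ I.one ∧ k = [0] ∧ s = .voterBra) ∨
    (i ≠ I.one ∧ ∃ r : Fin I.m, k = [(r + 1 : ℕ), size (I.V i r)] ∧ (r : ℕ) < 2 ∧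
      s = .voterTop) := by
  have hsn := hs.1
  by_cases h : i = I.one
  · have h' : (i : ℕ) = 0 := eq_one_iff.1 h
    rw [codedSincere, if_pos h', mem_codedVote hs]
    simp [h, hsn]
  · have h' : ¬ (i : ℕ) = 0 := fun h' => h (eq_one_iff.2 h')
    rw [codedSincere, if_neg h', mem_codedVote hs]
    simp only [h, false_and, false_or, ne_eq, not_false_eq_true, true_and]
    refine or_congr Iff.rfl (exists_congr fun r => and_congr Iff.rfl ?_)
    split_ifs with h2 <;> simp [h2, hsn]

theorem mem_codedStrategies (hs : s.Special) {i : Fin I.n} : (k, s) ∈ codedStrategies I i ↔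
    (k = [(I.A i).length + 1] ∧ s = .listKet (I.A i).isEmpty) ∨
    (∃ j : Fin (I.A i).length, k = [(j + 1 : ℕ), 0] ∧ s = .ballotBra) ∨
    (∃ j : Fin (I.A i).length, ∃ r : Fin I.m,
      k = [(j + 1 : ℕ), (r + 1 : ℕ), size ((I.A i)[j] r)] ∧ (r : ℕ) < 2 ∧ s = .ballotTop) := by
  have hsn := hs.1
  have hif : ∀ {r : ℕ}, (s = if r < 2 then .ballotTop else .other) ↔ r < 2 ∧ s = .ballotTop := by
    intro r
    split_ifs with h <;> simp [h, hsn]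
  rw [codedStrategies, mem_block]
  simp only [hsn, and_false, false_or, mem_codedVote hs, hif]
  constructor
  · rintro (⟨j, k, rfl, ⟨rfl, h⟩ | ⟨r, rfl, h⟩⟩ | h)
    · exact Or.inr (Or.inl ⟨j, rfl, h⟩)
    · exact Or.inr (Or.inr ⟨j, r, rfl, h⟩)
    · exact Or.inl h
  · rintro (h | ⟨j, rfl, h⟩ | ⟨j, r, rfl, h⟩)
    · exact Or.inr h
    · exact Or.inl ⟨j, _, rfl, Or.inl ⟨rfl, h⟩⟩
    · exact Or.inl ⟨j, _, rfl, Or.inr ⟨r, rfl, h⟩⟩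

/-- The first component of a key distinguishes the tie-breaking order, the sincere votes, the
strategies and the query; brackets and bits drop out because `s` is special. -/
theorem mem_coded (hs : s.Special) : (k, s) ∈ codedInstance I o ↔
    (∃ r : Fin I.m, k = [0, (r + 1 : ℕ), size (I.tie r)] ∧ s = .tie) ∨
    (∃ i : Fin I.n, ∃ k', k = 1 :: (i + 1 : ℕ) :: k' ∧ (k', s) ∈ codedSincere I i) ∨
    (∃ i : Fin I.n, ∃ k', k = 2 :: (i + 1 : ℕ) :: k' ∧ (k', s) ∈ codedStrategies I i) ∨
    (∃ v, o = some v ∧ ∃ r : Fin I.m, k = [3, (r + 1 : ℕ), size (v r)] ∧ (r : ℕ) < 2 ∧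
      s = .queryTop) := by
  have hsn := hs.1
  have hblock : ∀ {n i : ℕ} {g : Fin n → Coded}, (k, s) ∈ Coded.pre i (block .other .other g) ↔
      ∃ j : Fin n, ∃ k', k = i :: (j + 1 : ℕ) :: k' ∧ (k', s) ∈ g j := by
    intro n i g
    simp only [mem_pre, mem_block, hsn, and_false, false_or, or_false]
    constructor
    · rintro ⟨_, rfl, j, k', rfl, h⟩
      exact ⟨j, k', rfl, h⟩
    · rintro ⟨j, k', rfl, h⟩
      exact ⟨_, rfl, j, k', rfl, h⟩
  rw [codedInstance, List.mem_append, List.mem_append, List.mem_append, hblock, hblock]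
  refine or_congr ?_ (or_congr Iff.rfl (or_congr Iff.rfl ?_))
  · simp only [mem_pre, mem_codedVote hs, hsn, and_false, false_or]
    constructor
    · rintro ⟨_, rfl, r, rfl, h⟩
      exact ⟨r, rfl, h⟩
    · rintro ⟨r, rfl, h⟩
      exact ⟨_, rfl, r, rfl, h⟩
  · cases o with
    | none => simp [mem_pre]
    | some v =>
      simp only [Option.elim, mem_pre, mem_codedVote_if hs hsn, Option.some.injEq,
        exists_eq_left']
      constructor
      · rintro ⟨_, rfl, r, rfl, h⟩
        exact ⟨r, rfl, h⟩
      · rintro ⟨r, rfl, h⟩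
        exact ⟨_, rfl, r, rfl, h⟩

section members

open Tag

theorem mem_tie : (k, .tie) ∈ codedInstance I o ↔
    ∃ r : Fin I.m, k = [0, (r + 1 : ℕ), size (I.tie r)] := by
  have hs : Special (.tie) := by simp [Special, IsBit]
  rw [mem_coded o hs]
  simp [mem_codedSincere hs, mem_codedStrategies hs]

theorem mem_one {b : Bool} : (k, .one b) ∈ codedInstance I o ↔
    ∃ r : Fin I.m, k = [1, 1, (r + 1 : ℕ), size (I.V I.one r)] ∧ b = ((r : ℕ) < 2 : Bool) := by
  have hs : Special (.one b) := by simp [Special, IsBit]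
  rw [mem_coded o hs]
  simp [mem_codedSincere hs, mem_codedStrategies hs]
  rfl

theorem mem_voterBra : (k, .voterBra) ∈ codedInstance I o ↔
    ∃ i : Fin I.n, i ≠ I.one ∧ k = [1, (i + 1 : ℕ), 0] := by
  have hs : Special (.voterBra) := by simp [Special, IsBit]
  rw [mem_coded o hs]
  simp [mem_codedSincere hs, mem_codedStrategies hs]
  exact exists_congr fun i => and_comm

theorem mem_voterTop : (k, .voterTop) ∈ codedInstance I o ↔ ∃ i : Fin I.n, i ≠ I.one ∧
    ∃ r : Fin I.m, k = [1, (i + 1 : ℕ), (r + 1 : ℕ), size (I.V i r)] ∧ (r : ℕ) < 2 := by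
  have hs : Special (.voterTop) := by simp [Special, IsBit]
  rw [mem_coded o hs]
  simp [mem_codedSincere hs, mem_codedStrategies hs]
  refine exists_congr fun i => ?_
  constructor
  · rintro ⟨r, h, hi, hr⟩
    exact ⟨hi, r, h, hr⟩
  · rintro ⟨hi, r, h, hr⟩
    exact ⟨r, h, hi, hr⟩

theorem mem_listKet {b : Bool} : (k, .listKet b) ∈ codedInstance I o ↔
    ∃ i : Fin I.n, k = [2, (i + 1 : ℕ), (I.A i).length + 1] ∧ b = (I.A i).isEmpty := by
  have hs : Special (.listKet b) := by simp [Special, IsBit]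
  rw [mem_coded o hs]
  simp [mem_codedSincere hs, mem_codedStrategies hs]

theorem mem_ballotBra : (k, .ballotBra) ∈ codedInstance I o ↔
    ∃ i : Fin I.n, ∃ j : Fin (I.A i).length, k = [2, (i + 1 : ℕ), (j + 1 : ℕ), 0] := by
  have hs : Special (.ballotBra) := by simp [Special, IsBit]
  rw [mem_coded o hs]
  simp [mem_codedSincere hs, mem_codedStrategies hs]

theorem mem_ballotTop : (k, .ballotTop) ∈ codedInstance I o ↔
    ∃ i : Fin I.n, ∃ j : Fin (I.A i).length, ∃ r : Fin I.m,
      k = [2, (i + 1 : ℕ), (j + 1 : ℕ), (r + 1 : ℕ), size ((I.A i)[j] r)] ∧ (r : ℕ) < 2 := by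
  have hs : Special (.ballotTop) := by simp [Special, IsBit]
  rw [mem_coded o hs]
  simp [mem_codedSincere hs, mem_codedStrategies hs]

theorem mem_queryTop : (k, .queryTop) ∈ codedInstance I o ↔
    ∃ v, o = some v ∧ ∃ r : Fin I.m, k = [3, (r + 1 : ℕ), size (v r)] ∧ (r : ℕ) < 2 := by
  have hs : Special (.queryTop) := by simp [Special, IsBit]
  rw [mem_coded o hs]
  simp [mem_codedSincere hs, mem_codedStrategies hs]

end members

section tokens

open Tag

theorem endsWell_sincere (i : Fin I.n) : (codedSincere I i).EndsWell := by
  unfold codedSincere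
  split_ifs <;> exact endsWell_codedVote _

theorem endsWell_strategies (i : Fin I.n) : (codedStrategies I i).EndsWell :=
  endsWell_block (by simp [IsBit])

theorem tok_tie (r : Fin I.m) : (codedInstance I o).Tok [0, (r + 1 : ℕ), size (I.tie r)] .tie
    (encodeNat (I.tie r)) :=
  ((tok_codedVote I.tie not_isBit_other (f := fun _ => .tie) (fun _ => by simp [IsBit]) r).pre
    0).append (W₀ := []) (by simp [EndsWell]) _

theorem tok_sincere {i : Fin I.n} {l : List Bool} (h : (codedSincere I i).Tok k s l) :
    (codedInstance I o).Tok (1 :: (i + 1 : ℕ) :: k) s l :=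
  ((h.block not_isBit_other endsWell_sincere).pre 1).append ((endsWell_codedVote _).pre 0) _

theorem tok_one (r : Fin I.m) : (codedInstance I o).Tok [1, 1, (r + 1 : ℕ), size (I.V I.one r)]
    (.one ((r : ℕ) < 2)) (encodeNat (I.V I.one r)) := by
  refine tok_sincere (i := I.one) o ?_
  rw [codedSincere, if_pos (show (I.one : ℕ) = 0 from rfl)]
  exact tok_codedVote (I.V I.one) not_isBit_other (f := fun r => .one (r < 2))
    (fun _ => by simp [IsBit]) r

theorem tok_voterTop {i : Fin I.n} (hi : i ≠ I.one) {r : Fin I.m} (hr : (r : ℕ) < 2) :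
    (codedInstance I o).Tok [1, (i + 1 : ℕ), (r + 1 : ℕ), size (I.V i r)] .voterTop
      (encodeNat (I.V i r)) := by
  refine tok_sincere o ?_
  rw [codedSincere, if_neg (by rwa [← eq_one_iff])]
  have := tok_codedVote (I.V i) (a := .voterBra) (by simp [IsBit])
    (f := fun r => if r < 2 then .voterTop else .other)
    (fun r => by split_ifs <;> simp [IsBit]) r
  rwa [if_pos hr] at this

theorem tok_ballotTop {i : Fin I.n} {j : Fin (I.A i).length} {r : Fin I.m} (hr : (r : ℕ) < 2) :
    (codedInstance I o).Tok [2, (i + 1 : ℕ), (j + 1 : ℕ), (r + 1 : ℕ), size ((I.A i)[j] r)]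
      .ballotTop (encodeNat ((I.A i)[j] r)) := by
  have := tok_codedVote (I.A i)[j] (a := .ballotBra) (by simp [IsBit])
    (f := fun r => if r < 2 then .ballotTop else .other)
    (fun r => by split_ifs <;> simp [IsBit]) r
  rw [if_pos hr] at this
  have := this.block (i := j) (a := .other) (z := .listKet (I.A i).isEmpty)
    (g := fun j : Fin (I.A i).length =>
      codedVote .ballotBra (fun r => if r < 2 then .ballotTop else .other) (I.A i)[j])
    not_isBit_other fun _ => endsWell_codedVote _
  have h2 := (this.block (i := i) (a := .other) (z := .other) (g := codedStrategies I)
    not_isBit_other endsWell_strategies).pre 2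
  have h3 := h2.append (((endsWell_codedVote I.tie (a := .other) (f := fun _ => .tie)).pre 0).append
    ((endsWell_block (a := .other) (z := .other) (g := codedSincere I) not_isBit_other).pre 1))
      (Coded.pre 3 (o.elim [] fun v =>
        codedVote .other (fun r => if r < 2 then .queryTop else .other) v))
  rwa [List.append_assoc] at h3

theorem tok_queryTop {v : Vote I.m} {r : Fin I.m} (hr : (r : ℕ) < 2) :
    (codedInstance I (some v)).Tok [3, (r + 1 : ℕ), size (v r)] .queryTop
      (encodeNat (v r)) := by
  have := tok_codedVote v (a := .other) not_isBit_other
    (f := fun r => if r < 2 then .queryTop else .other)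
    (fun r => by split_ifs <;> simp [IsBit]) r
  rw [if_pos hr] at this
  have h3 := (this.pre 3).append (((endsWell_codedVote I.tie (a := .other) (f := fun _ => .tie)).pre
    0).append (((endsWell_block (a := .other) (z := .other) (g := codedSincere I)
      not_isBit_other).pre 1).append ((endsWell_block (a := .other) (z := .other)
        (g := codedStrategies I) not_isBit_other).pre 2))) []
  rw [List.append_nil, List.append_assoc, List.append_assoc] at h3
  exact h3

end tokens

end Instance

end GSVoting

/-! ### The arena of an encoded instance -/

namespace GSVoting

open Computability (encodeNat)
open StackProg Coded Finset Function
open StackProg.Formula (count)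

variable {k k' : List ℕ} {s s' : Tag}

theorem append_lt_append_iff (l : List ℕ) : l ++ k < l ++ k' ↔ k < k' := by
  induction l with
  | nil => rfl
  | cons a l ih => simp [ih]

theorem Coded.Sorted.tags_at {W : Coded} (hW : W.Sorted) {p : Tag → Prop} {x : ℕ} :
    Tag.At W.tags p x ↔ ∃ k s, (k, s) ∈ W ∧ p s ∧ x = W.pos k := by
  rw [Coded.tags_at]
  constructor
  · rintro ⟨k, s, hx, hs⟩
    have hm := List.mem_of_getElem? hx
    exact ⟨k, s, hm, hs, (hW.eq_iff hx (hW.getElem?_pos hm)).2 rfl⟩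
  · rintro ⟨k, s, hm, hs, rfl⟩
    exact ⟨k, s, hW.getElem?_pos hm, hs⟩

theorem Coded.Sorted.pos_lt_pos {W : Coded} (hW : W.Sorted) (h : (k, s) ∈ W) (h' : (k', s') ∈ W) :
    W.pos k < W.pos k' ↔ k < k' :=
  hW.lt_iff (hW.getElem?_pos h) (hW.getElem?_pos h')

theorem Coded.Sorted.pos_inj {W : Coded} (hW : W.Sorted) (h : (k, s) ∈ W) (h' : (k', s') ∈ W) :
    W.pos k = W.pos k' ↔ k = k' :=
  hW.eq_iff (hW.getElem?_pos h) (hW.getElem?_pos h')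

theorem Coded.Sorted.pos_lt {W : Coded} (hW : W.Sorted) (h : (k, s) ∈ W) :
    W.pos k < W.tags.length :=
  lt_of_eq_some (hW.getElem?_pos h)

theorem Vote.mem_top {m k : ℕ} {v : Vote m} {c : Fin m} : c ∈ v.top k ↔ (v.symm c : ℕ) < k := by
  simp [Vote.top]

theorem Vote.exists_mem_top {m k : ℕ} {v : Vote m} {p : Fin m → Prop} :
    (∃ c ∈ v.top k, p c) ↔ ∃ r : Fin m, (r : ℕ) < k ∧ p (v r) := by
  constructor
  · rintro ⟨c, hc, h⟩
    exact ⟨v.symm c, mem_top.1 hc, by simpa using h⟩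
  · rintro ⟨r, hr, h⟩
    exact ⟨v r, by simpa [mem_top] using hr, h⟩

theorem Vote.card_top {m k : ℕ} (hk : k ≤ m) (v : Vote m) : #(v.top k) = k := by
  have : v.top k = (univ.filter fun r : Fin m => (r : ℕ) < k).map v.toEmbedding := by
    ext c
    simp only [mem_top, mem_map_equiv, mem_filter, mem_univ, true_and]
  rw [this, card_map, Fin.card_filter_val_lt, min_eq_right hk]

namespace Instance

open Tag

variable (I : Instance) (o : Option (Vote I.m))

/-- The word of the tags of an encoded instance. -/
def word : List Tag := (codedInstance I o).tags

/-- The position of a key. -/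
def pos (k : List ℕ) : ℕ := (codedInstance I o).pos k

/-- The position of a candidate in the tie-breaking order. -/
def cand (c : Fin I.m) : ℕ := I.pos o [0, (I.tie.symm c + 1 : ℕ), size c]

variable {I}

theorem mem_cand (c : Fin I.m) :
    ([0, (I.tie.symm c + 1 : ℕ), size c], .tie) ∈ codedInstance I o :=
  (mem_tie o).2 ⟨I.tie.symm c, by simp⟩

/-- Candidates are identified with their positions in the tie-breaking order, so comparing positions
is breaking ties. -/
theorem cand_lt_cand {c d : Fin I.m} : I.cand o c < I.cand o d ↔ I.tie.symm c < I.tie.symm d := by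
  rw [cand, cand, pos, pos, (sorted_coded o).pos_lt_pos (mem_cand o c) (mem_cand o d)]
  constructor
  · intro h
    simp only [List.cons_lt_cons_iff, lt_irrefl, true_and, false_or] at h
    obtain h | ⟨h, h'⟩ := h
    · exact Fin.lt_def.2 (by omega)
    · have : c = d := I.tie.symm.injective (Fin.ext (by omega))
      simp [this] at h'
  · intro h
    rw [Fin.lt_def] at h
    simp [List.cons_lt_cons_iff, h]

theorem cand_injective : Injective (I.cand o) := by
  intro c d h
  have h1 := cand_lt_cand o (c := c) (d := d)
  have h2 := cand_lt_cand o (c := d) (d := c)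
  simp only [h, lt_irrefl, false_iff, not_lt] at h1 h2
  exact I.tie.symm.injective (le_antisymm h2 h1)

theorem at_iff {p : Tag → Prop} {x : ℕ} :
    At (I.word o) p x ↔ ∃ k s, (k, s) ∈ codedInstance I o ∧ p s ∧ x = I.pos o k :=
  (sorted_coded o).tags_at

theorem at_eq_iff {x : ℕ} : At (I.word o) (· = s) x ↔
    ∃ k, (k, s) ∈ codedInstance I o ∧ x = I.pos o k := by
  rw [at_iff]
  constructor
  · rintro ⟨k, s, h, rfl, hx⟩
    exact ⟨k, h, hx⟩
  · rintro ⟨k, h, hx⟩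
    exact ⟨k, s, h, rfl, hx⟩

theorem at_tie {x : ℕ} : At (I.word o) (· = .tie) x ↔ ∃ c, x = I.cand o c := by
  rw [at_eq_iff]
  constructor
  · rintro ⟨k, h, rfl⟩
    obtain ⟨r, rfl⟩ := (mem_tie o).1 h
    exact ⟨I.tie r, by simp [cand]⟩
  · rintro ⟨c, rfl⟩
    exact ⟨_, mem_cand o c, rfl⟩

theorem _root_.GSVoting.Coded.Tok.mem {W : Coded} {l : List Bool} (h : W.Tok k s l) :
    (k, s) ∈ W := by
  obtain ⟨W₁, B, W₂, rfl, -⟩ := h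
  simp

theorem denotes_iff {c : Fin I.m} (h : (codedInstance I o).Tok k s (encodeNat c)) {z : ℕ} :
    Denotes (I.word o) (I.pos o k) z ↔ z = I.cand o c := by
  have hW := sorted_coded o
  have key : ∀ d, Denotes (I.word o) (I.pos o k) (I.cand o d) ↔ c = d := by
    intro d
    have ht := tok_tie o (I.tie.symm d)
    rw [Equiv.apply_symm_apply] at ht
    refine (Tag.denotes_iff (h.tokenAt hW (hW.getElem?_pos h.mem))
      (ht.tokenAt hW (hW.getElem?_pos ht.mem))).trans ?_
    constructor
    · rintro ⟨-, h⟩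
      exact Fin.ext (encodeNat_injective h)
    · rintro rfl
      exact ⟨(at_tie o).2 ⟨c, rfl⟩, rfl⟩
  constructor
  · intro hd
    obtain ⟨d, rfl⟩ := (at_tie o).1 hd.1
    rw [(key d).1 hd]
  · rintro rfl
    exact (key c).2 rfl

theorem marked_one {z : ℕ} :
    Marked (I.word o) (.one true) z ↔ ∃ c ∈ (I.V I.one).top 2, z = I.cand o c := by
  rw [Vote.exists_mem_top, Marked]
  constructor
  · rintro ⟨x, -, hx, hz⟩
    obtain ⟨k, h, rfl⟩ := (at_eq_iff o).1 hx
    obtain ⟨r, rfl, hr⟩ := (mem_one o).1 h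
    exact ⟨r, by simpa using hr.symm, (denotes_iff o (tok_one o r)).1 hz⟩
  · rintro ⟨r, hr, hz⟩
    have h := tok_one o r
    simp only [hr, decide_true] at h
    exact ⟨_, (sorted_coded o).pos_lt h.mem, (at_eq_iff o).2 ⟨_, h.mem, rfl⟩,
      (denotes_iff o h).2 hz⟩

theorem marked_query {v : Vote I.m} {z : ℕ} :
    Marked (I.word (some v)) .queryTop z ↔ ∃ c ∈ v.top 2, z = I.cand (some v) c := by
  rw [Vote.exists_mem_top, Marked]
  constructor
  · rintro ⟨x, -, hx, hz⟩
    obtain ⟨k, h, rfl⟩ := (at_eq_iff _).1 hx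
    obtain ⟨v', hv, r, rfl, hr⟩ := (mem_queryTop _).1 h
    cases hv
    exact ⟨r, hr, (denotes_iff _ (tok_queryTop hr)).1 hz⟩
  · rintro ⟨r, hr, hz⟩
    have h := tok_queryTop (v := v) hr
    exact ⟨_, (sorted_coded _).pos_lt h.mem, (at_eq_iff _).2 ⟨_, h.mem, rfl⟩,
      (denotes_iff _ h).2 hz⟩

theorem pref_iff {p q : ℕ} : Pref (I.word o) q p ↔
    ∃ c d, q = I.cand o c ∧ p = I.cand o d ∧ (I.V I.one).Prefers c d := by
  have hone : ∀ x, At (I.word o) IsOne x ↔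
      ∃ r : Fin I.m, x = I.pos o [1, 1, (r + 1 : ℕ), size (I.V I.one r)] := by
    intro x
    rw [at_iff]
    constructor
    · rintro ⟨k, _, h, ⟨b, rfl⟩, rfl⟩
      obtain ⟨r, rfl, -⟩ := (mem_one o).1 h
      exact ⟨r, rfl⟩
    · rintro ⟨r, rfl⟩
      exact ⟨_, _, (tok_one o r).mem, ⟨_, rfl⟩, rfl⟩
  have hlt : ∀ r r' : Fin I.m, I.pos o [1, 1, (r + 1 : ℕ), size (I.V I.one r)] <
      I.pos o [1, 1, (r' + 1 : ℕ), size (I.V I.one r')] ↔ r < r' := by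
    intro r r'
    rw [pos, pos, (sorted_coded o).pos_lt_pos (tok_one o r).mem (tok_one o r').mem]
    constructor
    · intro h
      simp only [List.cons_lt_cons_iff, lt_irrefl, true_and, false_or] at h
      obtain h | ⟨h, h'⟩ := h
      · exact Fin.lt_def.2 (by omega)
      · have : r = r' := Fin.ext (by omega)
        simp [this] at h'
    · intro h
      rw [Fin.lt_def] at h
      simp [List.cons_lt_cons_iff, h]
  constructor
  · rintro ⟨x, -, y, -, hx, hy, hxy, hq, hp⟩
    obtain ⟨r, rfl⟩ := (hone _).1 hx
    obtain ⟨r', rfl⟩ := (hone _).1 hy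
    refine ⟨_, _, (denotes_iff o (tok_one o r)).1 hq, (denotes_iff o (tok_one o r')).1 hp, ?_⟩
    simpa [Vote.Prefers] using (hlt _ _).1 hxy
  · rintro ⟨c, d, rfl, rfl, h⟩
    refine ⟨_, (sorted_coded o).pos_lt (tok_one o ((I.V I.one).symm c)).mem, _,
      (sorted_coded o).pos_lt (tok_one o ((I.V I.one).symm d)).mem, (hone _).2 ⟨_, rfl⟩,
      (hone _).2 ⟨_, rfl⟩, (hlt _ _).2 h, (denotes_iff o (tok_one o _)).2 ?_,
      (denotes_iff o (tok_one o _)).2 ?_⟩ <;> simp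

/-! ### Ballots -/

variable (I) in
/-- The vote `v`, cast by the voter `i` sincerely or as one of his strategies, has the key `k`. -/
def Keyed (i : Fin I.n) (k : List ℕ) (v : Vote I.m) : Prop :=
  (i ≠ I.one ∧ k = [1, (i + 1 : ℕ)] ∧ v = I.V i) ∨
    ∃ j : Fin (I.A i).length, k = [2, (i + 1 : ℕ), (j + 1 : ℕ)] ∧ v = (I.A i)[j]

variable {i i' : Fin I.n} {v v' : Vote I.m}

theorem Keyed.unique (h : I.Keyed i k v) (h' : I.Keyed i' k v') : i = i' ∧ v = v' := by
  obtain ⟨-, rfl, rfl⟩ | ⟨j, rfl, rfl⟩ := h <;> obtain ⟨-, e, rfl⟩ | ⟨j', e, rfl⟩ := h'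
  · simp only [List.cons.injEq, and_true, true_and, Nat.add_right_cancel_iff] at e
    obtain rfl := Fin.ext e
    exact ⟨rfl, rfl⟩
  · simp at e
  · simp at e
  · simp only [List.cons.injEq, and_true, true_and, Nat.add_right_cancel_iff] at e
    obtain rfl := Fin.ext e.1
    obtain rfl := Fin.ext e.2
    exact ⟨rfl, rfl⟩

/-- Neither key is a proper prefix of the other, so the comparison is decided before the suffixes
are reached. -/
theorem Keyed.append_lt (h : I.Keyed i k v) (h' : I.Keyed i' k' v') (hk : k < k') (l l' : List ℕ) :
    k ++ l < k' ++ l' := by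
  obtain ⟨-, rfl, rfl⟩ | ⟨j, rfl, rfl⟩ := h <;> obtain ⟨-, rfl, rfl⟩ | ⟨j', rfl, rfl⟩ := h' <;>
    simp only [List.cons_lt_cons_iff, List.cons_append, List.nil_append] at hk ⊢
  · simp only [List.lt_irrefl, and_false, or_false] at hk
    tauto
  · simp
  · simp at hk
  · simp only [List.lt_irrefl, and_false, or_false] at hk
    tauto

theorem at_isBra {x : ℕ} :
    At (I.word o) IsBra x ↔ ∃ i k v, I.Keyed i k v ∧ x = I.pos o (k ++ [0]) := by
  rw [at_iff]
  constructor
  · rintro ⟨k, s, h, rfl | rfl, rfl⟩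
    · obtain ⟨i, hi, rfl⟩ := (mem_voterBra o).1 h
      exact ⟨i, [1, (i + 1 : ℕ)], _, Or.inl ⟨hi, rfl, rfl⟩, rfl⟩
    · obtain ⟨i, j, rfl⟩ := (mem_ballotBra o).1 h
      exact ⟨i, [2, (i + 1 : ℕ), (j + 1 : ℕ)], _, Or.inr ⟨j, rfl, rfl⟩, rfl⟩
  · rintro ⟨i, _, _, ⟨hi, rfl, rfl⟩ | ⟨j, rfl, rfl⟩, rfl⟩
    · exact ⟨_, _, (mem_voterBra o).2 ⟨i, hi, rfl⟩, Or.inl rfl, rfl⟩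
    · exact ⟨_, _, (mem_ballotBra o).2 ⟨i, j, rfl⟩, Or.inr rfl, rfl⟩

theorem Keyed.mem (h : I.Keyed i k v) : ∃ s, (k ++ [0], s) ∈ codedInstance I o := by
  obtain ⟨hi, rfl, rfl⟩ | ⟨j, rfl, rfl⟩ := h
  · exact ⟨_, (mem_voterBra o).2 ⟨i, hi, rfl⟩⟩
  · exact ⟨_, (mem_ballotBra o).2 ⟨i, j, rfl⟩⟩

theorem Keyed.tok (h : I.Keyed i k v) {r : Fin I.m} (hr : (r : ℕ) < 2) : ∃ s, IsTop s ∧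
    (codedInstance I o).Tok (k ++ [(r + 1 : ℕ), size (v r)]) s (encodeNat (v r)) := by
  obtain ⟨hi, rfl, rfl⟩ | ⟨j, rfl, rfl⟩ := h
  · exact ⟨_, Or.inl rfl, tok_voterTop o hi hr⟩
  · exact ⟨_, Or.inr rfl, tok_ballotTop o hr⟩

theorem at_isTop {x : ℕ} : At (I.word o) IsTop x ↔ ∃ i k v, I.Keyed i k v ∧
    ∃ r : Fin I.m, (r : ℕ) < 2 ∧ x = I.pos o (k ++ [(r + 1 : ℕ), size (v r)]) := by
  constructor
  · intro h
    rw [at_iff] at h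
    obtain ⟨k, s, h, rfl | rfl, rfl⟩ := h
    · obtain ⟨i, hi, r, rfl, hr⟩ := (mem_voterTop o).1 h
      exact ⟨i, [1, (i + 1 : ℕ)], _, Or.inl ⟨hi, rfl, rfl⟩, r, hr, rfl⟩
    · obtain ⟨i, j, r, rfl, hr⟩ := (mem_ballotTop o).1 h
      exact ⟨i, [2, (i + 1 : ℕ), (j + 1 : ℕ)], _, Or.inr ⟨j, rfl, rfl⟩, r, hr, rfl⟩
  · rintro ⟨i, k, v, h, r, hr, rfl⟩
    obtain ⟨s, hs, h⟩ := h.tok o hr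
    exact (at_iff o).2 ⟨_, s, h.mem, hs, rfl⟩

/-- A top candidate belongs to the vote that begins at `b` iff it comes later and no other vote
begins in between. This is why all sincere votes are keyed, even those that are not ballots. -/
theorem approves_iff (h : I.Keyed i k v) {z : ℕ} :
    Approves (I.word o) (I.pos o (k ++ [0])) z ↔ ∃ c ∈ v.top 2, z = I.cand o c := by
  have hW := sorted_coded o
  obtain ⟨s₀, hs₀⟩ := h.mem o
  rw [Vote.exists_mem_top]
  constructor
  · rintro ⟨x, -, hlt, hx, hbra, hz⟩
    obtain ⟨i', k', v', h', r, hr, rfl⟩ := (at_isTop o).1 hx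
    obtain ⟨s, -, ht⟩ := h'.tok o hr
    obtain ⟨s₁, hs₁⟩ := h'.mem o
    have hk : k = k' := by
      rw [pos, pos, hW.pos_lt_pos hs₀ ht.mem] at hlt
      obtain hk | hk | hk := lt_trichotomy k k'
      · refine (hbra (I.pos o (k' ++ [0])) (hW.pos_lt hs₁) ?_ ?_
          ((at_isBra o).2 ⟨_, _, _, h', rfl⟩)).elim
        · exact (hW.pos_lt_pos hs₀ hs₁).2 (h.append_lt h' hk _ _)
        · refine (hW.pos_lt_pos hs₁ ht.mem).2 ?_
          rw [append_lt_append_iff]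
          exact cons_lt_cons_of_lt (by omega) _ _
      · exact hk
      · exact (lt_asymm hlt (h'.append_lt h hk _ _)).elim
    subst hk
    obtain ⟨-, rfl⟩ := h.unique h'
    exact ⟨r, hr, (denotes_iff o ht).1 hz⟩
  · rintro ⟨r, hr, hz⟩
    obtain ⟨s, hs, ht⟩ := h.tok o hr
    refine ⟨_, hW.pos_lt ht.mem, (hW.pos_lt_pos hs₀ ht.mem).2 ?_, (at_iff o).2
      ⟨_, s, ht.mem, hs, rfl⟩, ?_, (denotes_iff o ht).2 hz⟩
    · rw [append_lt_append_iff]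
      exact cons_lt_cons_of_lt (by omega) _ _
    · intro t _ h1 h2 hbra
      obtain ⟨i', k', v', h', rfl⟩ := (at_isBra o).1 hbra
      obtain ⟨s₁, hs₁⟩ := h'.mem o
      replace h1 := (hW.pos_lt_pos hs₀ hs₁).1 h1
      replace h2 := (hW.pos_lt_pos hs₁ ht.mem).1 h2
      obtain hk | rfl | hk := lt_trichotomy k k'
      · exact lt_asymm h2 (h.append_lt h' hk _ _)
      · exact lt_irrefl _ h1
      · exact lt_asymm h1 (h'.append_lt h hk _ _)

end Instance

end GSVoting

/-! ### Voters, ballots and thresholds in the word -/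

namespace GSVoting

open Computability (encodeNat)
open StackProg Coded Finset Function
open StackProg.Formula (count)

variable {k k' : List ℕ} {s s' : Tag}

theorem count_eq_of_image {ι : Type*} {N : ℕ} {P : ℕ → Prop} {J : Finset ι} {f : ι → ℕ}
    (hf : Set.InjOn f J) (h : ∀ x, (x < N ∧ P x) ↔ ∃ i ∈ J, x = f i) : count N P = #J := by
  classical
  rw [count_eq_card, ← card_image_of_injOn hf]
  congr 1
  ext x
  rw [mem_filter, Finset.mem_range, h, mem_image]
  simp only [eq_comm]

namespace Instance

open Tag

variable {I : Instance} (o : Option (Vote I.m)) {i i' : Fin I.n} {v v' : Vote I.m}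

theorem strategies_one : I.A I.one = [] :=
  I.not_listed _ fun h => h.2 rfl

/-- The end of the list of strategies of the voter `i`. -/
theorem mem_end (i : Fin I.n) :
    ([2, (i + 1 : ℕ), (I.A i).length + 1], .listKet (I.A i).isEmpty) ∈ codedInstance I o :=
  (mem_listKet o).2 ⟨i, rfl, rfl⟩

theorem at_isListKet {x : ℕ} : At (I.word o) IsListKet x ↔
    ∃ i : Fin I.n, x = I.pos o [2, (i + 1 : ℕ), (I.A i).length + 1] := by
  rw [at_iff]
  constructor
  · rintro ⟨k, s, h, ⟨b, rfl⟩, rfl⟩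
    obtain ⟨i, rfl, -⟩ := (mem_listKet o).1 h
    exact ⟨i, rfl⟩
  · rintro ⟨i, rfl⟩
    exact ⟨_, _, mem_end o i, ⟨_, rfl⟩, rfl⟩

theorem end_lt_end : I.pos o [2, (i + 1 : ℕ), (I.A i).length + 1] <
    I.pos o [2, (i' + 1 : ℕ), (I.A i').length + 1] ↔ i < i' := by
  rw [pos, pos, (sorted_coded o).pos_lt_pos (mem_end o i) (mem_end o i'), Fin.lt_def]
  simp only [List.cons_lt_cons_iff, lt_irrefl, true_and, false_or, Nat.add_lt_add_iff_right,
    Nat.add_right_cancel_iff, and_false, or_false]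
  constructor
  · rintro (h | ⟨h, h'⟩)
    · exact h
    · rw [Fin.ext h] at h'
      exact (lt_irrefl _ h').elim
  · exact Or.inl

theorem end_injective :
    Injective fun i : Fin I.n => I.pos o [2, (i + 1 : ℕ), (I.A i).length + 1] := by
  intro i i' h
  have h1 := end_lt_end o (i := i) (i' := i')
  have h2 := end_lt_end o (i := i') (i' := i)
  simp only at h
  simp only [h, lt_irrefl, false_iff, not_lt] at h1 h2
  exact le_antisymm h2 h1

theorem mem_begin (hi : i ≠ I.one) : ([1, (i + 1 : ℕ), 0], .voterBra) ∈ codedInstance I o :=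
  (mem_voterBra o).2 ⟨i, hi, rfl⟩

theorem at_voterBra {x : ℕ} : At (I.word o) (· = .voterBra) x ↔
    ∃ i : Fin I.n, i ≠ I.one ∧ x = I.pos o [1, (i + 1 : ℕ), 0] := by
  rw [at_eq_iff]
  constructor
  · rintro ⟨k, h, rfl⟩
    obtain ⟨i, hi, rfl⟩ := (mem_voterBra o).1 h
    exact ⟨i, hi, rfl⟩
  · rintro ⟨i, hi, rfl⟩
    exact ⟨_, mem_begin o hi, rfl⟩

theorem begin_le_begin (hi : i ≠ I.one) (hi' : i' ≠ I.one) :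
    I.pos o [1, (i + 1 : ℕ), 0] ≤ I.pos o [1, (i' + 1 : ℕ), 0] ↔ i ≤ i' := by
  rw [← not_lt, ← not_lt, pos, pos,
    (sorted_coded o).pos_lt_pos (mem_begin o hi') (mem_begin o hi), Fin.lt_def]
  simp [List.cons_lt_cons_iff]

theorem begin_injective (hi : i ≠ I.one) (hi' : i' ≠ I.one)
    (h : I.pos o [1, (i + 1 : ℕ), 0] = I.pos o [1, (i' + 1 : ℕ), 0]) : i = i' :=
  le_antisymm ((begin_le_begin o hi hi').1 h.le) ((begin_le_begin o hi' hi).1 h.ge)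

/-- The first voter has no `voterBra`, so the votes that begin no later than that of the voter `i`
number exactly `i`; so do the lists that end before his. Equal counts pair each vote with its list
of strategies. -/
theorem fixed_iff {x : ℕ} : Fixed (I.word o) x ↔
    ∃ i, i ≠ I.one ∧ I.A i = [] ∧ x = I.pos o [1, (i + 1 : ℕ), 0] := by
  have h1 : ∀ i, i ≠ I.one → count (I.word o).length (fun t => At (I.word o) (· = .voterBra) t ∧
      t ≤ I.pos o [1, (i + 1 : ℕ), 0]) = i := by
    intro i hi
    have : #(Ioc I.one i) = (i : ℕ) := by
      rw [Fin.card_Ioc]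
      simp [one]
    conv_rhs => rw [← this]
    refine count_eq_of_image (f := fun j : Fin I.n => I.pos o [1, (j + 1 : ℕ), 0]) ?_ fun x => ?_
    · intro j hj j' hj'
      rw [mem_coe, mem_Ioc] at hj hj'
      exact begin_injective o hj.1.ne' hj'.1.ne'
    · constructor
      · rintro ⟨-, hx, hle⟩
        obtain ⟨j, hj, rfl⟩ := (at_voterBra o).1 hx
        rw [begin_le_begin o hj hi] at hle
        refine ⟨j, mem_Ioc.2 ⟨lt_of_le_of_ne ?_ hj.symm, hle⟩, rfl⟩
        rw [Fin.le_def]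
        exact Nat.zero_le _
      · rintro ⟨j, hj, rfl⟩
        rw [mem_Ioc] at hj
        exact ⟨(sorted_coded o).pos_lt (mem_begin o hj.1.ne'),
          (at_voterBra o).2 ⟨j, hj.1.ne', rfl⟩, (begin_le_begin o hj.1.ne' hi).2 hj.2⟩
  have h2 : ∀ i : Fin I.n, count (I.word o).length (fun t => At (I.word o) IsListKet t ∧
      t < I.pos o [2, (i + 1 : ℕ), (I.A i).length + 1]) = i := by
    intro i
    have : #(Iio i) = (i : ℕ) := Fin.card_Iio i
    conv_rhs => rw [← this]
    refine count_eq_of_image ((end_injective o).injOn) fun x => ?_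
    constructor
    · rintro ⟨-, hx, hlt⟩
      obtain ⟨j, rfl⟩ := (at_isListKet o).1 hx
      exact ⟨j, mem_Iio.2 ((end_lt_end o).1 hlt), rfl⟩
    · rintro ⟨j, hj, rfl⟩
      exact ⟨(sorted_coded o).pos_lt (mem_end o j), (at_isListKet o).2 ⟨j, rfl⟩,
        (end_lt_end o).2 (mem_Iio.1 hj)⟩
  constructor
  · rintro ⟨hx, y, -, hy, hcount⟩
    obtain ⟨i, hi, rfl⟩ := (at_voterBra o).1 hx
    obtain ⟨k, hk, rfl⟩ := (at_eq_iff o).1 hy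
    obtain ⟨j, rfl, hj⟩ := (mem_listKet o).1 hk
    rw [h1 i hi, h2 j] at hcount
    obtain rfl := Fin.ext hcount
    exact ⟨i, hi, List.isEmpty_iff.1 hj.symm, rfl⟩
  · rintro ⟨i, hi, hA, rfl⟩
    have hk : I.pos o [2, (i + 1 : ℕ), (I.A i).length + 1] < (I.word o).length :=
      (sorted_coded o).pos_lt (mem_end o i)
    refine ⟨(at_voterBra o).2 ⟨i, hi, rfl⟩, _, hk, (at_eq_iff o).2 ⟨_, ?_, rfl⟩, ?_⟩
    · exact (mem_listKet o).2 ⟨i, rfl, by simp [hA]⟩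
    · rw [h1 i hi, h2 i]

variable (I) in
/-- The vote `v` of the voter `i`, if he has no strategies, or his strategy `v` has the key `k`. -/
def Cast (i : Fin I.n) (k : List ℕ) (v : Vote I.m) : Prop :=
  (i ≠ I.one ∧ I.A i = [] ∧ k = [1, (i + 1 : ℕ)] ∧ v = I.V i) ∨
    ∃ j : Fin (I.A i).length, k = [2, (i + 1 : ℕ), (j + 1 : ℕ)] ∧ v = (I.A i)[j]

theorem Cast.keyed (h : I.Cast i k v) : I.Keyed i k v :=
  h.imp (fun h => ⟨h.1, h.2.2⟩) id

theorem Cast.ne_one (h : I.Cast i k v) : i ≠ I.one := by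
  obtain ⟨h, -⟩ | ⟨j, -⟩ := h
  · exact h
  · rintro rfl
    have := j.2
    simp [strategies_one] at this

theorem Keyed.eq_of_pos (h : I.Keyed i k v) (h' : I.Keyed i' k' v')
    (hk : I.pos o (k ++ [0]) = I.pos o (k' ++ [0])) : k = k' := by
  obtain ⟨s, hs⟩ := h.mem o
  obtain ⟨s', hs'⟩ := h'.mem o
  exact List.append_cancel_right (((sorted_coded o).pos_inj hs hs').1 hk)

theorem ballot_iff {x : ℕ} :
    Ballot (I.word o) x ↔ ∃ i k v, I.Cast i k v ∧ x = I.pos o (k ++ [0]) := by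
  rw [Ballot, fixed_iff, at_eq_iff]
  constructor
  · rintro (⟨k, h, rfl⟩ | ⟨i, hi, hA, rfl⟩)
    · obtain ⟨i, j, rfl⟩ := (mem_ballotBra o).1 h
      exact ⟨i, [2, (i + 1 : ℕ), (j + 1 : ℕ)], _, Or.inr ⟨j, rfl, rfl⟩, rfl⟩
    · exact ⟨i, [1, (i + 1 : ℕ)], _, Or.inl ⟨hi, hA, rfl, rfl⟩, rfl⟩
  · rintro ⟨i, _, _, ⟨hi, hA, rfl, rfl⟩ | ⟨j, rfl, rfl⟩, rfl⟩
    · exact Or.inr ⟨i, hi, hA, rfl⟩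
    · exact Or.inl ⟨_, (mem_ballotBra o).2 ⟨i, j, rfl⟩, rfl⟩

variable (I) in
/-- A position that represents the voter `i`: the beginning of his vote, or the end of the previous
list of strategies. -/
def own (i : Fin I.n) : ℕ :=
  if I.A i = [] then I.pos o [1, (i + 1 : ℕ), 0] else
    I.pos o [2, ((Order.pred i : Fin I.n) + 1 : ℕ), (I.A (Order.pred i)).length + 1]

theorem end_lt_ballot {j : Fin (I.A i).length} :
    I.pos o [2, (i' + 1 : ℕ), (I.A i').length + 1] < I.pos o [2, (i + 1 : ℕ), (j + 1 : ℕ), 0] ↔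
      i' < i := by
  rw [pos, pos, (sorted_coded o).pos_lt_pos (mem_end o i') ((mem_ballotBra o).2 ⟨i, j, rfl⟩),
    Fin.lt_def]
  simp only [List.cons_lt_cons_iff, lt_irrefl, true_and, false_or, Nat.add_lt_add_iff_right,
    Nat.add_right_cancel_iff]
  constructor
  · rintro (h | ⟨h, h'⟩)
    · exact h
    · obtain rfl := Fin.ext h
      have := j.2
      omega
  · exact Or.inl

theorem pred_lt (hi : i ≠ I.one) : Order.pred i < i := by
  refine Order.pred_lt_of_not_isMin fun h => hi (le_antisymm (h ?_) ?_) <;>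
    exact Fin.le_def.2 (Nat.zero_le _)

/-- The two kinds of positions lie in different parts of the word. Within the second kind, the
predecessor determines the voter because neither is the first. -/
theorem own_injective : Injective fun i : {i : Fin I.n // i ≠ I.one} => I.own o i := by
  rintro ⟨i, hi⟩ ⟨i', hi'⟩ h
  simp only [own] at h
  congr 1
  split_ifs at h
  · exact begin_injective o hi hi' h
  · have := ((sorted_coded o).pos_inj (mem_begin o hi) (mem_end o _)).1 h
    simp at this
  · have := ((sorted_coded o).pos_inj (mem_end o _) (mem_begin o hi')).1 h
    simp at this
  · have := end_injective o h
    have h1 := pred_lt hi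
    have h2 := pred_lt hi'
    by_contra hne
    obtain hlt | hlt := lt_or_gt_of_ne hne
    · exact absurd (Order.le_pred_of_lt hlt) (by rw [← this]; exact not_le.2 h1)
    · exact absurd (Order.le_pred_of_lt hlt) (by rw [this]; exact not_le.2 h2)

theorem own_lt (hi : i ≠ I.one) : I.own o i < I.pos o [2, (i + 1 : ℕ), (I.A i).length + 1] := by
  unfold own
  split_ifs
  · exact ((sorted_coded o).pos_lt_pos (mem_begin o hi) (mem_end o i)).2
      (cons_lt_cons_of_lt (by omega) _ _)
  · exact (end_lt_end o).2 (pred_lt hi)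

/-- The list ends before a strategy of `i` are those of the voters before `i`; the last of them is
`own i`. -/
theorem late_iff (h : I.Cast i k v) {z : ℕ} :
    Late (I.word o) (I.pos o (k ++ [0])) z ↔ z ≤ I.own o i := by
  have hW := sorted_coded o
  have hi := h.ne_one
  have tag : ∀ {k s p}, (k, s) ∈ codedInstance I o → (At (I.word o) p (I.pos o k) ↔ p s) :=
    fun h => tags_at_iff (hW.getElem?_pos h)
  obtain ⟨-, hA, rfl, rfl⟩ | ⟨j, rfl, rfl⟩ := h
  · have hm := mem_begin o hi
    simp only [List.cons_append, List.nil_append, Late, tag hm, own, hA, if_true, true_and,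
      reduceCtorEq, false_and, or_false]
  · have hm : ([2, (i + 1 : ℕ), (j + 1 : ℕ), 0], .ballotBra) ∈ codedInstance I o :=
      (mem_ballotBra o).2 ⟨i, j, rfl⟩
    have hA : I.A i ≠ [] := by
      intro hA
      have := j.2
      simp [hA] at this
    simp only [List.cons_append, List.nil_append, Late, tag hm, own, hA, if_false, true_and,
      reduceCtorEq, false_and, false_or]
    constructor
    · rintro ⟨y, -, hy, hz, hlt⟩
      obtain ⟨i', rfl⟩ := (at_isListKet o).1 hy
      have := Order.le_pred_of_lt ((end_lt_ballot o).1 hlt)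
      refine hz.trans (not_lt.1 fun h => ?_)
      exact absurd ((end_lt_end o).1 h) (not_lt.2 this)
    · intro hz
      exact ⟨_, hW.pos_lt (mem_end o _), (at_isListKet o).2 ⟨_, rfl⟩, hz,
        (end_lt_ballot o).2 (pred_lt hi)⟩

/-- Using `own i` and `own i'` themselves as thresholds shows that ballots which no threshold
separates have the same `own`, hence the same voter. -/
theorem same_iff {x y : ℕ} : Same (I.word o) x y ↔ ∃ i,
    (∃ k v, I.Cast i k v ∧ x = I.pos o (k ++ [0])) ∧
      ∃ k v, I.Cast i k v ∧ y = I.pos o (k ++ [0]) := by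
  rw [Same, ballot_iff, ballot_iff]
  constructor
  · rintro ⟨⟨i, k, v, h, rfl⟩, ⟨i', k', v', h', rfl⟩, hl⟩
    refine ⟨i, ⟨k, v, h, rfl⟩, k', v', ?_, rfl⟩
    have hlt : I.own o i < (I.word o).length :=
      (own_lt o h.ne_one).trans ((sorted_coded o).pos_lt (mem_end o i))
    have hlt' : I.own o i' < (I.word o).length :=
      (own_lt o h'.ne_one).trans ((sorted_coded o).pos_lt (mem_end o i'))
    have h1 := hl _ hlt
    have h2 := hl _ hlt'
    rw [late_iff o h, late_iff o h'] at h1 h2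
    have := own_injective o (a₁ := ⟨i, h.ne_one⟩) (a₂ := ⟨i', h'.ne_one⟩)
      (le_antisymm (h1.1 le_rfl) (h2.2 le_rfl))
    rw [Subtype.mk.injEq] at this
    rwa [this]
  · rintro ⟨i, ⟨k, v, h, rfl⟩, k', v', h', rfl⟩
    refine ⟨⟨i, k, v, h, rfl⟩, ⟨i, k', v', h', rfl⟩, fun z _ => ?_⟩
    rw [late_iff o h, late_iff o h']

/-! ### The length of the word -/

theorem length_block {n : ℕ} {a z : Tag} {g : Fin n → Coded} :
    (block a z g).length = ∑ i, (g i).length + 2 := by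
  simp [block, pre, List.length_flatten, List.sum_ofFn, Function.comp_def]

theorem size_pos {m : ℕ} {c : Fin m} (hc : (c : ℕ) ≠ 0) : 0 < size c := by
  rw [size, List.length_pos_iff]
  intro h
  exact hc (encodeNat_injective (h.trans (by rfl : [] = encodeNat 0)))

/-- The candidate `0` has the empty code and takes one symbol, every other candidate at least two,
and there are two brackets. -/
theorem le_length_codedVote {m : ℕ} {a : Tag} {f : ℕ → Tag} (v : Vote m) :
    2 * m + 1 ≤ (codedVote a f v).length := by
  have h1 : ∀ r, (token (encodeNat (v r)) (f r)).length = size (v r) + 1 := by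
    intro r
    simp [token, size]
  rw [codedVote, length_block]
  simp only [h1]
  rw [Equiv.sum_comp v fun c => size c + 1]
  cases m with
  | zero => simp
  | succ m =>
    have h2 : ∑ c : Fin m, 2 ≤ ∑ c : Fin m, (size c.succ + 1) :=
      sum_le_sum fun c _ => by
        have := size_pos (c := c.succ) (by simp)
        omega
    rw [Fin.sum_univ_succ]
    simp only [sum_const, card_univ, Fintype.card_fin, smul_eq_mul] at h2
    omega

/-- The tie-breaking order and the `n` sincere votes already give this length, which exceeds the
number of moves that the algorithm may need. -/
theorem le_length_word : (I.n + 1) * (2 * I.m + 1) ≤ (I.word o).length := by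
  have h1 : ∀ i, 2 * I.m + 1 ≤ (codedSincere I i).length := by
    intro i
    unfold codedSincere
    split_ifs <;> exact le_length_codedVote _
  have h2 : ∑ i : Fin I.n, (2 * I.m + 1) ≤ ∑ i, (codedSincere I i).length :=
    sum_le_sum fun i _ => h1 i
  have h3 : 2 * I.m + 1 ≤ (codedVote .other (fun _ => .tie) I.tie).length := le_length_codedVote _
  simp only [sum_const, card_univ, Fintype.card_fin, smul_eq_mul] at h2
  simp only [word, length_tags, codedInstance, List.length_append, Coded.pre, List.length_map,
    length_block (g := codedSincere I)]
  rw [Nat.succ_mul]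
  omega

end Instance

end GSVoting

/-! ### The selection problem posed by an instance -/

namespace GSVoting

open StackProg Coded Finset Function

namespace Instance

open Tag

/-- The strategies of a voter have approved candidates in common. -/
def Overlap (I : Instance) : Prop :=
  ∀ i, ∀ v ∈ I.A i, ∀ v' ∈ I.A i, ∃ c ∈ v.top 2, c ∈ v'.top 2

/-- The votes that the voter `i` may cast. -/
def options (I : Instance) (i : Fin I.n) : Set (Vote I.m) :=
  {v | (I.A i = [] ∧ v = I.V i) ∨ v ∈ I.A i}

variable {I : Instance} (o : Option (Vote I.m)) {i i' : Fin I.n} {v v' : Vote I.m}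
  {k k' : List ℕ}

theorem exists_cast (hi : i ≠ I.one) : (∃ k, I.Cast i k v) ↔ v ∈ I.options i := by
  constructor
  · rintro ⟨_, ⟨-, hA, rfl, rfl⟩ | ⟨j, rfl, rfl⟩⟩
    · exact Or.inl ⟨hA, rfl⟩
    · exact Or.inr (List.getElem_mem _)
  · rintro (⟨hA, rfl⟩ | h)
    · exact ⟨_, Or.inl ⟨hi, hA, rfl, rfl⟩⟩
    · obtain ⟨j, hj, rfl⟩ := List.mem_iff_getElem.1 h
      exact ⟨_, Or.inr ⟨⟨j, hj⟩, rfl, rfl⟩⟩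

theorem Overlap.options (h : I.Overlap) (hv : v ∈ I.options i) (hv' : v' ∈ I.options i) :
    ∃ c ∈ v.top 2, c ∈ v'.top 2 := by
  obtain ⟨hA, rfl⟩ | hv := hv
  · obtain ⟨-, rfl⟩ | hv' := hv'
    · have : (I.V i |>.top 2).Nonempty := by
        rw [← card_pos, Vote.card_top I.hm.le]
        omega
      obtain ⟨c, hc⟩ := this
      exact ⟨c, hc, hc⟩
    · simp [hA] at hv'
  · obtain ⟨hA, -⟩ | hv' := hv'
    · simp [hA] at hv
    · exact h i v hv v' hv'

/-- The other voters than the first one. -/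
abbrev Other (I : Instance) : Type := {i : Fin I.n // i ≠ I.one}

variable (I) in
open Classical in
/-- The positions of the candidates that are approved by the ballot at the position `x`. -/
noncomputable def approved (x : ℕ) : Finset ℕ :=
  (univ.image (I.cand o)).filter (Approves (I.word o) x)

variable (I) in
open Classical in
/-- The positions of the ballots of the voter `i`. -/
noncomputable def ballotsOf (i : Fin I.n) : Finset ℕ :=
  (range (I.word o).length).filter fun x => ∃ k v, I.Cast i k v ∧ x = I.pos o (k ++ [0])

open Classical in
theorem mem_ballotsOf {x : ℕ} :
    x ∈ I.ballotsOf o i ↔ ∃ k v, I.Cast i k v ∧ x = I.pos o (k ++ [0]) := by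
  rw [ballotsOf, mem_filter, Finset.mem_range, and_iff_right_iff_imp]
  rintro ⟨k, v, h, rfl⟩
  obtain ⟨s, hs⟩ := h.keyed.mem o
  exact (sorted_coded o).pos_lt hs

open Classical in
theorem approved_eq (h : I.Cast i k v) :
    I.approved o (I.pos o (k ++ [0])) = (v.top 2).image (I.cand o) := by
  ext z
  rw [approved, mem_filter, approves_iff o h.keyed, mem_image, mem_image]
  constructor
  · rintro ⟨-, c, hc, rfl⟩
    exact ⟨c, hc, rfl⟩
  · rintro ⟨c, hc, rfl⟩
    exact ⟨⟨c, mem_univ _, rfl⟩, c, hc, rfl⟩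

theorem mem_approved (h : I.Cast i k v) {c : Fin I.m} :
    I.cand o c ∈ I.approved o (I.pos o (k ++ [0])) ↔ c ∈ v.top 2 := by
  rw [approved_eq o h, (cand_injective o).mem_finset_image]

open Classical in
/-- The ballots of an instance. -/
noncomputable def ballots (h : I.Overlap) : Ballots I.Other where
  C := univ.image (I.cand o)
  L i := I.ballotsOf o i
  T := I.approved o
  ok _ _ := True
  subset _ _ _ := filter_subset _ _
  card_two i x hx := by
    obtain ⟨k, v, hk, rfl⟩ := (mem_ballotsOf o).1 hx
    rw [approved_eq o hk, card_image_of_injective _ (cand_injective o), Vote.card_top I.hm.le]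
  inter i x hx y hy := by
    obtain ⟨k, v, hk, rfl⟩ := (mem_ballotsOf o).1 hx
    obtain ⟨k', v', hk', rfl⟩ := (mem_ballotsOf o).1 hy
    obtain ⟨c, hc, hc'⟩ := h.options ((exists_cast i.2).1 ⟨k, hk⟩) ((exists_cast i.2).1 ⟨k', hk'⟩)
    exact ⟨_, (mem_approved o hk).2 hc, (mem_approved o hk').2 hc'⟩
  ok_mono _ _ _ _ _ := trivial

theorem cand_lt (c : Fin I.m) : I.cand o c < (I.word o).length :=
  (sorted_coded o).pos_lt (mem_cand o c)

open Classical in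
theorem models (h : I.Overlap) :
    (arena (I.word o)).Models (ballots o h) fun i : I.Other => I.own o i where
  cand c := by
    simp only [arena, ballots, at_tie, mem_image, mem_univ, true_and]
    exact exists_congr fun _ => eq_comm
  same x y := by
    simp only [arena, ballots, same_iff, mem_ballotsOf]
    constructor
    · rintro ⟨i, ⟨k, v, hk, hx⟩, hy⟩
      exact ⟨⟨i, hk.ne_one⟩, ⟨k, v, hk, hx⟩, hy⟩
    · rintro ⟨i, hi⟩
      exact ⟨i, hi⟩
  top i x hx c := by
    obtain ⟨k, v, hk, rfl⟩ := (mem_ballotsOf o).1 hx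
    change Approves _ _ _ ↔ c ∈ I.approved o _
    rw [approved_eq o hk, approves_iff o hk.keyed, mem_image]
    exact exists_congr fun c => and_congr Iff.rfl eq_comm
  late i x hx z := by
    obtain ⟨k, v, hk, rfl⟩ := (mem_ballotsOf o).1 hx
    exact late_iff o hk
  cand_lt c hc := by
    obtain ⟨c, -, rfl⟩ := mem_image.1 hc
    exact cand_lt o c
  ballot_lt i x hx := Finset.mem_range.1 (mem_filter.1 hx).1
  inj i j x hx hy := by
    obtain ⟨k, v, hk, rfl⟩ := (mem_ballotsOf o).1 hx
    obtain ⟨k', v', hk', e⟩ := (mem_ballotsOf o).1 hy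
    obtain rfl := hk.keyed.eq_of_pos o hk'.keyed e
    exact Subtype.ext (hk.keyed.unique hk'.keyed).1
  notMem c hc i hi := by
    obtain ⟨c, -, rfl⟩ := mem_image.1 hc
    obtain ⟨k, v, hk, e⟩ := (mem_ballotsOf o).1 hi
    obtain ⟨s, hs⟩ := hk.keyed.mem o
    have := ((sorted_coded o).pos_inj (mem_cand o c) hs).1 e
    obtain ⟨-, -, rfl, -⟩ | ⟨j, rfl, -⟩ := hk <;> simp at this

/-- If the first voter approves `a` and `b`, and the others vote according to `s`, then `c` does not
defeat `p`. -/
def Defends (I : Instance) (s : I.Other → Vote I.m) (a b p c : Fin I.m) : Prop :=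
  #{i | c ∈ (s i).top 2} + (if c = a ∨ c = b then 1 else 0) +
      (if I.tie.symm c < I.tie.symm p then 1 else 0) ≤
    #{i | p ∈ (s i).top 2} + if p = a ∨ p = b then 1 else 0

/-- The correctness of the algorithm, translated from positions back to votes; the size conditions
are met because the word is long. -/
theorem profitable_iff (h : I.Overlap) (a b a' b' : Fin I.m) :
    (arena (I.word o)).Profitable (I.cand o a) (I.cand o b) (I.cand o a') (I.cand o b') ↔
      ∃ s : I.Other → Vote I.m, (∀ i : I.Other, s i ∈ I.options i) ∧ ∃ p q, (I.V I.one).Prefers q p ∧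
        (∀ c, I.Defends s a b p c) ∧ ∀ c, I.Defends s a' b' q c := by
  have hle := le_length_word o
  have hcard : Fintype.card I.Other + 1 = I.n := by
    rw [Fintype.card_subtype_compl, Fintype.card_subtype_eq, Fintype.card_fin]
    have := I.hn
    omega
  have hC : #(ballots o h).C = I.m := by
    rw [ballots, card_image_of_injective _ (cand_injective o), card_univ, Fintype.card_fin]
  have hm := I.hm
  have key := (models o h).profitable_iff (own_injective o) (fun i => ?_) (fun i => ?_) ?_ ?_
    (I.cand o a) (I.cand o b) (I.cand o a') (I.cand o b')
  · rw [key]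
    have score : ∀ (t : I.Other → ℕ) (s : I.Other → Vote I.m),
        (∀ i : I.Other, ∃ k, I.Cast i k (s i) ∧ t i = I.pos o (k ++ [0])) →
        ∀ a b p, (ballots o h).Wins (I.cand o a) (I.cand o b) (I.cand o p) t ↔
          ∀ c, I.Defends s a b p c := by
      intro t s hts a b p
      have hs : ∀ c, (ballots o h).score t (I.cand o c) = #{i | c ∈ (s i).top 2} := by
        intro c
        refine congrArg card (filter_congr fun i _ => ?_)
        obtain ⟨k, hk, e⟩ := hts i
        rw [e]
        exact mem_approved o hk
      have hmem : ∀ {P : ℕ → Prop}, (∀ c ∈ (ballots o h).C, P c) ↔ ∀ c, P (I.cand o c) := by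
        intro P
        simp [ballots]
      rw [Ballots.Wins, hmem]
      refine forall_congr' fun c => ?_
      simp only [Target.Bound, Defends, hs, (cand_injective o).eq_iff, cand_lt_cand]
    constructor
    · rintro ⟨t, ht, p, -, q, -, hpref, h1, h2⟩
      obtain ⟨q, p, rfl, rfl, hqp⟩ := (pref_iff o).1 hpref
      have : ∀ i : I.Other, ∃ v k, I.Cast i k v ∧ t i = I.pos o (k ++ [0]) := by
        intro i
        obtain ⟨k, v, hk⟩ := (mem_ballotsOf o).1 (ht i)
        exact ⟨v, k, hk⟩
      choose s hs using this
      refine ⟨s, fun i => ?_, p, q, hqp, (score t s hs _ _ _).1 h1, (score t s hs _ _ _).1 h2⟩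
      obtain ⟨k, hk, -⟩ := hs i
      exact (exists_cast i.2).1 ⟨k, hk⟩
    · rintro ⟨s, hs, p, q, hpref, h1, h2⟩
      choose k hk using fun i : I.Other => (exists_cast i.2).2 (hs i)
      have := score (fun i => I.pos o (k i ++ [0])) s fun i => ⟨k i, hk i, rfl⟩
      refine ⟨_, fun i => (mem_ballotsOf o).2 ⟨k i, s i, hk i, rfl⟩, I.cand o p,
        mem_image_of_mem _ (mem_univ _), I.cand o q, mem_image_of_mem _ (mem_univ _),
        (pref_iff o).2 ⟨q, p, rfl, rfl, hpref⟩, (this _ _ _).2 h1, (this _ _ _).2 h2⟩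
  · have h1 := own_lt o i.2
    have h2 : I.pos o _ < (I.word o).length := (sorted_coded o).pos_lt (mem_end o i)
    exact lt_of_le_of_lt h1 h2
  · obtain ⟨v, hv⟩ : ∃ v, v ∈ I.options i := by
      by_cases hA : I.A i = []
      · exact ⟨_, Or.inl ⟨hA, rfl⟩⟩
      · obtain ⟨v, hv⟩ := List.exists_mem_of_ne_nil _ hA
        exact ⟨v, Or.inr hv⟩
    obtain ⟨k, hk⟩ := (exists_cast i.2).2 hv
    exact ⟨_, (mem_ballotsOf o).2 ⟨k, v, hk, rfl⟩⟩
  · change _ < (I.word o).length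
    nlinarith
  -- The bound on the moves is `(2 * (n - 1) + 1) * m`, as the first voter is not counted; it lies
  -- below `(n + 1) * (2 * m + 1)`.
  · change _ < (I.word o).length
    rw [hC]
    nlinarith

end Instance

end GSVoting

/-! ### Manipulation under 2-approval -/

namespace GSVoting

open Finset Function

namespace Vote

variable {m : ℕ} {v : Vote m} {a b c d : Fin m}

theorem exists_top_eq (hm : 2 < m) (hab : a ≠ b) : ∃ v : Vote m, v.top 2 = {a, b} := by
  let z : Fin m := ⟨0, by omega⟩
  let o : Fin m := ⟨1, by omega⟩
  have hzo : z ≠ o := by simp [z, o]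
  let σ : Vote m := Equiv.swap z a
  have hσ : σ z = a := Equiv.swap_apply_left _ _
  have hne : σ o ≠ a := fun h => hzo (σ.injective (hσ.trans h.symm))
  -- The first transposition puts `a` on top; the second brings `b` to the second place without
  -- touching `a`.
  refine ⟨σ.trans (Equiv.swap (σ o) b), ?_⟩
  have h0 : (σ.trans (Equiv.swap (σ o) b)) z = a := by
    rw [Equiv.trans_apply, hσ, Equiv.swap_apply_of_ne_of_ne hne.symm hab]
  have h1 : (σ.trans (Equiv.swap (σ o) b)) o = b := by
    rw [Equiv.trans_apply, Equiv.swap_apply_left]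
  symm
  refine eq_of_subset_of_card_le ?_ ?_
  · intro c hc
    rw [mem_insert, mem_singleton] at hc
    rw [mem_top]
    obtain rfl | rfl := hc
    · rw [(Equiv.symm_apply_eq _).2 h0.symm]
      simp [z]
    · rw [(Equiv.symm_apply_eq _).2 h1.symm]
      simp [o]
  · rw [card_top hm.le, card_pair hab]

theorem exists_eq_top (hm : 2 < m) (v : Vote m) : ∃ a b, a ≠ b ∧ v.top 2 = {a, b} :=
  card_eq_two.1 (card_top hm.le v)

theorem top_eq (hm : 2 < m) (ha : a ∈ v.top 2) (hb : b ∈ v.top 2) (hab : a ≠ b) :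
    v.top 2 = {a, b} := by
  symm
  refine eq_of_subset_of_card_le ?_ ?_
  · intro c hc
    rw [mem_insert, mem_singleton] at hc
    obtain rfl | rfl := hc <;> assumption
  · rw [card_top hm.le, card_pair hab]

theorem Prefers.mem_top {k : ℕ} (h : v.Prefers a b) (hb : b ∈ v.top k) : a ∈ v.top k := by
  rw [Vote.mem_top] at *
  exact lt_trans h hb

theorem Prefers.asymm (h : v.Prefers a b) : ¬ v.Prefers b a := lt_asymm h

theorem Prefers.ne (h : v.Prefers a b) : a ≠ b := by
  rintro rfl
  exact lt_irrefl _ h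

theorem Prefers.trans (h : v.Prefers a b) (h' : v.Prefers b c) : v.Prefers a c := lt_trans h h'

theorem prefers_or (h : a ≠ b) : v.Prefers a b ∨ v.Prefers b a :=
  lt_or_gt_of_ne (v.symm.injective.ne h)

end Vote

/-! ### The winner when one voter changes his vote -/

section winner

variable {n m k : ℕ} {hk : k < m} {tie : Vote m} {V : Profile n m} {i : Fin n} {v : Vote m}
  {c p : Fin m}

/-- The number of approvals of `c` by the voters other than `i`. -/
def scoreWithout (k : ℕ) (V : Profile n m) (i : Fin n) (c : Fin m) : ℕ :=
  #{j | j ≠ i ∧ c ∈ (V j).top k}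

theorem score_eq (i : Fin n) : score k V c = scoreWithout k V i c +
    if c ∈ (V i).top k then 1 else 0 := by
  rw [score, scoreWithout, ← card_filter_add_card_filter_not (p := fun j => j ≠ i), filter_filter,
    filter_filter]
  congr 1
  · congr 1
    ext j
    simp [and_comm]
  · split_ifs with h
    · rw [card_eq_one]
      refine ⟨i, ?_⟩
      ext j
      simp only [mem_filter, mem_univ, true_and, not_not, mem_singleton]
      constructor
      · exact fun h => h.2
      · rintro rfl
        exact ⟨h, rfl⟩
    · rw [card_eq_zero, filter_eq_empty_iff]
      rintro j - ⟨hj, hji⟩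
      rw [not_not] at hji
      exact h (hji ▸ hj)

theorem score_update : score k (update V i v) c = scoreWithout k V i c +
    if c ∈ v.top k then 1 else 0 := by
  have : scoreWithout k (update V i v) i c = scoreWithout k V i c :=
    congrArg card (filter_congr fun j _ => and_congr_right fun hj => by rw [update_of_ne hj])
  rw [score_eq i, update_self, this]

/-- An extra point for being preferred by the tie-breaking order turns the lexicographic comparison
of integer scores into a single inequality. -/
theorem kApproval_eq_iff : kApproval k hk tie V = p ↔
    ∀ c, score k V c + (if tie.symm c < tie.symm p then 1 else 0) ≤ score k V p := by
  have key : ∀ d, d ≠ kApproval k hk tie V → Beats k tie V (kApproval k hk tie V) d :=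
    (exists_beats_all k hk tie V).choose_spec
  constructor
  · rintro rfl c
    by_cases hc : c = kApproval k hk tie V
    · simp [hc]
    · obtain h | ⟨h, h'⟩ := key c hc
      · split_ifs <;> omega
      · rw [if_neg (lt_asymm h')]
        omega
  · intro h
    by_contra hne
    have h1 := h (kApproval k hk tie V)
    obtain h2 | ⟨h2, h3⟩ := key p (Ne.symm hne)
    · split_ifs at h1 <;> omega
    · rw [if_pos (show tie.symm _ < tie.symm p from h3)] at h1
      omega

theorem winner_update (h : kApproval k hk tie (update V i v) = p) (c : Fin m) :
    scoreWithout k V i c + (if c ∈ v.top k then 1 else 0) +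
        (if tie.symm c < tie.symm p then 1 else 0) ≤
      scoreWithout k V i p + if p ∈ v.top k then 1 else 0 := by
  have := kApproval_eq_iff.1 h c
  rwa [score_update, score_update] at this

theorem winner_self (h : kApproval k hk tie V = p) (i : Fin n) (c : Fin m) :
    scoreWithout k V i c + (if c ∈ (V i).top k then 1 else 0) +
        (if tie.symm c < tie.symm p then 1 else 0) ≤
      scoreWithout k V i p + if p ∈ (V i).top k then 1 else 0 := by
  have := kApproval_eq_iff.1 h c
  rwa [score_eq i, score_eq i] at this

/-- A manipulator approves the new winner. -/
theorem Manipulative.mem_top (h : Manipulative (kApproval k hk tie) V i v) :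
    kApproval k hk tie (update V i v) ∈ v.top k := by
  have h1 := winner_update (rfl : kApproval k hk tie (update V i v) = _) (kApproval k hk tie V)
  have h2 := winner_self (rfl : kApproval k hk tie V = _) i (kApproval k hk tie (update V i v))
  -- The old winner can lose a point only if he was sincerely approved; then so was the new winner,
  -- who is preferred, and who loses a point as well if not approved by `v`. So without the approval
  -- of `v` he cannot overtake.
  have h3 : kApproval k hk tie V ∈ (V i).top k →
    kApproval k hk tie (update V i v) ∈ (V i).top k := Vote.Prefers.mem_top h
  have h4 := tie.prefers_or h.ne
  unfold Vote.Prefers at h4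
  by_contra hp
  rw [if_neg hp] at h1
  obtain h4 | h4 := h4
  · rw [if_pos h4] at h2
    split_ifs at h1 h2 <;> first | omega | tauto
  · rw [if_pos h4] at h1
    split_ifs at h1 h2 <;> first | omega | tauto

end winner

/-! ### Minimal manipulations -/

section minimal

variable {n m : ℕ} {hm : 2 < m} {tie : Vote m} {V : Profile n m} {i : Fin n} {v u : Vote m}

/-- With at least `k` swaps all of the top `k` candidates are exchanged for candidates outside. -/
theorem IsSwap.notMem {k ℓ : ℕ} (h : IsSwap k v ℓ u) (hk : k ≤ m) (hℓ : k ≤ ℓ) :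
    ∀ c ∈ v.top k, c ∉ u.top k := by
  obtain ⟨x, y, hx, -, hxv, hyv, hswap, -⟩ := h
  intro c hc
  have : univ.image x = v.top k := by
    refine eq_of_subset_of_card_le ?_ ?_
    · intro d hd
      obtain ⟨j, -, rfl⟩ := mem_image.1 hd
      exact hxv j
    · rw [card_image_of_injective _ hx, card_univ, Fintype.card_fin, Vote.card_top hk]
      exact hℓ
  rw [← this] at hc
  obtain ⟨j, -, rfl⟩ := mem_image.1 hc
  have := hyv j
  rw [Vote.mem_top] at this ⊢
  rwa [(hswap j).1]

/-- A top candidate that takes part in no swap keeps its position. -/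
theorem IsSwap.le_of_disjoint {ℓ : ℕ} (h : IsSwap 2 v ℓ u) (hm : 2 < m)
    (hd : ∀ c ∈ v.top 2, c ∉ u.top 2) : 2 ≤ ℓ := by
  obtain ⟨x, y, -, -, -, hyv, -, hrest⟩ := h
  have : v.top 2 ⊆ univ.image x := by
    intro c hc
    by_contra hcx
    refine hd c hc ?_
    rw [Vote.mem_top, hrest c, ← Vote.mem_top]
    · exact hc
    · refine fun j => ⟨?_, ?_⟩
      · rintro rfl
        exact hcx (mem_image_of_mem _ (mem_univ _))
      · rintro rfl
        exact hyv j hc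
  have := (card_le_card this).trans card_image_le
  rwa [Vote.card_top hm.le, card_univ, Fintype.card_fin] at this

/-- Let all the other voters approve `a` and a candidate `y` that is approved by `u` but not by `v`.
Then `a` wins under `v`; under `u`, if `a` were not approved, `y` would be ahead. At least one other
voter is needed. -/
theorem Equivalent.mem_top (hn : 2 ≤ n) (h : Equivalent (n := n) (kApproval 2 hm tie) u v)
    {a : Fin m} (ha : a ∈ v.top 2) : a ∈ u.top 2 := by
  by_contra hau
  obtain ⟨a', p, hne, hv⟩ := v.exists_eq_top hm
  obtain ⟨p, hvp, hap⟩ : ∃ p, v.top 2 = {a, p} ∧ a ≠ p := by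
    rw [hv, mem_insert, mem_singleton] at ha
    obtain rfl | rfl := ha
    · exact ⟨p, hv, hne⟩
    · exact ⟨a', by rw [hv, pair_comm], hne.symm⟩
  obtain ⟨y, hy, hyp⟩ : ∃ y ∈ u.top 2, y ≠ p := by
    obtain ⟨b, b', hb, hu⟩ := u.exists_eq_top hm
    by_cases h : b = p
    · exact ⟨b', by simp [hu], fun h' => hb (h.trans h'.symm)⟩
    · exact ⟨b, by simp [hu], h⟩
  have hay : a ≠ y := by
    rintro rfl
    exact hau hy
  obtain ⟨w, hw⟩ := Vote.exists_top_eq hm hay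
  let i : Fin n := ⟨0, by omega⟩
  have hs : ∀ c, scoreWithout 2 (fun _ : Fin n => w) i c = if c ∈ w.top 2 then n - 1 else 0 := by
    intro c
    rw [scoreWithout]
    split_ifs with hc
    · simp only [hc, and_true]
      rw [filter_ne', card_erase_of_mem (mem_univ _), card_univ, Fintype.card_fin]
    · simp [hc]
  have hwin : kApproval 2 hm tie (update (fun _ : Fin n => w) i v) = a := by
    rw [kApproval_eq_iff]
    intro c
    rw [score_update, score_update, hs, hs, hw, hvp]
    simp only [mem_insert, mem_singleton, true_or, if_true]
    by_cases hca : c = a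
    · simp [hca]
    · have : ¬ (c = y ∧ c = p) := by
        rintro ⟨rfl, rfl⟩
        exact hyp rfl
      simp only [hca, false_or]
      split_ifs <;> omega
  have hwin' := winner_update ((h i fun _ => w).trans hwin) y
  rw [hs, hs, hw, if_pos hy, if_neg hau] at hwin'
  simp only [mem_insert, mem_singleton, true_or, or_true, if_true] at hwin'
  omega

/-- A minimal manipulation keeps one of the approved candidates. -/
theorem IsMinimalManipulation.exists_common (hn : 2 ≤ n)
    (h : IsMinimalManipulation 2 hm tie V i v) : ∃ c ∈ (V i).top 2, c ∈ v.top 2 := by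
  obtain ⟨hman, ℓ, hswap, hmin⟩ := h
  by_contra! hd
  have hℓ := hswap.le_of_disjoint hm hd
  have hp := hman.mem_top
  set p := kApproval 2 hm tie (update V i v) with hpdef
  have hpV : p ∉ (V i).top 2 := fun h => hd p h hp
  obtain ⟨a, b, hab, hV⟩ := (V i).exists_eq_top hm
  have ha : a ∈ (V i).top 2 := by simp [hV]
  have hpa : a ≠ p := by
    rintro rfl
    exact hpV ha
  obtain ⟨v', hv'⟩ := Vote.exists_top_eq hm hpa
  set w := kApproval 2 hm tie V with hwdef
  have hpw : (V i).Prefers p w := hman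
  have hw : w ∉ (V i).top 2 := fun h => hpV (hpw.mem_top h)
  have hwin : kApproval 2 hm tie (update V i v') = p := by
    rw [kApproval_eq_iff]
    intro c
    rw [score_update, score_update, hv']
    simp only [mem_insert, mem_singleton, or_true, if_true]
    have h1 := winner_update hpdef.symm c
    rw [if_pos hp] at h1
    -- Sincerely, `a` does not defeat `w`, even with the approval of `i`; and `w`, whom `i` does not
    -- sincerely approve, does not defeat `p` after the manipulation. So `a` does not defeat `p`
    -- either.
    by_cases hca : c = a
    · subst hca
      have h2 := winner_self hwdef.symm i c
      have h3 := winner_update hpdef.symm w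
      rw [if_pos hp] at h3
      rw [if_pos ha, if_neg hw] at h2
      simp only [true_or, if_true]
      split_ifs at h2 h3 ⊢ <;> omega
    · by_cases hcp : c = p
      · simp [hcp]
      · simp only [hca, hcp, or_false, if_false]
        omega
  -- By minimality `v'` is equivalent to a vote with at least two swaps, which approves none of the
  -- sincere candidates, although `v'` approves `a`.
  obtain ⟨u, ℓ', hu, heq, hle⟩ := hmin v' (by
    rintro rfl
    exact hd a ha (by simp [hv'])) (by
    change (V i).Prefers _ _
    rwa [hwin])
  exact hu.notMem hm.le (hℓ.trans hle) a ha (heq.mem_top hn (by simp [hv']))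

end minimal

theorem IsLevelOne.winner_eq {n m : ℕ} {R : VotingRule n m} {V : Profile n m} {i : Fin n}
    {v v' : Vote m} (h : IsLevelOne R V i v) (h' : IsLevelOne R V i v') :
    R (update V i v) = R (update V i v') := by
  by_contra hne
  exact (h _ ⟨v', rfl⟩ (Ne.symm hne)).asymm (h' _ ⟨v, rfl⟩ hne)

/-- The place where minimality and level-1 rationality enter. A minimal manipulation shares a
candidate with the sincere vote; two of them elect the same best feasible candidate, whom a
manipulator has to approve. -/
theorem Instance.overlap (I : Instance) : I.Overlap := by
  classical
  intro i v hv v' hv'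
  by_cases hi : i ∈ manipulators (kApproval 2 I.hm I.tie) I.V ∧ i ≠ ⟨0, I.hn⟩
  · have hn : 2 ≤ I.n := by
      have h1 := i.2
      have h2 : (i : ℕ) ≠ 0 := fun h => hi.2 (Fin.ext h)
      omega
    have hmin := I.minimal i hi.1 hi.2
    have hone := I.level_one i hi.1 hi.2
    have htop : ∃ c, c ∈ (I.V i).top 2 := by
      obtain ⟨a, b, -, h⟩ := (I.V i).exists_eq_top I.hm
      exact ⟨a, by simp [h]⟩
    by_cases h : v = I.V i
    · subst h
      by_cases h' : v' = I.V i
      · subst h'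
        obtain ⟨c, hc⟩ := htop
        exact ⟨c, hc, hc⟩
      · exact ((hmin v' hv').resolve_left h').exists_common hn
    · have hv1 := (hmin v hv).resolve_left h
      by_cases h' : v' = I.V i
      · subst h'
        obtain ⟨c, hc, hc'⟩ := hv1.exists_common hn
        exact ⟨c, hc', hc⟩
      · have hv2 := (hmin v' hv').resolve_left h'
        refine ⟨_, hv1.1.mem_top, ?_⟩
        rw [((hone v hv).resolve_left h).winner_eq ((hone v' hv').resolve_left h')]
        exact hv2.1.mem_top
  · rw [I.not_listed i hi] at hv
    simp at hv

end GSVoting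

/-! ### Dominance in GS-games -/

namespace GSVoting

open Finset Function
open Computability (Γ')

namespace Instance

variable (I : Instance)

/-- The profile in which the first voter casts `u`, and the others vote according to `s`. -/
def profile (u : Vote I.m) (s : I.Other → Vote I.m) : Profile I.n I.m :=
  fun i => if h : i = I.one then u else s ⟨i, h⟩

/-- The winner if the first voter casts `u`, and the others vote according to `s`. -/
noncomputable def winner (u : Vote I.m) (s : I.Other → Vote I.m) : Fin I.m :=
  kApproval 2 I.hm I.tie (I.profile u s)

/-- The first voter may prefer `u` to `v`. -/
def MayPrefer (u v : Vote I.m) : Prop :=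
  ∃ s : I.Other → Vote I.m, (∀ i : I.Other, s i ∈ I.options i) ∧
    (I.V I.one).Prefers (I.winner u s) (I.winner v s)

variable {I} {u v v' : Vote I.m} {a b a' b' : Fin I.m}

theorem profile_one (s : I.Other → Vote I.m) : I.profile u s I.one = u := dif_pos rfl

theorem profile_other (s : I.Other → Vote I.m) {i : Fin I.n} (hi : i ≠ I.one) :
    I.profile u s i = s ⟨i, hi⟩ := dif_neg hi

theorem score_profile (s : I.Other → Vote I.m) (c : Fin I.m) :
    score 2 (I.profile u s) c = #{i | c ∈ (s i).top 2} + if c ∈ u.top 2 then 1 else 0 := by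
  rw [score_eq I.one, profile_one, scoreWithout, ← card_map (Embedding.subtype _)]
  congr 2
  ext i
  simp only [mem_filter, mem_univ, true_and, mem_map, Embedding.subtype_apply, Subtype.exists,
    exists_and_right, exists_eq_right]
  constructor
  · rintro ⟨h, h'⟩
    rw [profile_other s h] at h'
    exact ⟨h, h'⟩
  · rintro ⟨h, h'⟩
    rw [profile_other s h]
    exact ⟨h, h'⟩

theorem winner_eq_iff (hu : u.top 2 = {a, b}) {s : I.Other → Vote I.m} {p : Fin I.m} :
    I.winner u s = p ↔ ∀ c, I.Defends s a b p c := by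
  rw [winner, kApproval_eq_iff]
  refine forall_congr' fun c => ?_
  rw [score_profile, score_profile, hu, Defends]
  simp only [mem_insert, mem_singleton]

theorem profitable_iff_mayPrefer (o : Option (Vote I.m)) (hu : u.top 2 = {a, b})
    (hv : v.top 2 = {a', b'}) : (Tag.arena (I.word o)).Profitable (I.cand o a) (I.cand o b)
      (I.cand o a') (I.cand o b') ↔ I.MayPrefer v u := by
  rw [profitable_iff o I.overlap]
  refine exists_congr fun s => and_congr_right fun _ => ?_
  simp only [← winner_eq_iff hu, ← winner_eq_iff hv]
  constructor
  · rintro ⟨p, q, h, rfl, rfl⟩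
    exact h
  · intro h
    exact ⟨_, _, h, rfl, rfl⟩

open Classical in
theorem mem_options_outcome (t : ∀ i, I.game.Strategy i) (i : I.Other) :
    I.game.outcomeProfile t i ∈ I.options i := by
  rw [GSGame.outcomeProfile]
  split_ifs with h
  · exact Or.inr ((t ⟨i, h⟩).2.resolve_left i.2)
  · refine Or.inl ⟨I.not_listed i fun h' => h (Or.inl h'.1), rfl⟩

theorem outcomeProfile_update (t : ∀ i, I.game.Strategy i) (u : Vote I.m) :
    I.game.outcomeProfile (update t ⟨I.one, Or.inr rfl⟩ ⟨u, Or.inl rfl⟩) =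
      I.profile u fun i => I.game.outcomeProfile t i := by
  funext i
  by_cases hi : i = I.one
  · subst hi
    rw [profile_one, GSGame.outcomeProfile]
    split_ifs with h
    · rw [update_self]
    · exact (h (Or.inr rfl)).elim
  · rw [profile_other _ hi, GSGame.outcomeProfile, GSGame.outcomeProfile]
    split_ifs with h
    · rw [update_of_ne]
      intro h'
      exact hi (congrArg Subtype.val h')
    · rfl

/-- Players other than the first have nonempty lists, as these contain the sincere votes; voters who
are not players have empty lists and vote sincerely. So selections of options are exactly what
strategy profiles produce. -/
theorem exists_outcomeProfile {s : I.Other → Vote I.m} (hs : ∀ i : I.Other, s i ∈ I.options i) :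
    ∃ t : ∀ i, I.game.Strategy i, ∀ i : I.Other, I.game.outcomeProfile t i = s i := by
  classical
  refine ⟨fun i => if h : i.1 = I.one then ⟨I.V i.1, Or.inl h⟩ else ⟨s ⟨i.1, h⟩, Or.inr ?_⟩,
    fun i => ?_⟩
  · obtain ⟨hA, -⟩ | h' := hs ⟨i.1, h⟩
    · have := I.truthful_mem i.1 (i.2.resolve_right h) h
      rw [hA] at this
      simp at this
    · exact h'
  · rw [GSGame.outcomeProfile]
    split_ifs with h h'
    · exact (i.2 h').elim
    · rfl
    · obtain ⟨-, h'⟩ | h' := hs i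
      · exact h'.symm
      · rw [I.not_listed i fun h'' => h (Or.inl h''.1)] at h'
        simp at h'

/-- By linearity, weak preference is the failure of the opposite strict preference, so the two
clauses of dominance become statements about `MayPrefer`. -/
theorem dominates_iff : I.game.Dominates u v ↔ ¬ I.MayPrefer v u ∧ I.MayPrefer u v := by
  have weak : ∀ p q : Fin I.m,
      ((I.V I.one).Prefers p q ∨ p = q) ↔ ¬ (I.V I.one).Prefers q p := by
    intro p q
    constructor
    · rintro (h | rfl)
      · exact h.asymm
      · exact fun h => h.ne rfl
    · intro h
      by_cases hpq : p = q
      · exact Or.inr hpq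
      · exact Or.inl ((Vote.prefers_or hpq).resolve_right h)
  have hpref : ∀ (t : ∀ i, I.game.Strategy i) (x y : Vote I.m),
      I.game.toGame.pref ⟨I.one, Or.inr rfl⟩ (update t ⟨I.one, Or.inr rfl⟩ ⟨x, Or.inl rfl⟩)
        (update t ⟨I.one, Or.inr rfl⟩ ⟨y, Or.inl rfl⟩) ↔
      ¬ (I.V I.one).Prefers (I.winner y fun i => I.game.outcomeProfile t i)
        (I.winner x fun i => I.game.outcomeProfile t i) := by
    intro t x y
    rw [← weak, winner, winner, ← outcomeProfile_update, ← outcomeProfile_update]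
    rfl
  have hex : ∀ x y : Vote I.m, I.MayPrefer x y ↔ ∃ t : ∀ i, I.game.Strategy i,
      (I.V I.one).Prefers (I.winner x fun i => I.game.outcomeProfile t i)
        (I.winner y fun i => I.game.outcomeProfile t i) := by
    intro x y
    constructor
    · rintro ⟨s, hs, h⟩
      obtain ⟨t, ht⟩ := exists_outcomeProfile hs
      refine ⟨t, ?_⟩
      rwa [funext ht]
    · rintro ⟨t, h⟩
      exact ⟨_, mem_options_outcome t, h⟩
  rw [hex, hex, not_exists]
  refine and_congr (forall_congr' fun t => hpref t u v) (exists_congr fun t => ?_)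
  refine (and_congr (hpref t u v) (not_congr (hpref t v u))).trans ?_
  rw [not_not]
  exact ⟨fun h => h.2, fun h => ⟨h.asymm, h⟩⟩

theorem dominates_irrefl (u : Vote I.m) : ¬ I.game.Dominates u u := by
  rw [dominates_iff]
  exact fun h => h.1 h.2

theorem dominates_trans {w : Vote I.m} (h : I.game.Dominates u v) (h' : I.game.Dominates v w) :
    I.game.Dominates u w := by
  rw [dominates_iff] at *
  have weak : ∀ {x y}, ¬ I.MayPrefer x y → ∀ s : I.Other → Vote I.m,
      (∀ i : I.Other, s i ∈ I.options i) →
      (I.V I.one).Prefers (I.winner y s) (I.winner x s) ∨ I.winner y s = I.winner x s := by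
    intro x y hxy s hs
    by_cases h : I.winner y s = I.winner x s
    · exact Or.inr h
    · exact Or.inl ((Vote.prefers_or h).resolve_right fun h => hxy ⟨s, hs, h⟩)
  obtain ⟨h1, s, hs, h2⟩ := h
  refine ⟨?_, s, hs, ?_⟩
  · rintro ⟨t, ht, h3⟩
    obtain h4 | h4 := weak h1 t ht
    · obtain h5 | h5 := weak h'.1 t ht
      · exact (h3.trans (h4.trans h5)).ne rfl
      · rw [h5] at h4
        exact h3.asymm h4
    · rw [h4] at h3
      exact h'.1 ⟨t, ht, h3⟩
  · obtain h3 | h3 := weak h'.1 s hs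
    · exact h2.trans h3
    · rwa [← h3]

/-- Dominance is irreflexive and transitive on a finite nonempty set. -/
theorem exists_isLevelTwo (I : Instance) : ∃ v, I.game.IsLevelTwo v := by
  let r : Vote I.m → Vote I.m → Prop := I.game.Dominates
  have : IsTrans _ r := ⟨fun _ _ _ => dominates_trans⟩
  have : Std.Irrefl r := ⟨dominates_irrefl⟩
  obtain ⟨v, -, hv⟩ := (Finite.wellFounded_of_trans_of_irrefl r).has_min Set.univ ⟨I.V I.one, trivial⟩
  exact ⟨v, fun u _ => hv u trivial⟩

theorem tag_dominates_iff (o : Option (Vote I.m)) (hu : u.top 2 = {a, b})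
    (hv : v.top 2 = {a', b'}) : Tag.Dominates (I.word o) (I.cand o a) (I.cand o b)
      (I.cand o a') (I.cand o b') ↔ I.game.Dominates u v := by
  rw [Tag.Dominates, profitable_iff_mayPrefer o hu hv, profitable_iff_mayPrefer o hv hu,
    dominates_iff]

/-- Every pair of distinct candidates is the approved pair of some vote, so that quantifying over
pairs replaces quantifying over the `m!` votes. -/
theorem tag_levelTwo_iff : Tag.LevelTwo (I.word (some v)) ↔ I.game.IsLevelTwo v := by
  constructor
  · intro h u _ hd
    obtain ⟨a, b, hab, hu⟩ := u.exists_eq_top I.hm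
    obtain ⟨c, d, hcd, hv⟩ := v.exists_eq_top I.hm
    exact h _ (cand_lt _ c) _ (cand_lt _ d) (marked_query.2 ⟨c, by simp [hv], rfl⟩)
      (marked_query.2 ⟨d, by simp [hv], rfl⟩) ((cand_injective _).ne hcd) _ (cand_lt _ a) _
      (cand_lt _ b) ((at_tie _).2 ⟨a, rfl⟩) ((at_tie _).2 ⟨b, rfl⟩) ((cand_injective _).ne hab)
      ((tag_dominates_iff _ hu hv).2 hd)
  · intro h _ _ _ _ hc' hd' hcd _ _ _ _ ha' hb' hab hdom
    obtain ⟨c, hc, rfl⟩ := marked_query.1 hc'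
    obtain ⟨d, hd, rfl⟩ := marked_query.1 hd'
    obtain ⟨a, rfl⟩ := (at_tie _).1 ha'
    obtain ⟨b, rfl⟩ := (at_tie _).1 hb'
    obtain ⟨u, hu⟩ := Vote.exists_top_eq I.hm (ne_of_apply_ne _ hab)
    rw [tag_dominates_iff _ hu (Vote.top_eq I.hm hc hd (ne_of_apply_ne _ hcd))] at hdom
    refine h u ?_ hdom
    rintro rfl
    exact dominates_irrefl _ hdom

theorem tag_improving_iff : Tag.Improving (I.word (some v)) ↔ I.game.IsImproving v := by
  constructor
  · rintro ⟨_, -, _, -, hc', hd', hcd, _, -, _, -, ha', hb', hab, hdom⟩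
    obtain ⟨c, hc, rfl⟩ := (marked_one _).1 hc'
    obtain ⟨d, hd, rfl⟩ := (marked_one _).1 hd'
    obtain ⟨a, ha, rfl⟩ := marked_query.1 ha'
    obtain ⟨b, hb, rfl⟩ := marked_query.1 hb'
    exact (tag_dominates_iff _ (Vote.top_eq I.hm ha hb (ne_of_apply_ne _ hab))
      (Vote.top_eq I.hm hc hd (ne_of_apply_ne _ hcd))).1 hdom
  · intro hdom
    obtain ⟨a, b, hab, hu⟩ := v.exists_eq_top I.hm
    obtain ⟨c, d, hcd, hv⟩ := (I.V I.one).exists_eq_top I.hm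
    exact ⟨_, cand_lt _ c, _, cand_lt _ d, (marked_one _).2 ⟨c, by simp [hv], rfl⟩,
      (marked_one _).2 ⟨d, by simp [hv], rfl⟩, (cand_injective _).ne hcd, _, cand_lt _ a, _,
      cand_lt _ b, marked_query.2 ⟨a, by simp [hu], rfl⟩, marked_query.2 ⟨b, by simp [hu], rfl⟩,
      (cand_injective _).ne hab, (tag_dominates_iff _ hu hv).2 hdom⟩

theorem tag_existsImproving_iff :
    Tag.ExistsImproving (I.word none) ↔ ∃ v, I.game.IsImproving v := by
  constructor
  · rintro ⟨_, -, _, -, hc', hd', hcd, _, -, _, -, ha', hb', hab, hdom⟩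
    obtain ⟨c, hc, rfl⟩ := (marked_one _).1 hc'
    obtain ⟨d, hd, rfl⟩ := (marked_one _).1 hd'
    obtain ⟨a, rfl⟩ := (at_tie _).1 ha'
    obtain ⟨b, rfl⟩ := (at_tie _).1 hb'
    obtain ⟨u, hu⟩ := Vote.exists_top_eq I.hm (ne_of_apply_ne _ hab)
    exact ⟨u, (tag_dominates_iff _ hu (Vote.top_eq I.hm hc hd (ne_of_apply_ne _ hcd))).1 hdom⟩
  · rintro ⟨u, hdom⟩
    obtain ⟨a, b, hab, hu⟩ := u.exists_eq_top I.hm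
    obtain ⟨c, d, hcd, hv⟩ := (I.V I.one).exists_eq_top I.hm
    exact ⟨_, cand_lt _ c, _, cand_lt _ d, (marked_one _).2 ⟨c, by simp [hv], rfl⟩,
      (marked_one _).2 ⟨d, by simp [hv], rfl⟩, (cand_injective _).ne hcd, _, cand_lt _ a, _,
      cand_lt _ b, (at_tie _).2 ⟨a, rfl⟩, (at_tie _).2 ⟨b, rfl⟩, (cand_injective _).ne hab,
      (tag_dominates_iff _ hu hv).2 hdom⟩

end Instance

open StackProg in
/-- A property is decidable in polynomial time, if it is defined by a sentence about the tags. -/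
theorem decidableInPolyTime {α : Type} {enc : α → List Γ'} {P : α → Prop} {Q : List Tag → Prop}
    (hQ : Definable fun w (_ : Empty → ℕ) (_ : Empty → Set ℕ) => Q w)
    (h : ∀ a, Q (tagger.run tagger.init (enc a)) ↔ P a) : DecidableInPolyTime enc P := by
  classical
  exact ⟨fun a => decide (P a), fun a => decide_eq_true_iff,
    Definable.decidableInPolyTime tagger hQ _ fun a => decide_eq_true_iff.trans (h a).symm⟩

end GSVoting

theorem mainTheorem5 :
    GSVoting.DecidableInPolyTime GSVoting.encodeQuery (fun q => q.1.game.IsLevelTwo q.2) ∧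
    GSVoting.DecidableInPolyTime GSVoting.encodeQuery (fun q => q.1.game.IsImproving q.2) ∧
    GSVoting.DecidableInPolyTime GSVoting.encodeInstance
      (fun I => ∃ v : GSVoting.Vote I.m, I.game.IsLevelTwo v) ∧
    GSVoting.DecidableInPolyTime GSVoting.encodeInstance
      (fun I => ∃ v : GSVoting.Vote I.m, I.game.IsImproving v) := by
  refine ⟨?_, ?_, ?_, ?_⟩
  · refine GSVoting.decidableInPolyTime GSVoting.Tag.definable_levelTwo fun q => ?_
    rw [GSVoting.tagger_query]
    exact GSVoting.Instance.tag_levelTwo_iff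
  · refine GSVoting.decidableInPolyTime GSVoting.Tag.definable_improving fun q => ?_
    rw [GSVoting.tagger_query]
    exact GSVoting.Instance.tag_improving_iff
  -- The answer is always yes, so any valid sentence defines the property.
  · refine GSVoting.decidableInPolyTime (Q := fun w => ∀ x < w.length, x ≤ x)
      (StackProg.Definable.all (StackProg.Definable.le _ _)) fun I => ?_
    exact iff_of_true (fun _ _ => le_rfl) I.exists_isLevelTwo
  · refine GSVoting.decidableInPolyTime GSVoting.Tag.definable_existsImproving fun I => ?_
    rw [GSVoting.tagger_instance]
    exact GSVoting.Instance.tag_existsImproving_iff
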